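/- Let $\mathbf H$ be a real or complex Hilbert space, and let $T_1(t),\dots,T_d(t)$, $t\ge 0$, be strongly continuous one-parameter semigroups of contractions on $\mathbf H$ ($\|T_j(t)\|\le 1$) with infinitesimal generators $D_1,\dots,D_d$. For $r\in\mathbb N$, $r\ge 1$, let $\mathbf H^r$ be the space of all $f\in\mathbf H$ for which $D_{j_1}\cdots D_{j_k}f$ is defined for all $1\le k\le r$ and all $1\le j_1,\dots,j_k\le d$, with the norm $$\|f\|_{\mathbf H^r}=\|f\|+\sum_{k=1}^{r}\ \sum_{1\le j_1,\dots,j_k\le d}\|D_{j_1}\cdots D_{j_k}f\| .$$ Write $Tf(t_1,\dots,t_d)=T_1(t_1)T_2(t_2)\cdots T_d(t_d)f$ for $t_1,\dots,t_d\ge 0$. Assume that (a) $\mathbf H^1=\bigcap_{i}\mathcal D(D_i)$ is dense in $\mathbf H$; (b) $\mathbf H^1$ is invariant under all $T_i(t)$, $1\le i\le d$, $t\ge 0$; (c) there are functions $\zeta_i^k$ ($1\le i,k\le d$), $C^\infty$ on the open unit ball $U$ of $\mathbb R^d$, such that for every $1\le i\le d$, every $f\in\mathbf H^1$ and every $\mathbf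 t\in U$ with non-negative coordinates $$D_i\,Tf(\mathbf t)=\sum_{k=1}^{d}\zeta_i^k(\mathbf t)\,(\partial_k Tf)(\mathbf t),\qquad \partial_k=\partial/\partial t_k$$ (with $\partial_k$ taken from the right where $t_k=0$). For $f\in\mathbf H$ and $s\ge 0$ define the mixed modulus of continuity and the $K$-functional $$\Omega^r(s,f)=\sum_{1\le j_1,\dots,j_r\le d}\ \sup_{0\le\tau_1\le s}\cdots\sup_{0\le\tau_r\le s}\bigl\|(T_{j_1}(\tau_1)-I)\cdots(T_{j_r}(\tau_r)-I)f\bigr\| ,$$ $$K(s^r,f,\mathbf H,\mathbf H^r)=\inf_{g\in\mathbf H^r}\bigl(\|f-g\|+s^r\|g\|_{\mathbf H^r}\bigr).$$ Then there are constants $c,C>0$, independent of $f$ and $s$, such that for all $f\in\mathbf H$ and all $s\ge 0$ $$c\,\Omega^r(s,f)\le K(s^r,f,\mathbf H,\mathbf H^r)\le C\bigl(\Omega^r(s,f)+s^r\|f\|\bigr).$$ -/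

import Mathlib

open Filter Topology
open scoped ContDiff

section SemigroupApproximation

variable {𝕜 H : Type*} [RCLike 𝕜] [NormedAddCommGroup H] [InnerProductSpace 𝕜 H]

/-- `T` restricted to `[0, ∞)` is a strongly continuous one-parameter semigroup of contractions.
The values `T t` for `t < 0` are never used. -/
structure IsContractionSemigroup (T : ℝ → H →L[𝕜] H) : Prop where
  map_zero : T 0 = 1
  map_add : ∀ s t : ℝ, 0 ≤ s → 0 ≤ t → T (s + t) = T s * T t
  norm_le_one : ∀ t : ℝ, 0 ≤ t → ‖T t‖ ≤ 1
  continuousOn : ∀ f : H, ContinuousOn (fun t : ℝ => T t f) (Set.Ici 0)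

/-- The difference quotient `(T(t) f - f) / t`. -/
noncomputable def semigroupQuotient (T : ℝ → H →L[𝕜] H) (f : H) (t : ℝ) : H :=
  ((t : 𝕜)⁻¹) • (T t f - f)

/-- The domain of the infinitesimal generator of `T`: the vectors `f` for which
`(T(t) f - f) / t` converges in norm as `t → 0+`. -/
def generatorDomain (T : ℝ → H →L[𝕜] H) : Set H :=
  {f | ∃ g : H, Tendsto (semigroupQuotient T f) (𝓝[>] 0) (𝓝 g)}

/-- The infinitesimal generator of `T`, meaningful on `generatorDomain T`. -/
noncomputable def generator (T : ℝ → H →L[𝕜] H) (f : H) : H :=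
  limUnder (𝓝[>] 0) (semigroupQuotient T f)

variable {d : ℕ}

/-- The Sobolev-type space of order `r`: the vectors `f` such that `D_{j_1} ... D_{j_k} f` is
defined for all `k ≤ r` and all indices, where `D_j` is the generator of `T j`. -/
def sobolevSpace (T : Fin d → ℝ → H →L[𝕜] H) : ℕ → Set H
  | 0 => Set.univ
  | r + 1 => {f | ∀ j, f ∈ generatorDomain (T j) ∧ generator (T j) f ∈ sobolevSpace T r}

/-- The mixed derivative `D_{j_1} ... D_{j_k} f` (with `D_{j_k}` applied first). -/
noncomputable def mixedDeriv (T : Fin d → ℝ → H →L[𝕜] H) {k : ℕ} (j : Fin k → Fin d) (f : H) : H :=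
  (List.ofFn j).foldr (fun i g => generator (T i) g) f

/-- The Sobolev norm `‖f‖ + ∑_{k=1}^{r} ∑_{j_1, ..., j_k} ‖D_{j_1} ... D_{j_k} f‖`. -/
noncomputable def sobolevNorm (T : Fin d → ℝ → H →L[𝕜] H) (r : ℕ) (f : H) : ℝ :=
  ‖f‖ + ∑ k ∈ Finset.Icc 1 r, ∑ j : Fin k → Fin d, ‖mixedDeriv T j f‖

/-- The vector `T_1(t_1) T_2(t_2) ... T_d(t_d) f`. -/
noncomputable def orbitMap (T : Fin d → ℝ → H →L[𝕜] H) (f : H)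
    (t : EuclideanSpace ℝ (Fin d)) : H :=
  (List.ofFn fun k => T k (t k)).prod f

/-- `v` is the partial derivative, with respect to the `k`-th variable, at the point `t` of the
function `t ↦ T_1(t_1) ... T_d(t_d) f` on `[0, ∞)^d` (two-sided if `t k > 0`, and from the right
if `t k = 0`). -/
def HasOrbitPartialDeriv (T : Fin d → ℝ → H →L[𝕜] H) (f : H) (k : Fin d)
    (t : EuclideanSpace ℝ (Fin d)) (v : H) : Prop :=
  Tendsto (fun h : ℝ => ((h : 𝕜)⁻¹) •
      (orbitMap T f (t + EuclideanSpace.single k h) - orbitMap T f t))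
    (𝓝[{h : ℝ | h ≠ 0 ∧ 0 ≤ t k + h}] 0) (𝓝 v)

/-- The structural identity
`D_i T_1(t_1) ... T_d(t_d) f = ∑_k ζ_i^k(t) ∂_k (T_1(t_1) ... T_d(t_d) f)` for all `i`, all `f` in
the intersection of the domains and all `t` in the open unit ball with non-negative coordinates,
with coefficients `ζ_i^k` that are smooth in the open unit ball. -/
def SatisfiesStructureIdentity (T : Fin d → ℝ → H →L[𝕜] H) : Prop :=
  ∃ ζ : Fin d → Fin d → EuclideanSpace ℝ (Fin d) → 𝕜,
    (∀ i k, ContDiffOn ℝ ∞ (ζ i k) (Metric.ball 0 1)) ∧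
    ∀ i, ∀ f ∈ sobolevSpace T 1, ∀ t ∈ Metric.ball (0 : EuclideanSpace ℝ (Fin d)) 1,
      (∀ k, 0 ≤ t k) →
      ∃ v : Fin d → H, (∀ k, HasOrbitPartialDeriv T f k t (v k)) ∧
        generator (T i) (orbitMap T f t) = ∑ k, ζ i k t • v k

/-- The mixed modulus of continuity
`Ω^r(s, f) = ∑_{j_1, ..., j_r} sup ‖(T_{j_1}(τ_1) - I) ... (T_{j_r}(τ_r) - I) f‖`,
the supremum being over all `τ_1, ..., τ_r ∈ [0, s]`. -/
noncomputable def mixedModulus (T : Fin d → ℝ → H →L[𝕜] H) (r : ℕ) (s : ℝ) (f : H) : ℝ :=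
  ∑ j : Fin r → Fin d, ⨆ τ : Fin r → Set.Icc (0 : ℝ) s,
    ‖(List.ofFn fun i => T (j i) (τ i : ℝ) - 1).prod f‖

/-- The K-functional `K(u, f, H, H^r) = inf_{g ∈ H^r} (‖f - g‖ + u ‖g‖_{H^r})`. -/
noncomputable def kFunctional (T : Fin d → ℝ → H →L[𝕜] H) (r : ℕ) (u : ℝ) (f : H) : ℝ :=
  ⨅ g : sobolevSpace T r, (‖f - (g : H)‖ + u * sobolevNorm T r (g : H))

end SemigroupApproximation

/-! Two estimates are needed. On H^r, a product of r differences with steps at most s has norm O(s^r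
‖g‖_{H^r}); this gives the lower bound after splitting f = (f − g) + g. Conversely, for small s,
every f has an approximant g in H^r with ‖f − g‖ and s^r times the top derivatives of g bounded by
Ω^r(s, f), which gives the upper bound. Both need a commutation rule that the structure identity
does not state outright: for short times, D_i T_m(t) y = ∑_l E_il(t) T_m(t) D_l y on H^1, with C¹
coefficients and E(0) = I (`CommutesVia`).

The rule is proved by induction on m. On the m-th coordinate axis the structure identity expresses
D_i T_m(ρ) y through D_k T_m(ρ) y with k < m and T_m(ρ) D_k y with k ≥ m (`generator_orbit_eq_sum`),
so only the indices k < m are in question. Let P be the product of the T_k with k < m, through which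
generators can already be moved, and let A_φ y = ∫ φ(u) P(su) y du. Integration by parts shows that,
when ∫ φ = 1, the bounded operators s⁻¹ A_{∂_k φ} converge to −D_k on H^1. By Duhamel's formula
their commutators with T_m reduce to [D_m, A_φ], a sum of averages of generators against kernels of
size O(s). Absorption arguments bound these uniformly in s (`exists_kernelAverage_commutator_le`,
`exists_approxDefect_orbit_le`). Letting s → 0, the generators are bounded along orbits of T_m,
continuous at time 0, and their commutators with T_m are differentiable there, with some matrix Γ
(`exists_hasRegularOrbits`). Then ρ ↦ T_m(σ − ρ) D_i T_m(ρ) y solves a linear system with constant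
matrix Γ, and uniqueness gives the rule with E(t) = exp(tΓ) (`HasRegularOrbits.exists_commutesVia`).

Lower bound: since E(t) − I = O(t), T_m(t) − I maps H^{k+1} to H^k with norm O(t); apply this r
times (`exists_mixedModulus_le`).

Upper bound: now A averages over the full product T_1 ⋯ T_d against a kernel of integral one. The
structure identity and integration by parts turn D_i A f into s⁻¹ times averages of f against
derivatives of kernels. These have integral zero, so f may be subtracted under the integral: one
derivative costs s⁻¹ and one difference. The commutation rule allows iteration, so derivatives of
order r of A^r f are O(s^{-r} Ω^r). Since f − A^r f need not be small of order r, the approximant is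
g = A^r ∑_{i<r} (1 − A^r)^i f, for which f − g = (1 − A^r)^r f = Q (1 − A)^r f with Q bounded
(`exists_approximation`). Derivatives of intermediate order follow by Landau–Kolmogorov
interpolation (`exists_sobolevNorm_le`). -/

section Semigroup

/-! ### Calculus of a single contraction semigroup and its generator. -/

variable {𝕜 H : Type*} [RCLike 𝕜] [NormedAddCommGroup H] [InnerProductSpace 𝕜 H]

/-- `v` is the value of the infinitesimal generator of `T` at `f`. -/
def HasGenerator (T : ℝ → H →L[𝕜] H) (f v : H) : Prop :=
  Tendsto (semigroupQuotient T f) (𝓝[>] 0) (𝓝 v)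

namespace HasGenerator

variable {T : ℝ → H →L[𝕜] H} {f g v w : H}

theorem mem_generatorDomain (h : HasGenerator T f v) : f ∈ generatorDomain T := ⟨v, h⟩

theorem generator_eq (h : HasGenerator T f v) : generator T f = v := h.limUnder_eq

theorem of_mem (h : f ∈ generatorDomain T) : HasGenerator T f (generator T f) := by
  obtain ⟨v, hv⟩ := h
  have hv' : HasGenerator T f v := hv
  rw [hv'.generator_eq]
  exact hv

theorem add (h : HasGenerator T f v) (h' : HasGenerator T g w) :
    HasGenerator T (f + g) (v + w) := by
  refine (Tendsto.add h h').congr fun t => ?_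
  simp only [semigroupQuotient, map_add, ← smul_add]
  congr 1
  abel

theorem smul (c : 𝕜) (h : HasGenerator T f v) : HasGenerator T (c • f) (c • v) := by
  refine (Tendsto.const_smul h c).congr fun t => ?_
  simp only [semigroupQuotient, map_smul, ← smul_sub]
  rw [smul_comm]

theorem zero : HasGenerator T 0 0 := by
  refine tendsto_const_nhds.congr fun t => ?_
  simp [semigroupQuotient]

theorem sub (h : HasGenerator T f v) (h' : HasGenerator T g w) :
    HasGenerator T (f - g) (v - w) := by
  have := h.add (h'.smul (-1))
  simpa [sub_eq_add_neg] using this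

theorem sum {ι : Type*} (s : Finset ι) {f v : ι → H} (h : ∀ i ∈ s, HasGenerator T (f i) (v i)) :
    HasGenerator T (∑ i ∈ s, f i) (∑ i ∈ s, v i) := by
  classical
  induction s using Finset.induction_on with
  | empty => simpa using zero
  | insert a s ha ih =>
    rw [Finset.sum_insert ha, Finset.sum_insert ha]
    exact (h a (Finset.mem_insert_self _ _)).add
      (ih fun i hi => h i (Finset.mem_insert_of_mem hi))

end HasGenerator

namespace IsContractionSemigroup

variable {T : ℝ → H →L[𝕜] H} (hT : IsContractionSemigroup T)
include hT

theorem zero_apply (f : H) : T 0 f = f := by rw [hT.map_zero]; rfl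

theorem add_apply {s t : ℝ} (hs : 0 ≤ s) (ht : 0 ≤ t) (f : H) : T (s + t) f = T s (T t f) := by
  rw [hT.map_add s t hs ht]; rfl

theorem norm_apply_le {t : ℝ} (ht : 0 ≤ t) (f : H) : ‖T t f‖ ≤ ‖f‖ := by
  have := (T t).le_of_opNorm_le (hT.norm_le_one t ht) f
  simpa using this

/-- Contractivity upgrades strong continuity to joint continuity: T(τ)w splits as T(τ)(w − w₀) +
T(τ)w₀. -/
theorem tendsto_apply {ι : Type*} {l : Filter ι} {τ : ι → ℝ} {w : ι → H} {τ₀ : ℝ} {w₀ : H}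
    (h₀ : 0 ≤ τ₀) (hτ : Tendsto τ l (𝓝 τ₀)) (hpos : ∀ᶠ x in l, 0 ≤ τ x)
    (hw : Tendsto w l (𝓝 w₀)) : Tendsto (fun x => T (τ x) (w x)) l (𝓝 (T τ₀ w₀)) := by
  have h1 : Tendsto (fun x => T (τ x) (w x - w₀)) l (𝓝 0) := by
    refine squeeze_zero_norm' (a := fun x => ‖w x - w₀‖) ?_ ?_
    · filter_upwards [hpos] with x hx using hT.norm_apply_le hx _
    · simpa using (hw.sub_const w₀).norm
  have h2 : Tendsto (fun x => T (τ x) w₀) l (𝓝 (T τ₀ w₀)) :=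
    (hT.continuousOn w₀ τ₀ h₀).tendsto.comp (tendsto_nhdsWithin_iff.2 ⟨hτ, hpos⟩)
  have h3 := h1.add h2
  rw [zero_add] at h3
  refine h3.congr fun x => ?_
  simp

theorem continuousOn_apply {X : Type*} [TopologicalSpace X] {s : Set X} {τ : X → ℝ} {w : X → H}
    (hτ : ContinuousOn τ s) (hpos : ∀ x ∈ s, 0 ≤ τ x) (hw : ContinuousOn w s) :
    ContinuousOn (fun x => T (τ x) (w x)) s := fun x hx =>
  hT.tendsto_apply (hpos x hx) (hτ x hx)
    (eventually_nhdsWithin_of_forall hpos) (hw x hx)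

theorem hasGenerator_orbit {f v : H} (h : HasGenerator T f v) {t : ℝ} (ht : 0 ≤ t) :
    HasGenerator T (T t f) (T t v) := by
  refine (((T t).continuous.tendsto v).comp h).congr' ?_
  filter_upwards [self_mem_nhdsWithin] with x hx
  have hx0 : (0 : ℝ) ≤ x := le_of_lt hx
  simp only [Function.comp_apply, semigroupQuotient, map_smul, map_sub]
  rw [← hT.add_apply ht hx0, ← hT.add_apply hx0 ht, add_comm]

theorem eventually_norm_orbit_sub_le (v : H) {ε : ℝ} (hε : 0 < ε) :
    ∃ δ > 0, ∀ ρ, 0 ≤ ρ → ρ ≤ δ → ‖T ρ v - v‖ ≤ ε := by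
  have h := (hT.continuousOn v 0 Set.self_mem_Ici).tendsto
  rw [hT.zero_apply] at h
  have h' := (Metric.tendsto_nhdsWithin_nhds.1 h) ε hε
  obtain ⟨δ, hδ, hd⟩ := h'
  refine ⟨δ / 2, half_pos hδ, fun ρ h0 h1 => ?_⟩
  have := hd (x := ρ) h0 (by rw [Real.dist_eq, sub_zero, abs_of_nonneg h0]; linarith)
  rw [dist_eq_norm] at this
  exact this.le

variable [NormedSpace ℝ H] [IsScalarTower ℝ 𝕜 H]

omit hT in
theorem ofReal_inv_smul (t : ℝ) (x : H) : ((t : 𝕜)⁻¹) • x = t⁻¹ • x := by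
  rw [← RCLike.ofReal_inv, ← algebraMap_smul 𝕜 (t⁻¹) x]

omit hT in
theorem tendsto_slope_zero {f v : H} (h : HasGenerator T f v) :
    Tendsto (fun t : ℝ => t⁻¹ • (T t f - f)) (𝓝[>] 0) (𝓝 v) := by
  refine Tendsto.congr (fun t => ?_) h
  rw [semigroupQuotient, ofReal_inv_smul]

/-- On either side of t the slope equals T(min t t') applied to the difference quotient of f at |t'
− t|, so the one limit at 0+ and joint continuity give both one-sided derivatives. -/
theorem hasDerivWithinAt_orbit {f v : H} (h : HasGenerator T f v) {t : ℝ} (ht : 0 ≤ t) :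
    HasDerivWithinAt (fun t => T t f) (T t v) (Set.Ici 0) t := by
  rw [hasDerivWithinAt_iff_tendsto_slope]
  have habs : Tendsto (fun t' : ℝ => |t' - t|) (𝓝[Set.Ici 0 \ {t}] t) (𝓝[>] 0) := by
    refine tendsto_nhdsWithin_iff.2 ⟨?_, ?_⟩
    · have : Continuous fun t' : ℝ => |t' - t| := by fun_prop
      simpa using (this.tendsto t).mono_left nhdsWithin_le_nhds
    · filter_upwards [self_mem_nhdsWithin] with x hx
      exact abs_pos.2 (sub_ne_zero.2 hx.2)
  have hmin : Tendsto (fun t' : ℝ => min t t') (𝓝[Set.Ici 0 \ {t}] t) (𝓝 t) := by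
    have : Continuous fun t' : ℝ => min t t' := by fun_prop
    simpa using (this.tendsto t).mono_left nhdsWithin_le_nhds
  have hpos : ∀ᶠ t' in 𝓝[Set.Ici 0 \ {t}] t, 0 ≤ min t t' := by
    filter_upwards [self_mem_nhdsWithin] with x hx using le_min ht hx.1
  refine (hT.tendsto_apply ht hmin hpos ((tendsto_slope_zero h).comp habs)).congr' ?_
  filter_upwards [self_mem_nhdsWithin] with x hx
  have hx0 : (0 : ℝ) ≤ x := hx.1
  simp only [Function.comp_apply, slope_def_module]
  rcases le_total t x with htx | htx
  · rw [min_eq_left htx, abs_of_nonneg (sub_nonneg.2 htx), ContinuousLinearMap.map_smul_of_tower,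
      map_sub, ← hT.add_apply ht (sub_nonneg.2 htx), add_sub_cancel]
  · rw [min_eq_right htx, abs_of_nonpos (sub_nonpos.2 htx), neg_sub,
      ContinuousLinearMap.map_smul_of_tower, map_sub, ← hT.add_apply hx0 (sub_nonneg.2 htx),
      add_sub_cancel, ← neg_sub (T x f), smul_neg, ← neg_smul, ← inv_neg, neg_sub]

/-- Mean value inequality for ρ ↦ T(ρ)f − ρw. Leaving w free makes this serve the Lipschitz bound (w
= 0), closedness of the generator and the Landau inequality. -/
theorem norm_taylor_le {f v w : H} {t ε : ℝ} (h : HasGenerator T f v) (ht : 0 ≤ t)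
    (hε : ∀ ρ ∈ Set.Icc 0 t, ‖T ρ v - w‖ ≤ ε) : ‖T t f - f - t • w‖ ≤ ε * t := by
  have := norm_image_sub_le_of_norm_deriv_right_le_segment (a := 0) (b := t) (C := ε)
    (f := fun ρ => T ρ f - ρ • w) (f' := fun ρ => T ρ v - (1 : ℝ) • w) ?_ ?_ ?_ t
    (Set.right_mem_Icc.2 ht)
  · simp only [hT.zero_apply, zero_smul, sub_zero] at this
    rwa [sub_right_comm] at this
  · exact ((hT.continuousOn f).mono Set.Icc_subset_Ici_self).sub
      (continuous_id.smul continuous_const).continuousOn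
  · intro x hx
    exact ((hT.hasDerivWithinAt_orbit h hx.1).mono (Set.Ici_subset_Ici.2 hx.1)).sub
      ((hasDerivWithinAt_id x _).smul_const w)
  · intro x hx
    simpa using hε x ⟨hx.1, hx.2.le⟩

theorem norm_sub_le {f v : H} {t : ℝ} (h : HasGenerator T f v) (ht : 0 ≤ t) :
    ‖T t f - f‖ ≤ t * ‖v‖ := by
  have := hT.norm_taylor_le (w := 0) (ε := ‖v‖) h ht
    (fun ρ hρ => by simpa using hT.norm_apply_le hρ.1 v)
  simpa [mul_comm] using this

omit hT in
theorem hasGenerator_of_norm_le {f v : H}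
    (h : ∀ ε > 0, ∀ᶠ t in 𝓝[>] (0 : ℝ), ‖T t f - f - t • v‖ ≤ ε * t) : HasGenerator T f v := by
  rw [HasGenerator, Metric.tendsto_nhds]
  intro ε hε
  filter_upwards [h (ε / 2) (half_pos hε), self_mem_nhdsWithin] with t ht ht0
  have ht0 : (0 : ℝ) < t := ht0
  rw [dist_eq_norm, semigroupQuotient, ofReal_inv_smul]
  have : t⁻¹ • (T t f - f) - v = t⁻¹ • (T t f - f - t • v) := by
    rw [smul_sub t⁻¹ _ (t • v), inv_smul_smul₀ ht0.ne']
  rw [this, norm_smul, norm_inv, Real.norm_of_nonneg ht0.le]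
  calc t⁻¹ * ‖T t f - f - t • v‖ ≤ t⁻¹ * (ε / 2 * t) := by gcongr
    _ = ε / 2 := by field_simp
    _ < ε := half_lt_self hε

/-- The generator is closed: the Taylor error at y_n is controlled by ‖z_n − z₀‖ and the continuity
of the orbit of z₀ alone, so it survives the limit. -/
theorem hasGenerator_of_tendsto {ι : Type*} {l : Filter ι} [l.NeBot] {y z : ι → H} {y₀ z₀ : H}
    (hyz : ∀ᶠ n in l, HasGenerator T (y n) (z n)) (hy : Tendsto y l (𝓝 y₀))
    (hz : Tendsto z l (𝓝 z₀)) : HasGenerator T y₀ z₀ := by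
  refine hasGenerator_of_norm_le fun ε hε => ?_
  obtain ⟨δ, hδ, hd⟩ := hT.eventually_norm_orbit_sub_le z₀ hε
  filter_upwards [Ioo_mem_nhdsGT hδ] with t ht
  have h1 : Tendsto (fun n => ‖T t (y n) - y n - t • z₀‖) l (𝓝 ‖T t y₀ - y₀ - t • z₀‖) :=
    (((((T t).continuous.tendsto y₀).comp hy).sub hy).sub_const _).norm
  have h2 : Tendsto (fun n => (‖z n - z₀‖ + ε) * t) l (𝓝 ((0 + ε) * t)) := by
    have := (tendsto_iff_norm_sub_tendsto_zero.1 hz)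
    exact (this.add_const ε).mul_const t
  rw [zero_add] at h2
  refine le_of_tendsto_of_tendsto h1 h2 ?_
  filter_upwards [hyz] with n hn
  refine hT.norm_taylor_le hn ht.1.le fun ρ hρ => ?_
  calc ‖T ρ (z n) - z₀‖ = ‖T ρ (z n - z₀) + (T ρ z₀ - z₀)‖ := by rw [map_sub]; congr 1; abel
    _ ≤ ‖T ρ (z n - z₀)‖ + ‖T ρ z₀ - z₀‖ := norm_add_le _ _
    _ ≤ ‖z n - z₀‖ + ε := add_le_add (hT.norm_apply_le hρ.1 _) (hd ρ hρ.1 (hρ.2.trans ht.2.le))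

/-- Factoring T(σ − x) out of the slope leaves the slope of a minus a difference quotient of T at
the fixed vector a(ρ). Hence a(x) need not lie in the domain for x ≠ ρ. -/
theorem hasDerivWithinAt_duhamel {σ ρ : ℝ} {a : ℝ → H} {a' v : H} (hρ : ρ < σ)
    (ha : HasDerivWithinAt a a' (Set.Ici ρ) ρ) (hv : HasGenerator T (a ρ) v) :
    HasDerivWithinAt (fun x => T (σ - x) (a x)) (T (σ - ρ) (a' - v)) (Set.Ici ρ) ρ := by
  rw [hasDerivWithinAt_iff_tendsto_slope, Set.Ici_sdiff_left] at ha ⊢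
  have hsub : Tendsto (fun x => x - ρ) (𝓝[>] ρ) (𝓝[>] 0) := by
    refine tendsto_nhdsWithin_iff.2 ⟨?_, ?_⟩
    · have : Continuous fun x : ℝ => x - ρ := by fun_prop
      simpa using (this.tendsto ρ).mono_left nhdsWithin_le_nhds
    · filter_upwards [self_mem_nhdsWithin] with x hx
      exact sub_pos.2 (Set.mem_Ioi.1 hx)
  have h1 : Tendsto (fun x => σ - x) (𝓝[>] ρ) (𝓝 (σ - ρ)) :=
    ((continuous_const.sub continuous_id).tendsto ρ).mono_left nhdsWithin_le_nhds
  have h2 : ∀ᶠ x in 𝓝[>] ρ, 0 ≤ σ - x := by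
    filter_upwards [Ioo_mem_nhdsGT hρ] with x hx using sub_nonneg.2 hx.2.le
  refine (hT.tendsto_apply (sub_nonneg.2 hρ.le) h1 h2
    (ha.sub ((tendsto_slope_zero hv).comp hsub))).congr' ?_
  filter_upwards [Ioo_mem_nhdsGT hρ] with x hx
  simp only [Function.comp_apply, slope_def_module]
  have : σ - ρ = (σ - x) + (x - ρ) := by ring
  rw [this, hT.add_apply (sub_nonneg.2 hx.2.le) (sub_nonneg.2 hx.1.le), ← smul_sub,
    ContinuousLinearMap.map_smul_of_tower, ← map_sub]
  congr 2
  abel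

/-- A Landau-Kolmogorov inequality. -/
theorem mul_norm_generator_le {f v w : H} {δ : ℝ} (hδ : 0 ≤ δ) (h : HasGenerator T f v)
    (h' : HasGenerator T v w) : δ * ‖v‖ ≤ 2 * ‖f‖ + δ ^ 2 * ‖w‖ := by
  have h1 := hT.norm_taylor_le (w := v) (ε := δ * ‖w‖) h hδ fun ρ hρ =>
    (hT.norm_sub_le h' hρ.1).trans (by gcongr; exact hρ.2)
  have h2 : ‖δ • v‖ ≤ ‖T δ f - f - δ • v‖ + ‖T δ f - f‖ := by
    have := _root_.norm_sub_le (T δ f - f) (T δ f - f - δ • v)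
    rw [sub_sub_cancel] at this
    linarith
  have h3 : ‖T δ f - f‖ ≤ ‖f‖ + ‖f‖ :=
    (_root_.norm_sub_le _ _).trans (add_le_add (hT.norm_apply_le hδ f) le_rfl)
  rw [norm_smul, Real.norm_of_nonneg hδ] at h2
  nlinarith

theorem hasDerivWithinAt_apply {τ : ℝ} {w : ℝ → H} {w' v : H} (hτ : 0 ≤ τ)
    (hw : HasDerivWithinAt w w' {h | 0 ≤ τ + h} 0) (hv : HasGenerator T (w 0) v) :
    HasDerivWithinAt (fun h => T (τ + h) (w h)) (T τ v + T τ w') {h | 0 ≤ τ + h} 0 := by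
  have h1 : HasDerivWithinAt (fun h => T (τ + h) (w 0)) (T τ v) {h | 0 ≤ τ + h} 0 := by
    have h2 : HasDerivWithinAt (fun h : ℝ => τ + h) 1 {h | 0 ≤ τ + h} 0 :=
      (hasDerivWithinAt_id (0 : ℝ) _).const_add τ
    have h3 : HasDerivWithinAt (fun t => T t (w 0)) (T τ v) (Set.Ici 0) (τ + 0) := by
      rw [add_zero]; exact hT.hasDerivWithinAt_orbit hv hτ
    simpa [Function.comp_def] using h3.scomp (0 : ℝ) h2 fun x hx => hx
  rw [hasDerivWithinAt_iff_tendsto_slope] at h1 hw ⊢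
  have h4 : Tendsto (fun h : ℝ => τ + h) (𝓝[{h | 0 ≤ τ + h} \ {0}] 0) (𝓝 τ) := by
    have : Continuous fun h : ℝ => τ + h := by fun_prop
    simpa using (this.tendsto 0).mono_left nhdsWithin_le_nhds
  have h5 : ∀ᶠ h in 𝓝[{h | 0 ≤ τ + h} \ {0}] 0, 0 ≤ τ + h := by
    filter_upwards [self_mem_nhdsWithin] with x hx using hx.1
  refine (h1.add (hT.tendsto_apply hτ h4 h5 hw)).congr fun h => ?_
  simp only [slope_def_module, sub_zero, add_zero, ContinuousLinearMap.map_smul_of_tower, map_sub,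
    ← smul_add]
  congr 1
  abel

open MeasureTheory in
-- The difference quotients of F are dominated by ‖G‖, by the Lipschitz bound `norm_sub_le`, so
-- dominated convergence applies.
theorem hasGenerator_integral [CompleteSpace H] {α : Type*} [MeasurableSpace α] {μ : Measure α}
    {F G : α → H} (hF : Integrable F μ) (hG : Integrable G μ)
    (hFG : ∀ a, HasGenerator T (F a) (G a)) :
    HasGenerator T (∫ a, F a ∂μ) (∫ a, G a ∂μ) := by
  have key : Tendsto (fun t : ℝ => ∫ a, semigroupQuotient T (F a) t ∂μ) (𝓝[>] 0)
      (𝓝 (∫ a, G a ∂μ)) := by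
    refine tendsto_integral_filter_of_dominated_convergence (fun a => ‖G a‖) ?_ ?_ hG.norm ?_
    · refine Eventually.of_forall fun t => ?_
      exact (((T t).integrable_comp hF).sub hF).aestronglyMeasurable.const_smul _
    · filter_upwards [self_mem_nhdsWithin] with t ht
      have ht : (0 : ℝ) < t := ht
      refine Eventually.of_forall fun a => ?_
      rw [semigroupQuotient, ofReal_inv_smul, norm_smul, norm_inv, Real.norm_of_nonneg ht.le]
      rw [inv_mul_le_iff₀ ht]
      exact hT.norm_sub_le (hFG a) ht.le
    · exact Eventually.of_forall hFG
  refine key.congr fun t => ?_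
  simp only [semigroupQuotient]
  rw [integral_smul, integral_sub ((T t).integrable_comp hF) hF, (T t).integral_comp_comm hF]

end IsContractionSemigroup

end Semigroup

/-! ### Linear structure of the Sobolev spaces. -/

section SobolevSpace

variable {𝕜 H : Type*} [RCLike 𝕜] [NormedAddCommGroup H] [InnerProductSpace 𝕜 H] {d : ℕ}
  {T : Fin d → ℝ → H →L[𝕜] H}

theorem mem_sobolevSpace_of_hasGenerator {r : ℕ} {f : H} {v : Fin d → H}
    (h : ∀ j, HasGenerator (T j) f (v j)) (hv : ∀ j, v j ∈ sobolevSpace T r) :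
    f ∈ sobolevSpace T (r + 1) := fun j =>
  ⟨(h j).mem_generatorDomain, by rw [(h j).generator_eq]; exact hv j⟩

theorem mem_sobolevSpace_one {f : H} {v : Fin d → H} (h : ∀ j, HasGenerator (T j) f (v j)) :
    f ∈ sobolevSpace T 1 := mem_sobolevSpace_of_hasGenerator h fun _ => Set.mem_univ _

theorem hasGenerator_of_mem_succ {r : ℕ} {f : H} (h : f ∈ sobolevSpace T (r + 1)) (j : Fin d) :
    HasGenerator (T j) f (generator (T j) f) := HasGenerator.of_mem (h j).1

theorem sobolevSpace_succ_subset (r : ℕ) : sobolevSpace T (r + 1) ⊆ sobolevSpace T r := by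
  induction r with
  | zero => exact Set.subset_univ _
  | succ r ih => exact fun f hf j => ⟨(hf j).1, ih (hf j).2⟩

theorem sobolevSpace_succ_subset_one (r : ℕ) : sobolevSpace T (r + 1) ⊆ sobolevSpace T 1 :=
  fun _ hf j => ⟨(hf j).1, Set.mem_univ _⟩

theorem zero_mem_sobolevSpace (r : ℕ) : (0 : H) ∈ sobolevSpace T r := by
  induction r with
  | zero => exact Set.mem_univ _
  | succ r ih => exact mem_sobolevSpace_of_hasGenerator (fun j => HasGenerator.zero) fun _ => ih

theorem add_mem_sobolevSpace {r : ℕ} {f g : H} (hf : f ∈ sobolevSpace T r)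
    (hg : g ∈ sobolevSpace T r) : f + g ∈ sobolevSpace T r := by
  induction r generalizing f g with
  | zero => exact Set.mem_univ _
  | succ r ih =>
    exact mem_sobolevSpace_of_hasGenerator
      (fun j => (hasGenerator_of_mem_succ hf j).add (hasGenerator_of_mem_succ hg j))
      fun j => ih (hf j).2 (hg j).2

theorem smul_mem_sobolevSpace {r : ℕ} (c : 𝕜) {f : H} (hf : f ∈ sobolevSpace T r) :
    c • f ∈ sobolevSpace T r := by
  induction r generalizing f with
  | zero => exact Set.mem_univ _
  | succ r ih =>
    exact mem_sobolevSpace_of_hasGenerator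
      (fun j => (hasGenerator_of_mem_succ hf j).smul c) fun j => ih (hf j).2

theorem sub_mem_sobolevSpace {r : ℕ} {f g : H} (hf : f ∈ sobolevSpace T r)
    (hg : g ∈ sobolevSpace T r) : f - g ∈ sobolevSpace T r := by
  have := add_mem_sobolevSpace hf (smul_mem_sobolevSpace (-1) hg)
  simpa [sub_eq_add_neg] using this

theorem sum_mem_sobolevSpace {ι : Type*} {r : ℕ} (s : Finset ι) {f : ι → H}
    (hf : ∀ i ∈ s, f i ∈ sobolevSpace T r) : ∑ i ∈ s, f i ∈ sobolevSpace T r := by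
  classical
  induction s using Finset.induction_on with
  | empty => simpa using zero_mem_sobolevSpace r
  | insert a s ha ih =>
    rw [Finset.sum_insert ha]
    exact add_mem_sobolevSpace (hf a (Finset.mem_insert_self _ _))
      (ih fun i hi => hf i (Finset.mem_insert_of_mem hi))

/-- The graph norm `‖f‖ + ∑ j, ‖D_j f‖` on the space of order one. -/
noncomputable def graphNorm (T : Fin d → ℝ → H →L[𝕜] H) (f : H) : ℝ :=
  ‖f‖ + ∑ j, ‖generator (T j) f‖

theorem graphNorm_nonneg (f : H) : 0 ≤ graphNorm T f := by
  unfold graphNorm; positivity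

theorem norm_le_graphNorm (f : H) : ‖f‖ ≤ graphNorm T f :=
  le_add_of_nonneg_right (by positivity)

theorem norm_generator_le_graphNorm (f : H) (i : Fin d) :
    ‖generator (T i) f‖ ≤ graphNorm T f :=
  (Finset.single_le_sum (f := fun j => ‖generator (T j) f‖) (fun _ _ => norm_nonneg _)
    (Finset.mem_univ i)).trans (le_add_of_nonneg_left (norm_nonneg _))

end SobolevSpace

/-! ### Ordered products of the semigroups and their partial derivatives. -/

section ListOrbit

variable {𝕜 H : Type*} [RCLike 𝕜] [NormedAddCommGroup H] [InnerProductSpace 𝕜 H] {d : ℕ}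

/-- The product of the operators `T_k(t_k)` over a list of indices `k`. -/
noncomputable def listOrbit (T : Fin d → ℝ → H →L[𝕜] H) (t : EuclideanSpace ℝ (Fin d)) :
    List (Fin d) → H →L[𝕜] H
  | [] => 1
  | a :: L => T a (t a) * listOrbit T t L

/-- The partial derivative of `t ↦ listOrbit T t L y` in the `k`-th variable. -/
noncomputable def listPartial (T : Fin d → ℝ → H →L[𝕜] H) (k : Fin d)
    (t : EuclideanSpace ℝ (Fin d)) : List (Fin d) → H → H
  | [], _ => 0
  | a :: L, y => (if k = a then T a (t a) (generator (T a) (listOrbit T t L y)) else 0) +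
      T a (t a) (listPartial T k t L y)

variable {T : Fin d → ℝ → H →L[𝕜] H}

theorem listOrbit_cons_apply (t : EuclideanSpace ℝ (Fin d)) (a : Fin d) (L : List (Fin d)) (y : H) :
    listOrbit T t (a :: L) y = T a (t a) (listOrbit T t L y) := rfl

theorem orbitMap_eq_listOrbit (t : EuclideanSpace ℝ (Fin d)) (f : H) :
    orbitMap T f t = listOrbit T t (List.finRange d) f := by
  rw [orbitMap, List.ofFn_eq_map]
  generalize List.finRange d = L
  congr 1
  induction L with
  | nil => rfl
  | cons a L ih => rw [List.map_cons, List.prod_cons, ih]; rfl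

theorem listOrbit_append (t : EuclideanSpace ℝ (Fin d)) (L L' : List (Fin d)) :
    listOrbit T t (L ++ L') = listOrbit T t L * listOrbit T t L' := by
  induction L with
  | nil => exact (one_mul _).symm
  | cons a L ih =>
    rw [List.cons_append, listOrbit, ih, listOrbit, mul_assoc]

theorem listPartial_append (k : Fin d) (t : EuclideanSpace ℝ (Fin d)) (L L' : List (Fin d))
    (y : H) : listPartial T k t (L ++ L') y =
      listPartial T k t L (listOrbit T t L' y) + listOrbit T t L (listPartial T k t L' y) := by
  induction L with
  | nil => simp [listPartial, listOrbit]
  | cons a L ih =>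
    rw [List.cons_append, listPartial, ih, listPartial, listOrbit_cons_apply, listOrbit_append,
      map_add, mul_apply_eq_comp, add_assoc]

variable (hT : ∀ i, IsContractionSemigroup (T i))
include hT

theorem norm_listOrbit_apply_le {t : EuclideanSpace ℝ (Fin d)} (ht : ∀ k, 0 ≤ t k)
    (L : List (Fin d)) (y : H) : ‖listOrbit T t L y‖ ≤ ‖y‖ := by
  induction L with
  | nil => exact le_rfl
  | cons a L ih => exact ((hT a).norm_apply_le (ht a) _).trans ih

theorem continuousOn_listOrbit (L : List (Fin d)) (y : H) :
    ContinuousOn (fun t => listOrbit T t L y) {t | ∀ k, 0 ≤ t k} := by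
  induction L with
  | nil => exact continuousOn_const
  | cons a L ih =>
    refine (hT a).continuousOn_apply ?_ (fun t ht => ht a) ih
    exact (by fun_prop : Continuous fun t : EuclideanSpace ℝ (Fin d) => t a).continuousOn

theorem listOrbit_zero (L : List (Fin d)) (t : EuclideanSpace ℝ (Fin d)) (ht : ∀ k ∈ L, t k = 0) :
    listOrbit T t L = 1 := by
  induction L with
  | nil => rfl
  | cons a L ih =>
    rw [listOrbit, ih fun k hk => ht k (List.mem_cons_of_mem _ hk), ht a List.mem_cons_self,
      (hT a).map_zero, one_mul]

/-- When all times in the list vanish the product rule only counts how often the factor k occurs. -/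
theorem listPartial_zero (k : Fin d) (L : List (Fin d)) (t : EuclideanSpace ℝ (Fin d))
    (ht : ∀ k ∈ L, t k = 0) (y : H) :
    listPartial T k t L y = L.count k • generator (T k) y := by
  induction L with
  | nil => simp [listPartial]
  | cons a L ih =>
    rw [listPartial, ih fun k hk => ht k (List.mem_cons_of_mem _ hk), ht a List.mem_cons_self,
      listOrbit_zero hT L t fun k hk => ht k (List.mem_cons_of_mem _ hk), List.count_cons,
      (hT a).zero_apply, (hT a).zero_apply, add_comm, add_smul]
    congr 1
    by_cases h : k = a
    · subst h; simp
    · simp [h, Ne.symm h]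

variable (hinv : ∀ i, ∀ t : ℝ, 0 ≤ t → ∀ f ∈ sobolevSpace T 1, T i t f ∈ sobolevSpace T 1)
include hinv

omit hT in
theorem listOrbit_mem_sobolevSpace_one {t : EuclideanSpace ℝ (Fin d)} (ht : ∀ k, 0 ≤ t k)
    (L : List (Fin d)) {y : H} (hy : y ∈ sobolevSpace T 1) :
    listOrbit T t L y ∈ sobolevSpace T 1 := by
  induction L with
  | nil => exact hy
  | cons a L ih => exact hinv a _ (ht a) _ ih

variable [NormedSpace ℝ H] [IsScalarTower ℝ 𝕜 H]

theorem hasDerivWithinAt_listOrbit {t : EuclideanSpace ℝ (Fin d)} (ht : ∀ k, 0 ≤ t k)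
    (k : Fin d) (L : List (Fin d)) {y : H} (hy : y ∈ sobolevSpace T 1) :
    HasDerivWithinAt (fun h : ℝ => listOrbit T (t + EuclideanSpace.single k h) L y)
      (listPartial T k t L y) {h | 0 ≤ t k + h} 0 := by
  induction L with
  | nil => exact hasDerivWithinAt_const _ _ _
  | cons a L ih =>
    have h0 : t + EuclideanSpace.single k (0 : ℝ) = t := by
      ext j; simp
    have hgen : HasGenerator (T a) (listOrbit T (t + EuclideanSpace.single k (0 : ℝ)) L y)
        (generator (T a) (listOrbit T t L y)) := by
      rw [h0]
      exact hasGenerator_of_mem_succ (listOrbit_mem_sobolevSpace_one hinv ht L hy) a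
    by_cases hka : k = a
    · subst hka
      have := (hT k).hasDerivWithinAt_apply (ht k) ih hgen
      simpa [listPartial, listOrbit_cons_apply] using this
    · have : HasDerivWithinAt
          (fun h : ℝ => T a (t a) (listOrbit T (t + EuclideanSpace.single k h) L y))
          (T a (t a) (listPartial T k t L y)) {h | 0 ≤ t k + h} 0 :=
        ((T a (t a)).restrictScalars ℝ).hasFDerivAt.comp_hasDerivWithinAt (0 : ℝ) ih
      simpa [listPartial, listOrbit_cons_apply, hka, Ne.symm hka] using this

/-- This identifies the unspecified derivatives in the structure identity with the explicit product
rule. The set of admissible increments contains (0, ∞), so limits along it are unique. -/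
theorem hasOrbitPartialDeriv_iff {t : EuclideanSpace ℝ (Fin d)} (ht : ∀ k, 0 ≤ t k)
    (k : Fin d) {y v : H} (hy : y ∈ sobolevSpace T 1) :
    HasOrbitPartialDeriv T y k t v ↔ v = listPartial T k t (List.finRange d) y := by
  have h1 := hasDerivWithinAt_listOrbit hT hinv ht k (List.finRange d) hy
  rw [hasDerivWithinAt_iff_tendsto_slope] at h1
  have hset : ({h | 0 ≤ t k + h} \ {0} : Set ℝ) = {h : ℝ | h ≠ 0 ∧ 0 ≤ t k + h} := by
    ext h; simp [and_comm]
  have h0 : t + EuclideanSpace.single k (0 : ℝ) = t := by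
    ext j; simp
  rw [hset] at h1
  have h2 : HasOrbitPartialDeriv T y k t (listPartial T k t (List.finRange d) y) := by
    refine h1.congr fun h => ?_
    rw [slope_def_module, sub_zero, h0, orbitMap_eq_listOrbit, orbitMap_eq_listOrbit,
      IsContractionSemigroup.ofReal_inv_smul]
  have : (𝓝[{h : ℝ | h ≠ 0 ∧ 0 ≤ t k + h}] 0).NeBot := by
    refine NeBot.mono (nhdsGT_neBot (0 : ℝ)) (nhdsWithin_mono _ fun h hh => ?_)
    exact ⟨ne_of_gt hh, add_nonneg (ht k) (le_of_lt hh)⟩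
  exact ⟨fun h => tendsto_nhds_unique h h2, fun h => h ▸ h2⟩

end ListOrbit

/-! ### Moving generators through products of semigroups. -/

section Commutation

variable {𝕜 H : Type*} [RCLike 𝕜] [NormedAddCommGroup H] [InnerProductSpace 𝕜 H] {d : ℕ}

/-- On the space of order one and for times in `[0, δ]`, the generators pass through the semigroup
`T m` with coefficients `E`. -/
structure CommutesVia (T : Fin d → ℝ → H →L[𝕜] H) (m : Fin d) (δ : ℝ)
    (E : ℝ → Fin d → Fin d → 𝕜) : Prop where
  contDiff : ∀ i l, ContDiff ℝ 1 fun t => E t i l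
  zero : ∀ i l, E 0 i l = if i = l then 1 else 0
  generator_eq : ∀ t, 0 ≤ t → t ≤ δ → ∀ y ∈ sobolevSpace T 1, ∀ i,
    generator (T i) (T m t y) = ∑ l, E t i l • T m t (generator (T l) y)

/-- The analogue of `CommutesVia` for the product of the semigroups in a list `L`: coefficients `E`
for the generators, coefficients `C` for the partial derivatives. -/
structure ListCommutesVia (T : Fin d → ℝ → H →L[𝕜] H) (L : List (Fin d)) (δ : ℝ)
    (E C : EuclideanSpace ℝ (Fin d) → Fin d → Fin d → 𝕜) : Prop where
  contDiff : ∀ i l, ContDiff ℝ 1 fun t => E t i l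
  zero : ∀ i l, E 0 i l = if i = l then 1 else 0
  generator_eq : ∀ t : EuclideanSpace ℝ (Fin d), (∀ k, 0 ≤ t k ∧ t k ≤ δ) →
    ∀ y ∈ sobolevSpace T 1, ∀ i,
      generator (T i) (listOrbit T t L y) = ∑ l, E t i l • listOrbit T t L (generator (T l) y)
  contDiff' : ∀ k l, ContDiff ℝ 1 fun t => C t k l
  zero' : ∀ k l, C 0 k l = if k = l then (L.count k : 𝕜) else 0
  listPartial_eq : ∀ t : EuclideanSpace ℝ (Fin d), (∀ k, 0 ≤ t k ∧ t k ≤ δ) →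
    ∀ y ∈ sobolevSpace T 1, ∀ k,
      listPartial T k t L y = ∑ l, C t k l • listOrbit T t L (generator (T l) y)

variable {T : Fin d → ℝ → H →L[𝕜] H}

/-- Moving a generator through one more factor multiplies the coefficient matrices. For a partial
derivative, the new factor a contributes T_a D_a = D_a T_a, that is, the generator D_a of the whole
product, which the coefficients E already express. -/
theorem exists_listCommutesVia (hT : ∀ i, IsContractionSemigroup (T i))
    (hinv : ∀ i, ∀ t : ℝ, 0 ≤ t → ∀ f ∈ sobolevSpace T 1, T i t f ∈ sobolevSpace T 1)
    {δ : ℝ} (L : List (Fin d)) (hL : ∀ m ∈ L, ∃ E, CommutesVia T m δ E) :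
    ∃ E C, ListCommutesVia T L δ E C := by
  induction L with
  | nil =>
    refine ⟨fun _ i l => if i = l then 1 else 0, fun _ _ _ => 0, fun i l => contDiff_const,
      fun i l => rfl, fun t _ y _ i => ?_, fun k l => contDiff_const, fun k l => by simp,
      fun t _ y _ k => by simp [listPartial]⟩
    simp [listOrbit]
  | cons a L ih =>
    obtain ⟨E, C, h⟩ := ih fun m hm => hL m (List.mem_cons_of_mem _ hm)
    obtain ⟨A, hA⟩ := hL a List.mem_cons_self
    have hcoord : ContDiff ℝ 1 fun t : EuclideanSpace ℝ (Fin d) => t a := by fun_prop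
    have hE : ∀ i l, ContDiff ℝ 1 fun t : EuclideanSpace ℝ (Fin d) =>
        ∑ p, A (t a) i p * E t p l := fun i l =>
      ContDiff.sum fun p _ => ((hA.contDiff i p).comp hcoord).mul (h.contDiff p l)
    have hE0 : ∀ i l, ∑ p, A ((0 : EuclideanSpace ℝ (Fin d)) a) i p * E 0 p l =
        if i = l then 1 else 0 := fun i l => by
      simp [hA.zero, h.zero]
    have hEeq : ∀ t : EuclideanSpace ℝ (Fin d), (∀ k, 0 ≤ t k ∧ t k ≤ δ) →
        ∀ y ∈ sobolevSpace T 1, ∀ i, generator (T i) (listOrbit T t (a :: L) y) =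
          ∑ l, (∑ p, A (t a) i p * E t p l) • listOrbit T t (a :: L) (generator (T l) y) := by
      intro t ht y hy i
      rw [listOrbit_cons_apply, hA.generator_eq _ (ht a).1 (ht a).2 _
        (listOrbit_mem_sobolevSpace_one hinv (fun k => (ht k).1) L hy)]
      simp only [h.generator_eq t ht y hy, map_sum, map_smul, listOrbit_cons_apply,
        Finset.sum_smul, Finset.smul_sum, mul_smul]
      exact Finset.sum_comm
    refine ⟨fun t i l => ∑ p, A (t a) i p * E t p l,
      fun t k l => (if k = a then ∑ p, A (t a) a p * E t p l else 0) + C t k l, hE, hE0, hEeq,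
      fun k l => ?_, fun k l => ?_, fun t ht y hy k => ?_⟩
    · refine ContDiff.add ?_ (h.contDiff' k l)
      split_ifs
      exacts [hE a l, contDiff_const]
    · rw [hE0 a l, h.zero' k l, List.count_cons]
      by_cases hka : k = a
      · subst hka
        by_cases hkl : k = l <;> simp [hkl, add_comm]
      · simp [hka, Ne.symm hka]
    · rw [listPartial, h.listPartial_eq t ht y hy]
      simp only [add_smul, Finset.sum_add_distrib, map_sum, map_smul, listOrbit_cons_apply]
      congr 1
      by_cases hka : k = a
      · subst hka
        have hgen : generator (T k) (T k (t k) (listOrbit T t L y)) =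
            T k (t k) (generator (T k) (listOrbit T t L y)) := by
          have hmem := listOrbit_mem_sobolevSpace_one hinv (fun k => (ht k).1) L hy
          exact ((hT k).hasGenerator_orbit (hasGenerator_of_mem_succ hmem k) (ht k).1).generator_eq
        simp only [if_true]
        rw [← hgen, ← listOrbit_cons_apply, hEeq t ht y hy]
        rfl
      · simp [hka]

variable [NormedSpace ℝ H] [IsScalarTower ℝ 𝕜 H]

/-- At the point ρe_m every factor except T_m is the identity, so the position of k relative to m in
the ordered product decides whether D_k acts after or before T_m(ρ). This asymmetry is what makes
induction on m possible. -/
theorem generator_orbit_eq_sum (hT : ∀ i, IsContractionSemigroup (T i))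
    (hinv : ∀ i, ∀ t : ℝ, 0 ≤ t → ∀ f ∈ sobolevSpace T 1, T i t f ∈ sobolevSpace T 1)
    {ζ : Fin d → Fin d → EuclideanSpace ℝ (Fin d) → 𝕜}
    (hζ : ∀ i, ∀ f ∈ sobolevSpace T 1, ∀ t ∈ Metric.ball (0 : EuclideanSpace ℝ (Fin d)) 1,
      (∀ k, 0 ≤ t k) → ∃ v : Fin d → H, (∀ k, HasOrbitPartialDeriv T f k t (v k)) ∧
        generator (T i) (orbitMap T f t) = ∑ k, ζ i k t • v k)
    (m : Fin d) {ρ : ℝ} (hρ : 0 ≤ ρ) (hρ1 : ρ < 1) {y : H} (hy : y ∈ sobolevSpace T 1)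
    (i : Fin d) :
    generator (T i) (T m ρ y) = ∑ k, ζ i k (EuclideanSpace.single m ρ) •
      (if k < m then generator (T k) (T m ρ y) else T m ρ (generator (T k) y)) := by
  set t : EuclideanSpace ℝ (Fin d) := EuclideanSpace.single m ρ with ht
  have htm : t m = ρ := by simp [ht]
  have htk : ∀ k, k ≠ m → t k = 0 := fun k hk => by simp [ht, hk]
  have htpos : ∀ k, 0 ≤ t k := fun k => by
    by_cases hk : k = m
    · rw [hk, htm]; exact hρ
    · rw [htk k hk]
  obtain ⟨v, hv, hgen⟩ := hζ i y hy t
    (by simp [ht, abs_of_nonneg hρ, hρ1]) htpos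
  obtain ⟨L₁, L₂, hL⟩ := List.append_of_mem (List.mem_finRange m)
  have hsort := List.pairwise_lt_finRange d
  rw [hL, List.pairwise_append, List.pairwise_cons] at hsort
  have h1 : ∀ k ∈ L₁, k < m := fun k hk => hsort.2.2 k hk m List.mem_cons_self
  have h2 : ∀ k ∈ L₂, m < k := hsort.2.1.1
  have hcount : ∀ k, List.count k L₁ + List.count k (m :: L₂) = 1 := fun k => by
    rw [← List.count_append, ← hL]
    exact List.count_eq_one_of_mem (List.nodup_finRange d) (List.mem_finRange k)
  have z1 : ∀ k ∈ L₁, t k = 0 := fun k hk => htk k (h1 k hk).ne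
  have z2 : ∀ k ∈ L₂, t k = 0 := fun k hk => htk k (h2 k hk).ne'
  have horb : listOrbit T t (m :: L₂) y = T m ρ y := by
    rw [listOrbit_cons_apply, listOrbit_zero hT L₂ t z2, htm]; rfl
  have horb' : orbitMap T y t = T m ρ y := by
    rw [orbitMap_eq_listOrbit, hL, listOrbit_append, listOrbit_zero hT L₁ t z1, one_mul, horb]
  rw [horb'] at hgen
  rw [hgen]
  refine Finset.sum_congr rfl fun k _ => ?_
  congr 1
  rw [(hasOrbitPartialDeriv_iff hT hinv htpos k hy).1 (hv k), hL, listPartial_append, horb,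
    listOrbit_zero hT L₁ t z1, listPartial_zero hT k L₁ t z1, listPartial,
    listPartial_zero hT k L₂ t z2, listOrbit_zero hT L₂ t z2, htm]
  have hc := hcount k
  rw [List.count_cons] at hc
  -- The index k occurs exactly once in L₁ ++ m :: L₂: to the left of m, at m, or to the right.
  rcases lt_trichotomy k m with hk | hk | hk
  · have : L₂.count k = 0 := List.count_eq_zero.2 fun h => absurd (h2 k h) hk.not_gt
    rw [this] at hc ⊢
    have hc' : L₁.count k = 1 := by simpa [hk.ne'] using hc
    simp [hk, hk.ne, hc']
  · subst hk
    have : L₁.count k = 0 := List.count_eq_zero.2 fun h => absurd (h1 k h) (lt_irrefl k)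
    have h' : L₂.count k = 0 := List.count_eq_zero.2 fun h => absurd (h2 k h) (lt_irrefl k)
    simp [this, h']
  · have : L₁.count k = 0 := List.count_eq_zero.2 fun h => absurd (h1 k h) hk.not_gt
    rw [this] at hc ⊢
    have hc' : L₂.count k = 1 := by simpa [hk.ne] using hc
    simp [hk.not_gt, hk.ne', hc']

end Commutation

/-! ### Averaging kernels supported inside the positive orthant. -/

section Kernel

open MeasureTheory

variable {𝕜 : Type*} [RCLike 𝕜] {d : ℕ}

/-- The centre of the common support of the averaging kernels. -/
noncomputable def kernelCenter (d : ℕ) : EuclideanSpace ℝ (Fin d) := WithLp.toLp 2 fun _ => 1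

/-- The common support of the averaging kernels. -/
def kernelSupport (d : ℕ) : Set (EuclideanSpace ℝ (Fin d)) :=
  Metric.closedBall (kernelCenter d) (1 / 2)

/-- A bound for the norm on `kernelSupport d`. -/
noncomputable def kernelRadius (d : ℕ) : ℝ := ‖kernelCenter d‖ + 1 / 2

/-- An open neighbourhood of `kernelSupport d`. -/
def kernelRegion (d : ℕ) : Set (EuclideanSpace ℝ (Fin d)) := {u | ∀ k, 0 < u k ∧ u k < 2}

theorem isOpen_kernelRegion : IsOpen (kernelRegion d) := by
  have : kernelRegion d = ⋂ k : Fin d, {u : EuclideanSpace ℝ (Fin d) | 0 < u k ∧ u k < 2} := by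
    ext u; simp [kernelRegion]
  rw [this]
  refine isOpen_iInter_of_finite fun k => ?_
  have hk : Continuous fun u : EuclideanSpace ℝ (Fin d) => u k := by fun_prop
  exact (isOpen_lt continuous_const hk).inter (isOpen_lt hk continuous_const)

/-- Coordinates on the support lie in [1/2, 3/2]. Being away from the faces of the orthant removes
boundary terms and makes the one-sided derivatives two-sided. -/
theorem kernelSupport_subset : kernelSupport d ⊆ kernelRegion d := fun u hu k => by
  have h1 : ‖(u - kernelCenter d) k‖ ≤ 1 / 2 :=
    (PiLp.norm_apply_le _ k).trans (by simpa [kernelSupport, dist_eq_norm] using hu)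
  rw [PiLp.sub_apply, Real.norm_eq_abs, abs_le] at h1
  simp only [kernelCenter] at h1
  constructor <;> linarith [h1.1, h1.2]

theorem norm_le_kernelRadius {u : EuclideanSpace ℝ (Fin d)} (hu : u ∈ kernelSupport d) :
    ‖u‖ ≤ kernelRadius d := by
  have h1 : ‖u - kernelCenter d‖ ≤ 1 / 2 := by simpa [kernelSupport, dist_eq_norm] using hu
  have := norm_add_le (u - kernelCenter d) (kernelCenter d)
  rw [sub_add_cancel] at this
  rw [kernelRadius]
  linarith

theorem half_le_kernelRadius : 1 / 2 ≤ kernelRadius d :=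
  le_add_of_nonneg_left (norm_nonneg _)

theorem isCompact_kernelSupport : IsCompact (kernelSupport d) := isCompact_closedBall _ _

theorem isClosed_kernelSupport : IsClosed (kernelSupport d) := Metric.isClosed_closedBall

/-- `φ` is a `C¹` kernel supported in `kernelSupport d` and bounded by `b` together with its
derivative. -/
structure IsKernel (b : ℝ) (φ : EuclideanSpace ℝ (Fin d) → 𝕜) : Prop where
  contDiff : ContDiff ℝ 1 φ
  eq_zero : ∀ u, u ∉ kernelSupport d → φ u = 0
  norm_le : ∀ u, ‖φ u‖ ≤ b
  norm_fderiv_le : ∀ u, ‖fderiv ℝ φ u‖ ≤ b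

/-- The partial derivative of a scalar kernel. -/
noncomputable def partialDeriv (k : Fin d) (φ : EuclideanSpace ℝ (Fin d) → 𝕜)
    (u : EuclideanSpace ℝ (Fin d)) : 𝕜 := fderiv ℝ φ u (EuclideanSpace.single k 1)

theorem fderiv_eq_zero_of_notMem {φ : EuclideanSpace ℝ (Fin d) → 𝕜}
    (h : ∀ u, u ∉ kernelSupport d → φ u = 0) {u : EuclideanSpace ℝ (Fin d)}
    (hu : u ∉ kernelSupport d) : fderiv ℝ φ u = 0 := by
  have : φ =ᶠ[𝓝 u] fun _ => 0 := by
    filter_upwards [isClosed_kernelSupport.isOpen_compl.mem_nhds hu] with x hx using h x hx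
  rw [this.fderiv_eq, fderiv_fun_const]
  rfl

namespace IsKernel

variable {b : ℝ} {φ : EuclideanSpace ℝ (Fin d) → 𝕜} (h : IsKernel b φ)
include h

theorem nonneg : 0 ≤ b := (norm_nonneg _).trans (h.norm_le 0)

theorem partialDeriv_eq_zero (k : Fin d) (u : EuclideanSpace ℝ (Fin d))
    (hu : u ∉ kernelSupport d) : partialDeriv k φ u = 0 := by
  rw [partialDeriv, fderiv_eq_zero_of_notMem h.eq_zero hu]; rfl

theorem norm_partialDeriv_le (k : Fin d) (u : EuclideanSpace ℝ (Fin d)) :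
    ‖partialDeriv k φ u‖ ≤ b := by
  have := (fderiv ℝ φ u).le_of_opNorm_le (h.norm_fderiv_le u) (EuclideanSpace.single k 1)
  simpa [partialDeriv] using this

theorem continuous_partialDeriv (k : Fin d) : Continuous (partialDeriv k φ) :=
  (h.contDiff.continuous_fderiv one_ne_zero).clm_apply continuous_const

theorem mono {b' : ℝ} (hb : b ≤ b') : IsKernel b' φ :=
  ⟨h.contDiff, h.eq_zero, fun u => (h.norm_le u).trans hb, fun u => (h.norm_fderiv_le u).trans hb⟩

/-- Regularity of g matters only on the support, since the product vanishes on the open complement.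
-/
theorem mul {a a' : ℝ} {g : EuclideanSpace ℝ (Fin d) → 𝕜}
    (hg : ∀ u ∈ kernelSupport d, ContDiffAt ℝ 1 g u)
    (ha : ∀ u ∈ kernelSupport d, ‖g u‖ ≤ a) (ha' : ∀ u ∈ kernelSupport d, ‖fderiv ℝ g u‖ ≤ a')
    (h0 : 0 ≤ a) (h0' : 0 ≤ a') : IsKernel ((a + a') * b) fun u => g u * φ u := by
  have hz : ∀ u, u ∉ kernelSupport d → g u * φ u = 0 := fun u hu => by rw [h.eq_zero u hu, mul_zero]
  have hb := h.nonneg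
  refine ⟨contDiff_iff_contDiffAt.2 fun u => ?_, hz, fun u => ?_, fun u => ?_⟩
  · by_cases hu : u ∈ kernelSupport d
    · exact (hg u hu).mul h.contDiff.contDiffAt
    · have : (fun u => g u * φ u) =ᶠ[𝓝 u] fun _ => 0 := by
        filter_upwards [isClosed_kernelSupport.isOpen_compl.mem_nhds hu] with x hx using hz x hx
      exact contDiffAt_const.congr_of_eventuallyEq this
  · by_cases hu : u ∈ kernelSupport d
    · rw [norm_mul]
      calc ‖g u‖ * ‖φ u‖ ≤ a * b := mul_le_mul (ha u hu) (h.norm_le u) (norm_nonneg _) h0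
        _ ≤ (a + a') * b := by gcongr; linarith
    · rw [hz u hu, norm_zero]; positivity
  · by_cases hu : u ∈ kernelSupport d
    · have h1 := (hg u hu).differentiableAt one_ne_zero
      have h2 := h.contDiff.differentiable one_ne_zero u
      rw [fderiv_fun_mul h1 h2]
      refine (norm_add_le _ _).trans ?_
      rw [norm_smul, norm_smul, add_mul, mul_comm a' b]
      exact add_le_add (mul_le_mul (ha u hu) (h.norm_fderiv_le u) (norm_nonneg _) h0)
        (mul_le_mul (h.norm_le u) (ha' u hu) (norm_nonneg _) hb)
    · rw [fderiv_eq_zero_of_notMem hz hu, norm_zero]; positivity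

end IsKernel

theorem IsKernel.smul {b : ℝ} {φ : EuclideanSpace ℝ (Fin d) → 𝕜} (h : IsKernel b φ) (c : 𝕜) :
    IsKernel (‖c‖ * b) fun u => c * φ u := by
  have := h.mul (g := fun _ => c) (a := ‖c‖) (a' := 0) (fun u _ => contDiffAt_const)
    (fun u _ => le_rfl) (fun u _ => by simp) (norm_nonneg c) le_rfl
  rwa [add_zero] at this

/-- Rescaling by s makes ψ(su) − ψ(0) of size O(s) in C¹: its values by the mean value inequality,
its gradient by the chain rule. This gain of s compensates each s⁻¹ lost in an integration by parts.
-/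
theorem exists_isKernel_mul {ψ : EuclideanSpace ℝ (Fin d) → 𝕜}
    (hψ : ContDiffOn ℝ 1 ψ (Metric.ball 0 1)) :
    ∃ B, 0 ≤ B ∧ ∀ s, 0 < s → s * kernelRadius d ≤ 1 / 2 → ∀ b φ, IsKernel b φ →
      IsKernel (B * b) (fun u => ψ (s • u) * φ u) ∧
      IsKernel (B * s * b) (fun u => (ψ (s • u) - ψ 0) * φ u) := by
  set Q : Set (EuclideanSpace ℝ (Fin d)) := Metric.closedBall 0 (1 / 2)
  have hQ : Q ⊆ Metric.ball 0 1 := Metric.closedBall_subset_ball (by norm_num)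
  have hQc : IsCompact Q := isCompact_closedBall _ _
  have hat : ∀ t ∈ Q, ContDiffAt ℝ 1 ψ t := fun t ht =>
    (hψ t (hQ ht)).contDiffAt (Metric.isOpen_ball.mem_nhds (hQ ht))
  obtain ⟨M₁, hM₁⟩ := hQc.exists_bound_of_continuousOn (hψ.continuousOn.mono hQ)
  obtain ⟨M₂, hM₂⟩ := hQc.exists_bound_of_continuousOn
    ((hψ.continuousOn_fderiv_of_isOpen Metric.isOpen_ball le_rfl).mono hQ)
  have h0Q : (0 : EuclideanSpace ℝ (Fin d)) ∈ Q := Metric.mem_closedBall_self (by norm_num)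
  have hM₁0 : 0 ≤ M₁ := (norm_nonneg _).trans (hM₁ 0 h0Q)
  have hM₂0 : 0 ≤ M₂ := (norm_nonneg _).trans (hM₂ 0 h0Q)
  have hlip : ∀ t ∈ Q, ‖ψ t - ψ 0‖ ≤ M₂ * ‖t‖ := fun t ht => by
    have := (convex_closedBall (0 : EuclideanSpace ℝ (Fin d)) (1 / 2)).norm_image_sub_le_of_norm_fderiv_le
      (𝕜 := ℝ) (f := ψ) (fun x hx => (hat x hx).differentiableAt one_ne_zero) hM₂ h0Q ht
    simpa using this
  set R := kernelRadius d with hR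
  have hR0 : 1 / 2 ≤ R := half_le_kernelRadius
  -- M₁ + M₂ serves the first kernel (using s ≤ 1), M₂R + M₂ the second.
  refine ⟨M₁ + M₂ + M₂ * R + M₂, by positivity, fun s hs hsR b φ hφ => ?_⟩
  have hs1 : s ≤ 1 := by nlinarith
  have hmem : ∀ u ∈ kernelSupport d, s • u ∈ Q := fun u hu => by
    rw [mem_closedBall_zero_iff, norm_smul, Real.norm_of_nonneg hs.le]
    exact (mul_le_mul_of_nonneg_left (norm_le_kernelRadius hu) hs.le).trans hsR
  have hcomp : ∀ u ∈ kernelSupport d, ContDiffAt ℝ 1 (fun u => ψ (s • u)) u := fun u hu =>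
    (hat _ (hmem u hu)).comp u (by fun_prop)
  have hfd : ∀ u ∈ kernelSupport d, ‖fderiv ℝ (fun u => ψ (s • u)) u‖ ≤ s * M₂ := fun u hu => by
    rw [fderiv_comp_smul (f := ψ), norm_smul, Real.norm_of_nonneg hs.le]
    exact mul_le_mul_of_nonneg_left (hM₂ _ (hmem u hu)) hs.le
  constructor
  · refine (hφ.mul hcomp (fun u hu => hM₁ _ (hmem u hu)) hfd hM₁0 (by positivity)).mono ?_
    refine mul_le_mul_of_nonneg_right ?_ hφ.nonneg
    nlinarith
  · refine (hφ.mul (g := fun u => ψ (s • u) - ψ 0) (a := M₂ * (s * R)) (a' := s * M₂)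
      (fun u hu => (hcomp u hu).sub contDiffAt_const)
      (fun u hu => (hlip _ (hmem u hu)).trans ?_) (fun u hu => ?_) (by positivity)
      (by positivity)).mono ?_
    · rw [norm_smul, Real.norm_of_nonneg hs.le]
      gcongr
      exact norm_le_kernelRadius hu
    · rw [fderiv_sub_const]; exact hfd u hu
    · refine mul_le_mul_of_nonneg_right ?_ hφ.nonneg
      nlinarith [mul_nonneg hs.le hM₁0, mul_nonneg hs.le hM₂0]

/-- Finitely many coefficient functions admit a common constant in `exists_isKernel_mul`. -/
theorem exists_isKernel_mul_family {ψ : Fin d → Fin d → EuclideanSpace ℝ (Fin d) → 𝕜}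
    (hψ : ∀ i l, ContDiffOn ℝ 1 (ψ i l) (Metric.ball 0 1)) :
    ∃ B, 0 ≤ B ∧ ∀ i l, ∀ s, 0 < s → s * kernelRadius d ≤ 1 / 2 → ∀ b φ, IsKernel b φ →
      IsKernel (B * b) (fun u => ψ i l (s • u) * φ u) ∧
      IsKernel (B * s * b) (fun u => (ψ i l (s • u) - ψ i l 0) * φ u) := by
  choose B hB0 hB using fun i l => exists_isKernel_mul (hψ i l)
  have hle : ∀ i l, B i l ≤ ∑ i, ∑ l, B i l := fun i l =>
    (Finset.single_le_sum (f := fun l => B i l) (fun l _ => hB0 i l) (Finset.mem_univ l)).trans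
      (Finset.single_le_sum (f := fun i => ∑ l, B i l)
        (fun i _ => Finset.sum_nonneg fun l _ => hB0 i l) (Finset.mem_univ i))
  refine ⟨∑ i, ∑ l, B i l, Finset.sum_nonneg fun i _ => Finset.sum_nonneg fun l _ => hB0 i l,
    fun i l s hs hsR b φ hφ => ?_⟩
  obtain ⟨h1, h2⟩ := hB i l s hs hsR b φ hφ
  have := hφ.nonneg
  exact ⟨h1.mono (by gcongr; exact hle i l), h2.mono (by gcongr; exact hle i l)⟩

variable (𝕜) in
/-- A smooth kernel of integral one whose partial derivatives are kernels as well. -/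
theorem exists_unit_kernel (d : ℕ) : ∃ (κ : EuclideanSpace ℝ (Fin d) → 𝕜) (b : ℝ),
    IsKernel b κ ∧ (∀ k, IsKernel b (partialDeriv k κ)) ∧ ∫ u, κ u = 1 := by
  let β : ContDiffBump (kernelCenter d) := ⟨1 / 4, 1 / 2, by norm_num, by norm_num⟩
  set κ₀ : EuclideanSpace ℝ (Fin d) → ℝ := β.normed volume with hκ₀
  have h0 : ContDiff ℝ ∞ κ₀ := β.contDiff_normed
  set κ : EuclideanSpace ℝ (Fin d) → 𝕜 := fun u => (κ₀ u : 𝕜) with hκ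
  have h1 : ContDiff ℝ ∞ κ := (RCLike.ofRealCLM (K := 𝕜)).contDiff.comp h0
  have hz : ∀ u, u ∉ kernelSupport d → κ u = 0 := fun u hu => by
    have : κ₀ u = 0 := by
      rw [← Function.notMem_support, β.support_normed_eq]
      exact fun h => hu (Metric.ball_subset_closedBall h)
    simp [hκ, this]
  have hd : ContDiff ℝ 1 (fderiv ℝ κ) := h1.fderiv_right (by norm_cast)
  have hpd : ∀ k, ContDiff ℝ 1 (partialDeriv k κ) := fun k => hd.clm_apply contDiff_const
  have hpz : ∀ k u, u ∉ kernelSupport d → partialDeriv k κ u = 0 := fun k u hu => by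
    rw [partialDeriv, fderiv_eq_zero_of_notMem hz hu]; rfl
  have key : ∀ φ : EuclideanSpace ℝ (Fin d) → 𝕜, ContDiff ℝ 1 φ →
      (∀ u, u ∉ kernelSupport d → φ u = 0) → ∃ b, IsKernel b φ := fun φ hφ hφz => by
    obtain ⟨M₁, hM₁⟩ := isCompact_kernelSupport.exists_bound_of_continuousOn
      hφ.continuous.continuousOn
    obtain ⟨M₂, hM₂⟩ := isCompact_kernelSupport.exists_bound_of_continuousOn
      (hφ.continuous_fderiv one_ne_zero).continuousOn
    refine ⟨max (max M₁ M₂) 0, hφ, hφz, fun u => ?_, fun u => ?_⟩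
    · by_cases hu : u ∈ kernelSupport d
      · exact (hM₁ u hu).trans ((le_max_left _ _).trans (le_max_left _ _))
      · rw [hφz u hu, norm_zero]; exact le_max_right _ _
    · by_cases hu : u ∈ kernelSupport d
      · exact (hM₂ u hu).trans ((le_max_right _ _).trans (le_max_left _ _))
      · rw [fderiv_eq_zero_of_notMem hφz hu, norm_zero]; exact le_max_right _ _
  obtain ⟨b₀, hb₀⟩ := key κ (h1.of_le (by norm_cast)) hz
  choose b hb using fun k => key _ (hpd k) (hpz k)
  refine ⟨κ, b₀ + ∑ k, b k, hb₀.mono ?_, fun k => (hb k).mono ?_, ?_⟩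
  · exact le_add_of_nonneg_right (Finset.sum_nonneg fun k _ => (hb k).nonneg)
  · exact (Finset.single_le_sum (fun k _ => (hb k).nonneg) (Finset.mem_univ k)).trans
      (le_add_of_nonneg_left hb₀.nonneg)
  · rw [hκ, integral_ofReal, β.integral_normed]
    simp

end Kernel

/-! ### Averages of orbits and integration by parts. -/

section Average

open MeasureTheory

variable {𝕜 H : Type*} [RCLike 𝕜] [NormedAddCommGroup H] [InnerProductSpace 𝕜 H] {d : ℕ}
  [NormedSpace ℝ H] [IsScalarTower ℝ 𝕜 H]

/-- The volume of the common support of the kernels. -/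
noncomputable def kernelVolume (d : ℕ) : ℝ := volume.real (kernelSupport d)

theorem kernelVolume_nonneg : 0 ≤ kernelVolume d := measureReal_nonneg

omit [IsScalarTower ℝ 𝕜 H] in
theorem norm_integral_kernel_le {φ : EuclideanSpace ℝ (Fin d) → 𝕜}
    {F : EuclideanSpace ℝ (Fin d) → H} {b M : ℝ} (hb : 0 ≤ b)
    (hz : ∀ u, u ∉ kernelSupport d → φ u = 0) (hφ : ∀ u, ‖φ u‖ ≤ b)
    (hF : ∀ u ∈ kernelSupport d, ‖F u‖ ≤ M) :
    ‖∫ u, φ u • F u‖ ≤ kernelVolume d * b * M := by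
  have h1 : ∫ u, φ u • F u = ∫ u in kernelSupport d, φ u • F u := by
    refine (setIntegral_eq_integral_of_forall_compl_eq_zero fun u hu => ?_).symm
    rw [hz u hu, zero_smul]
  rw [h1]
  refine (norm_setIntegral_le_of_norm_le_const isCompact_kernelSupport.measure_lt_top
    (C := b * M) fun u hu => ?_).trans (le_of_eq ?_)
  · rw [norm_smul]
    exact mul_le_mul (hφ u) (hF u hu) (norm_nonneg _) hb
  · rw [kernelVolume]; ring

omit [NormedSpace ℝ H] [IsScalarTower ℝ 𝕜 H] in
theorem integrable_kernel_smul {φ : EuclideanSpace ℝ (Fin d) → 𝕜}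
    {F : EuclideanSpace ℝ (Fin d) → H} (hφ : Continuous φ)
    (hz : ∀ u, u ∉ kernelSupport d → φ u = 0) (hF : ContinuousOn F (kernelRegion d)) :
    Integrable fun u => φ u • F u := by
  have hsupp : tsupport (fun u => φ u • F u) ⊆ kernelSupport d := by
    refine closure_minimal (fun u hu => ?_) isClosed_kernelSupport
    by_contra h
    exact hu (by simp [hz u h])
  have hcont : Continuous fun u => φ u • F u :=
    (hφ.continuousOn.smul hF).continuous_of_tsupport_subset isOpen_kernelRegion
      (hsupp.trans kernelSupport_subset)
  exact hcont.integrable_of_hasCompactSupport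
    (isCompact_kernelSupport.of_isClosed_subset (isClosed_tsupport _) hsupp)

theorem smul_mem_of_mem_kernelRegion {s δ : ℝ} (hs : 0 < s) (hsδ : 2 * s ≤ δ)
    {u : EuclideanSpace ℝ (Fin d)} (hu : u ∈ kernelRegion d) (k : Fin d) :
    0 ≤ (s • u) k ∧ (s • u) k ≤ δ := by
  have := hu k
  simp only [PiLp.smul_apply, smul_eq_mul]
  constructor <;> nlinarith [this.1, this.2]

/-- The weighted average `∫ φ(u) P(s u) f du`, where `P` is the product of the semigroups over the
list `L`. -/
noncomputable def kernelAverage (T : Fin d → ℝ → H →L[𝕜] H) (L : List (Fin d)) (s : ℝ)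
    (φ : EuclideanSpace ℝ (Fin d) → 𝕜) (f : H) : H :=
  ∫ u, φ u • listOrbit T (s • u) L f

variable {T : Fin d → ℝ → H →L[𝕜] H} (hT : ∀ i, IsContractionSemigroup (T i))
include hT

omit [NormedSpace ℝ H] [IsScalarTower ℝ 𝕜 H] in
theorem continuousOn_listOrbit_smul {s : ℝ} (hs : 0 < s) (L : List (Fin d)) (f : H) :
    ContinuousOn (fun u => listOrbit T (s • u) L f) (kernelRegion d) :=
  (continuousOn_listOrbit hT L f).comp (by fun_prop) fun u hu k =>
    (smul_mem_of_mem_kernelRegion hs le_rfl hu k).1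

omit [NormedSpace ℝ H] [IsScalarTower ℝ 𝕜 H] in
theorem integrable_kernelAverage {s : ℝ} (hs : 0 < s) (L : List (Fin d))
    {φ : EuclideanSpace ℝ (Fin d) → 𝕜} (hφ : Continuous φ)
    (hz : ∀ u, u ∉ kernelSupport d → φ u = 0) (f : H) :
    Integrable fun u => φ u • listOrbit T (s • u) L f :=
  integrable_kernel_smul hφ hz (continuousOn_listOrbit_smul hT hs L f)

omit [IsScalarTower ℝ 𝕜 H] in
theorem norm_kernelAverage_le {s b : ℝ} (hs : 0 < s) (L : List (Fin d))
    {φ : EuclideanSpace ℝ (Fin d) → 𝕜} (hb : 0 ≤ b)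
    (hz : ∀ u, u ∉ kernelSupport d → φ u = 0) (hφ : ∀ u, ‖φ u‖ ≤ b) (f : H) :
    ‖kernelAverage T L s φ f‖ ≤ kernelVolume d * b * ‖f‖ :=
  norm_integral_kernel_le hb hz hφ fun _ hu => norm_listOrbit_apply_le hT
    (fun k => (smul_mem_of_mem_kernelRegion hs le_rfl (kernelSupport_subset hu) k).1) L f

omit [IsScalarTower ℝ 𝕜 H] in
theorem kernelAverage_add {s : ℝ} (hs : 0 < s) (L : List (Fin d))
    {φ : EuclideanSpace ℝ (Fin d) → 𝕜} (hφ : Continuous φ)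
    (hz : ∀ u, u ∉ kernelSupport d → φ u = 0) (f g : H) :
    kernelAverage T L s φ (f + g) = kernelAverage T L s φ f + kernelAverage T L s φ g := by
  simp only [kernelAverage, map_add, smul_add]
  exact integral_add (integrable_kernelAverage hT hs L hφ hz f)
    (integrable_kernelAverage hT hs L hφ hz g)

omit hT in
theorem kernelAverage_smul (s : ℝ) (L : List (Fin d))
    (φ : EuclideanSpace ℝ (Fin d) → 𝕜) (c : 𝕜) (f : H) :
    kernelAverage T L s φ (c • f) = c • kernelAverage T L s φ f := by
  simp only [kernelAverage, map_smul]
  rw [← integral_smul]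
  simp only [smul_comm c]

omit hT in
theorem kernelAverage_mul (s : ℝ) (L : List (Fin d))
    (φ : EuclideanSpace ℝ (Fin d) → 𝕜) (c : 𝕜) (f : H) :
    kernelAverage T L s (fun u => c * φ u) f = c • kernelAverage T L s φ f := by
  simp only [kernelAverage, mul_smul]
  rw [← integral_smul]

theorem kernelAverage_sub {s : ℝ} (hs : 0 < s) (L : List (Fin d))
    {φ : EuclideanSpace ℝ (Fin d) → 𝕜} (hφ : Continuous φ)
    (hz : ∀ u, u ∉ kernelSupport d → φ u = 0) (f g : H) :
    kernelAverage T L s φ (f - g) = kernelAverage T L s φ f - kernelAverage T L s φ g := by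
  have := kernelAverage_add hT hs L hφ hz f ((-1 : 𝕜) • g)
  rw [kernelAverage_smul] at this
  simpa [sub_eq_add_neg] using this

theorem kernelAverage_sum {ι : Type*} {s : ℝ} (hs : 0 < s) (L : List (Fin d))
    {φ : EuclideanSpace ℝ (Fin d) → 𝕜} (hφ : Continuous φ)
    (hz : ∀ u, u ∉ kernelSupport d → φ u = 0) (I : Finset ι) (f : ι → H) :
    kernelAverage T L s φ (∑ i ∈ I, f i) = ∑ i ∈ I, kernelAverage T L s φ (f i) := by
  classical
  induction I using Finset.induction_on with
  | empty => simpa using kernelAverage_smul (T := T) s L φ (0 : 𝕜) (0 : H)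
  | insert a I ha ih =>
    rw [Finset.sum_insert ha, Finset.sum_insert ha, kernelAverage_add hT hs L hφ hz, ih]

section CommutingList

variable {L : List (Fin d)} {δ : ℝ} {E C : EuclideanSpace ℝ (Fin d) → Fin d → Fin d → 𝕜}
  (hinv : ∀ i, ∀ t : ℝ, 0 ≤ t → ∀ f ∈ sobolevSpace T 1, T i t f ∈ sobolevSpace T 1)
  (hL : ListCommutesVia T L δ E C)
include hinv hL

/-- The generator passes under the integral and through the product; the coefficients E(su) are
absorbed into the kernel, so averages of derivatives are again of the same kind. -/
theorem kernelAverage_mem_and_generator [CompleteSpace H] {s b : ℝ} (hs : 0 < s)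
    (hsδ : 2 * s ≤ δ) {φ : EuclideanSpace ℝ (Fin d) → 𝕜} (hφ : IsKernel b φ) {y : H}
    (hy : y ∈ sobolevSpace T 1) (i : Fin d) :
    HasGenerator (T i) (kernelAverage T L s φ y)
      (∑ l, kernelAverage T L s (fun u => E (s • u) i l * φ u) (generator (T l) y)) := by
  have hcont : ∀ l, Continuous fun u => E (s • u) i l * φ u := fun l =>
    ((hL.contDiff i l).continuous.comp (continuous_const_smul s)).mul hφ.contDiff.continuous
  have hz : ∀ l u, u ∉ kernelSupport d → E (s • u) i l * φ u = 0 := fun l u hu => by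
    rw [hφ.eq_zero u hu, mul_zero]
  have hint : ∀ l, Integrable fun u =>
      (E (s • u) i l * φ u) • listOrbit T (s • u) L (generator (T l) y) := fun l =>
    integrable_kernelAverage hT hs L (hcont l) (hz l) _
  simp only [kernelAverage]
  rw [← integral_finsetSum _ fun l _ => hint l]
  refine (hT i).hasGenerator_integral
    (integrable_kernelAverage hT hs L hφ.contDiff.continuous hφ.eq_zero y)
    (integrable_finsetSum _ fun l _ => hint l) fun u => ?_
  by_cases hu : u ∈ kernelSupport d
  · have hu' := smul_mem_of_mem_kernelRegion hs hsδ (kernelSupport_subset hu)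
    have h1 := hasGenerator_of_mem_succ
      (listOrbit_mem_sobolevSpace_one hinv (fun k => (hu' k).1) L hy) i
    rw [hL.generator_eq _ hu' y hy i] at h1
    have h2 := h1.smul (φ u)
    rw [Finset.smul_sum] at h2
    simpa only [smul_smul, mul_comm (φ u)] using h2
  · simpa [hφ.eq_zero u hu] using HasGenerator.zero (T := T i)

theorem kernelAverage_mem_sobolevSpace_one [CompleteSpace H] {s b : ℝ} (hs : 0 < s)
    (hsδ : 2 * s ≤ δ) {φ : EuclideanSpace ℝ (Fin d) → 𝕜} (hφ : IsKernel b φ) {y : H}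
    (hy : y ∈ sobolevSpace T 1) : kernelAverage T L s φ y ∈ sobolevSpace T 1 :=
  mem_sobolevSpace_one fun i => kernelAverage_mem_and_generator hT hinv hL hs hsδ hφ hy i

omit [NormedSpace ℝ H] [IsScalarTower ℝ 𝕜 H] hinv in
theorem continuousOn_listPartial_smul {s : ℝ} (hs : 0 < s) (hsδ : 2 * s ≤ δ) {y : H}
    (hy : y ∈ sobolevSpace T 1) (k : Fin d) :
    ContinuousOn (fun u => listPartial T k (s • u) L y) (kernelRegion d) := by
  have : ContinuousOn (fun u => ∑ l, C (s • u) k l • listOrbit T (s • u) L (generator (T l) y))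
      (kernelRegion d) := by
    refine continuousOn_finsetSum _ fun l _ => ContinuousOn.smul ?_
      (continuousOn_listOrbit_smul hT hs L _)
    exact ((hL.contDiff' k l).continuous.comp (continuous_const_smul s)).continuousOn
  refine this.congr fun u hu => ?_
  exact hL.listPartial_eq _ (smul_mem_of_mem_kernelRegion hs hsδ hu) y hy k

/-- Integration by parts in u_k; the factor s⁻¹ comes from the chain rule for u ↦ su. -/
theorem integral_smul_listPartial {s b : ℝ} (hs : 0 < s) (hsδ : 2 * s ≤ δ)
    {φ : EuclideanSpace ℝ (Fin d) → 𝕜} (hφ : IsKernel b φ) {y : H}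
    (hy : y ∈ sobolevSpace T 1) (k : Fin d) :
    ∫ u, φ u • listPartial T k (s • u) L y =
      -(s⁻¹ • kernelAverage T L s (partialDeriv k φ) y) := by
  have hline : ∀ u ∈ tsupport φ, HasLineDerivAt ℝ (fun u => listOrbit T (s • u) L y)
      (s • listPartial T k (s • u) L y) u (EuclideanSpace.single k 1) := fun u hu => by
    have huK : u ∈ kernelSupport d := by
      refine closure_minimal (fun x hx => ?_) isClosed_kernelSupport hu
      by_contra h
      exact hx (hφ.eq_zero x h)
    have hu0 := kernelSupport_subset huK
    have h1 := hasDerivWithinAt_listOrbit hT hinv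
      (fun k => (smul_mem_of_mem_kernelRegion hs hsδ hu0 k).1) k L hy
    have hpos : 0 < (s • u) k := by simpa using mul_pos hs (hu0 k).1
    -- The k-th coordinate is strictly positive on the support, so the derivative within the
    -- half-line is a full one.
    have h2 := h1.hasDerivAt (by
      filter_upwards [lt_mem_nhds (show -(s • u) k < 0 by linarith)] with h hh
      show 0 ≤ (s • u) k + h
      linarith)
    have h3 : HasDerivAt (fun τ : ℝ => s * τ) s 0 := by
      simpa using (hasDerivAt_id (0 : ℝ)).const_mul s
    have h4 := HasDerivAt.scomp_of_eq (0 : ℝ) h2 h3 (by simp)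
    refine HasDerivAt.congr_of_eventuallyEq h4 (Eventually.of_forall fun τ => ?_)
    simp only [Function.comp_apply]
    congr 2
    ext j
    by_cases hj : j = k <;> simp [hj]
  have hzp : ∀ u, u ∉ kernelSupport d → partialDeriv k φ u = 0 := hφ.partialDeriv_eq_zero k
  have h5 := integral_bilinear_hasLineDerivAt_right_eq_neg_left_of_integrable (μ := volume)
    (B := ContinuousLinearMap.lsmul ℝ 𝕜 (E := H)) (f := φ) (f' := partialDeriv k φ)
    (g := fun u => listOrbit T (s • u) L y) (g' := fun u => s • listPartial T k (s • u) L y)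
    (v := EuclideanSpace.single k 1)
    (integrable_kernelAverage hT hs L (hφ.continuous_partialDeriv k) hzp y)
    (integrable_kernel_smul hφ.contDiff.continuous hφ.eq_zero
      ((continuousOn_listPartial_smul hT hL hs hsδ hy k).const_smul s))
    (integrable_kernelAverage hT hs L hφ.contDiff.continuous hφ.eq_zero y)
    (fun u _ => (hφ.contDiff.differentiable one_ne_zero u).hasFDerivAt.hasLineDerivAt _) hline
  simp only [ContinuousLinearMap.lsmul_apply] at h5
  simp only [smul_comm (_ : 𝕜) s] at h5
  rw [integral_smul] at h5
  rw [kernelAverage, ← smul_neg, ← h5, inv_smul_smul₀ hs.ne']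

end CommutingList

end Average

/-! ### Averages of generators bounded by absorption. -/

section KernelEstimate

open MeasureTheory

/-- The absorption principle: a supremum known in advance to be finite may be subtracted from both
sides. The a priori bound may be as bad as one likes, since it does not enter the conclusion. -/
theorem le_two_mul_of_self_bound {ι : Type*} {F : ι → ℝ} {A : ℝ}
    (hbdd : BddAbove (Set.range F)) (h : ∀ M, (∀ j, F j ≤ M) → ∀ i, F i ≤ A + M / 2) (i : ι) :
    F i ≤ 2 * A := by
  have : Nonempty ι := ⟨i⟩
  have h1 : ⨆ j, F j ≤ A + (⨆ j, F j) / 2 := ciSup_le (h _ fun j => le_ciSup hbdd j)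
  exact (le_ciSup hbdd i).trans (by linarith)

theorem eventually_mul_le {a : ℝ} (c : ℝ) (ha : 0 < a) : ∀ᶠ s in 𝓝[>] (0 : ℝ), s * c ≤ a := by
  have h : Tendsto (fun s : ℝ => s * c) (𝓝[>] 0) (𝓝 0) := by
    have : Continuous fun s : ℝ => s * c := by fun_prop
    simpa using (this.tendsto 0).mono_left nhdsWithin_le_nhds
  exact h.eventually_le_const ha

theorem eventually_scale {δ : ℝ} (hδ : 0 < δ) (d : ℕ) :
    ∀ᶠ s in 𝓝[>] (0 : ℝ), 0 < s ∧ 2 * s ≤ δ ∧ s * kernelRadius d ≤ 1 / 2 ∧ s ≤ 1 := by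
  filter_upwards [self_mem_nhdsWithin, eventually_mul_le 2 hδ,
    eventually_mul_le (kernelRadius d) (half_pos one_pos), eventually_mul_le 1 one_pos]
    with s h0 h1 h2 h3
  exact ⟨h0, by linarith, h2, by linarith⟩

variable {𝕜 H : Type*} [RCLike 𝕜] [NormedAddCommGroup H] [InnerProductSpace 𝕜 H] {d : ℕ}
  {T : Fin d → ℝ → H →L[𝕜] H} (hT : ∀ i, IsContractionSemigroup (T i))
  [NormedSpace ℝ H] [IsScalarTower ℝ 𝕜 H]

omit [IsScalarTower ℝ 𝕜 H] in
include hT in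
theorem IsKernel.norm_kernelAverage_le {s b : ℝ} (hs : 0 < s) (L : List (Fin d))
    {φ : EuclideanSpace ℝ (Fin d) → 𝕜} (hφ : IsKernel b φ) (f : H) :
    ‖kernelAverage T L s φ f‖ ≤ kernelVolume d * b * ‖f‖ :=
  _root_.norm_kernelAverage_le hT hs L hφ.nonneg hφ.eq_zero hφ.norm_le f

include hT in
theorem exists_clm_kernelAverage {s : ℝ} (hs : 0 < s) (L : List (Fin d))
    {φ : EuclideanSpace ℝ (Fin d) → 𝕜} {b : ℝ} (hφ : IsKernel b φ) :
    ∃ A : H →L[𝕜] H, ∀ f, A f = kernelAverage T L s φ f :=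
  ⟨LinearMap.mkContinuous
    { toFun := kernelAverage T L s φ
      map_add' := kernelAverage_add hT hs L hφ.contDiff.continuous hφ.eq_zero
      map_smul' := kernelAverage_smul s L φ } (kernelVolume d * b)
    (hφ.norm_kernelAverage_le hT hs L), fun _ => rfl⟩

omit [IsScalarTower ℝ 𝕜 H] in
include hT in
theorem kernelAverage_mul_eq {s b b' : ℝ} (hs : 0 < s) (L : List (Fin d))
    {φ ψ : EuclideanSpace ℝ (Fin d) → 𝕜} (hφ : IsKernel b φ)
    (hψ : IsKernel b' fun u => (ψ (s • u) - ψ 0) * φ u) (f : H) :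
    kernelAverage T L s (fun u => ψ (s • u) * φ u) f =
      kernelAverage T L s (fun u => (ψ (s • u) - ψ 0) * φ u) f +
        ψ 0 • kernelAverage T L s φ f := by
  rw [← kernelAverage_mul]
  simp only [kernelAverage]
  rw [← integral_add (integrable_kernelAverage hT hs L hψ.contDiff.continuous hψ.eq_zero f)
    (integrable_kernelAverage hT hs L (hφ.smul (ψ 0)).contDiff.continuous
      (hφ.smul (ψ 0)).eq_zero f)]
  refine integral_congr_ae (Eventually.of_forall fun u => ?_)
  simp only [← add_smul]
  congr 1
  ring

variable {L : List (Fin d)} {δ : ℝ} {E C : EuclideanSpace ℝ (Fin d) → Fin d → Fin d → 𝕜}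
  (hinv : ∀ i, ∀ t : ℝ, 0 ≤ t → ∀ f ∈ sobolevSpace T 1, T i t f ∈ sobolevSpace T 1)
  (hL : ListCommutesVia T L δ E C)

include hT hinv hL in
theorem smul_kernelAverage_partialDeriv {s b : ℝ} (hs : 0 < s) (hsδ : 2 * s ≤ δ)
    {φ : EuclideanSpace ℝ (Fin d) → 𝕜} (hφ : IsKernel b φ) {y : H}
    (hy : y ∈ sobolevSpace T 1) (k : Fin d) :
    s⁻¹ • kernelAverage T L s (partialDeriv k φ) y =
      -∑ l, kernelAverage T L s (fun u => C (s • u) k l * φ u) (generator (T l) y) := by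
  rw [eq_neg_iff_add_eq_zero, add_comm, ← sub_neg_eq_add,
    ← integral_smul_listPartial hT hinv hL hs hsδ hφ hy k, sub_eq_zero]
  simp only [kernelAverage]
  rw [← integral_finsetSum]
  · refine integral_congr_ae (Eventually.of_forall fun u => ?_)
    by_cases hu : u ∈ kernelSupport d
    · have hu' := smul_mem_of_mem_kernelRegion hs hsδ (kernelSupport_subset hu)
      simp only [hL.listPartial_eq _ hu' y hy, Finset.smul_sum, smul_smul, mul_comm (φ u)]
    · simp [hφ.eq_zero u hu]
  · intro l _
    exact integrable_kernelAverage hT hs L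
      (((hL.contDiff' k l).continuous.comp (continuous_const_smul s)).mul hφ.contDiff.continuous)
      (fun u hu => by simp [hφ.eq_zero u hu]) _

include hT hinv hL in
-- Integration by parts yields all generators with coefficients C(su). Since k occurs once in the
-- list, the k-th row of C(0) selects D_k, so freezing C at 0 isolates the average of D_k up to
-- kernels of size O(s).
theorem kernelAverage_generator_eq {s b b' : ℝ} (hs : 0 < s) (hsδ : 2 * s ≤ δ)
    {φ : EuclideanSpace ℝ (Fin d) → 𝕜} (hφ : IsKernel b φ) {y : H}
    (hy : y ∈ sobolevSpace T 1) {k : Fin d} (hk : L.count k = 1)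
    (hC : ∀ l, IsKernel b' fun u => (C (s • u) k l - C 0 k l) * φ u) :
    kernelAverage T L s φ (generator (T k) y) =
      -(s⁻¹ • kernelAverage T L s (partialDeriv k φ) y) -
      ∑ l, kernelAverage T L s (fun u => (C (s • u) k l - C 0 k l) * φ u) (generator (T l) y) := by
  rw [smul_kernelAverage_partialDeriv hT hinv hL hs hsδ hφ hy k,
    Finset.sum_congr rfl fun l _ => kernelAverage_mul_eq (ψ := fun t => C t k l) hT hs L hφ
      (hC l) _, Finset.sum_add_distrib]
  simp [hL.zero', hk]

omit [NormedSpace ℝ H] [IsScalarTower ℝ 𝕜 H] in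
include hL in
/-- The coefficients of a commuting list perturb kernels by `O(s)`. -/
theorem ListCommutesVia.exists_isKernel_mul : ∃ B, 0 ≤ B ∧ ∀ s, 0 < s → s * kernelRadius d ≤ 1 / 2 →
    ∀ b φ, IsKernel b φ → ∀ i l,
      IsKernel (B * s * b) (fun u => (E (s • u) i l - E 0 i l) * φ u) ∧
      IsKernel (B * s * b) (fun u => (C (s • u) i l - C 0 i l) * φ u) ∧
      IsKernel (B * b) (fun u => C (s • u) i l * φ u) := by
  obtain ⟨B₁, h1, hB₁⟩ := exists_isKernel_mul_family (ψ := fun i l t => E t i l)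
    fun i l => (hL.contDiff i l).contDiffOn
  obtain ⟨B₂, h2, hB₂⟩ := exists_isKernel_mul_family (ψ := fun i l t => C t i l)
    fun i l => (hL.contDiff' i l).contDiffOn
  refine ⟨B₁ + B₂, add_nonneg h1 h2, fun s hs hsR b φ hφ i l => ?_⟩
  have hb := hφ.nonneg
  refine ⟨(hB₁ i l s hs hsR b φ hφ).2.mono ?_, (hB₂ i l s hs hsR b φ hφ).2.mono ?_,
    (hB₂ i l s hs hsR b φ hφ).1.mono ?_⟩
  · gcongr; linarith
  · gcongr; linarith
  · gcongr; linarith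

/-- The generators at `y` are combinations, with coefficients bounded by `Z` and up to errors
bounded by `β`, of the generators with index in `P`. -/
def ControlledBy (T : Fin d → ℝ → H →L[𝕜] H) (P : Finset (Fin d)) (Z β : ℝ) (y : H) : Prop :=
  ∃ (z : Fin d → Fin d → 𝕜) (w : Fin d → H), (∀ i k, ‖z i k‖ ≤ Z) ∧ (∀ i, ‖w i‖ ≤ β) ∧
    ∀ i, generator (T i) y = ∑ k ∈ P, z i k • generator (T k) y + w i

omit [IsScalarTower ℝ 𝕜 H] in
include hT in
theorem norm_kernelAverage_generator_le {P : Finset (Fin d)} {Z β : ℝ} {y : H} (hZ : 0 ≤ Z)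
    (hy : ControlledBy T P Z β y) {s b M : ℝ} (hs : 0 < s)
    {φ : EuclideanSpace ℝ (Fin d) → 𝕜} (hφ : IsKernel b φ)
    (hM : ∀ k ∈ P, ‖kernelAverage T L s φ (generator (T k) y)‖ ≤ M) (hM0 : 0 ≤ M) (i : Fin d) :
    ‖kernelAverage T L s φ (generator (T i) y)‖ ≤ d * Z * M + kernelVolume d * b * β := by
  obtain ⟨z, w, hz, hw, h⟩ := hy
  rw [h i, kernelAverage_add hT hs L hφ.contDiff.continuous hφ.eq_zero,
    kernelAverage_sum hT hs L hφ.contDiff.continuous hφ.eq_zero]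
  have hb := hφ.nonneg
  have hv := kernelVolume_nonneg (d := d)
  refine (norm_add_le _ _).trans (add_le_add ?_ ((hφ.norm_kernelAverage_le hT hs L _).trans
    (by gcongr; exact hw i)))
  refine (norm_sum_le_of_le P (f := fun k => kernelAverage T L s φ (z i k • generator (T k) y))
    (n := fun _ => Z * M) fun k hk => ?_).trans ?_
  · rw [kernelAverage_smul, norm_smul]
    exact mul_le_mul (hz i k) (hM k hk) (norm_nonneg _) hZ
  · rw [Finset.sum_const, nsmul_eq_mul, mul_assoc]
    gcongr
    exact (Finset.card_le_univ P).trans_eq (Fintype.card_fin d)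

include hT hinv hL in
/-- Integration by parts bounds the averages of the generators by `‖y‖ / s`. -/
theorem exists_norm_kernelAverage_generator_le [CompleteSpace H] (hδ : 0 < δ)
    {P : Finset (Fin d)} (hP : ∀ k ∈ P, L.count k = 1) {Z : ℝ} (hZ : 0 ≤ Z) :
    ∃ K, 0 ≤ K ∧ ∀ᶠ s in 𝓝[>] (0 : ℝ), ∀ y ∈ sobolevSpace T 1, ∀ β, ControlledBy T P Z β y →
      ∀ b φ, IsKernel b φ → ∀ i,
        ‖kernelAverage T L s φ (generator (T i) y)‖ ≤ K * b * (‖y‖ / s + β) := by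
  obtain ⟨B, hB0, hB⟩ := hL.exists_isKernel_mul
  set v := kernelVolume d with hv
  have hv0 : 0 ≤ v := kernelVolume_nonneg
  refine ⟨d * Z * (2 * (v + d * (B * v))) + v, by positivity, ?_⟩
  filter_upwards [eventually_scale hδ d, eventually_mul_le (d * (B * (d * Z))) (half_pos one_pos)]
    with s ⟨hs, hsδ, hsR, hs1⟩ hsmall y hy β hc b φ hφ i
  have hβ : 0 ≤ β := by
    obtain ⟨z, w, -, hw, -⟩ := hc
    exact (norm_nonneg _).trans (hw i)
  have hys : 0 ≤ ‖y‖ / s := by positivity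
  -- scaling
  have hscale : ∀ M, 0 ≤ M → (∀ φ, IsKernel 1 φ → ∀ k ∈ P,
      ‖kernelAverage T L s φ (generator (T k) y)‖ ≤ M) → ∀ b φ, IsKernel b φ → ∀ i,
      ‖kernelAverage T L s φ (generator (T i) y)‖ ≤ b * (d * Z * M + v * β) := by
    intro M hM0 hM b φ hφ i
    have key : ∀ k ∈ P, ‖kernelAverage T L s φ (generator (T k) y)‖ ≤ b * M := by
      intro k hk
      rcases hφ.nonneg.eq_or_lt with h0 | h0
      · have := hφ.norm_kernelAverage_le hT hs L (generator (T k) y)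
        rw [← h0] at this ⊢
        simpa using this
      · have h1 := hφ.smul (((b : ℝ) : 𝕜)⁻¹)
        rw [norm_inv, RCLike.norm_ofReal, abs_of_pos h0, inv_mul_cancel₀ h0.ne'] at h1
        have h2 := hM _ h1 k hk
        rw [kernelAverage_mul, norm_smul, norm_inv, RCLike.norm_ofReal, abs_of_pos h0,
          inv_mul_le_iff₀ h0] at h2
        exact h2
    have := norm_kernelAverage_generator_le hT (L := L) hZ hc hs hφ key
      (mul_nonneg hφ.nonneg hM0) i
    calc _ ≤ _ := this
      _ = _ := by rw [hv]; ring
  set A := v * (‖y‖ / s) + d * (B * (v * β)) with hA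
  -- The supremum runs over all unit kernels at once, because the error terms carry kernels
  -- different from φ. It is finite since the graph norm of y is.
  have hU : ∀ j : {φ : EuclideanSpace ℝ (Fin d) → 𝕜 // IsKernel 1 φ} × {k // k ∈ P},
      ‖kernelAverage T L s j.1.1 (generator (T j.2.1) y)‖ ≤ 2 * A := by
    refine le_two_mul_of_self_bound ⟨v * graphNorm T y, ?_⟩ ?_
    · rintro _ ⟨j, rfl⟩
      refine (j.1.2.norm_kernelAverage_le hT hs L _).trans ?_
      rw [mul_one]
      gcongr
      exact norm_generator_le_graphNorm y _
    · rintro M hM ⟨⟨φ, hφ⟩, ⟨k, hk⟩⟩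
      have hM0 : 0 ≤ M := (norm_nonneg _).trans (hM ⟨⟨φ, hφ⟩, ⟨k, hk⟩⟩)
      have hM' := hscale M hM0 fun φ hφ k hk => hM ⟨⟨φ, hφ⟩, ⟨k, hk⟩⟩
      have h3 := kernelAverage_generator_eq hT hinv hL hs hsδ hφ hy (hP k hk)
        fun l => (hB s hs hsR 1 φ hφ k l).2.1
      simp only
      rw [h3]
      refine (norm_sub_le _ _).trans ?_
      have h4 : ‖-(s⁻¹ • kernelAverage T L s (partialDeriv k φ) y)‖ ≤ v * (‖y‖ / s) := by
        rw [norm_neg, norm_smul, norm_inv, Real.norm_of_nonneg hs.le, inv_mul_le_iff₀ hs]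
        have := norm_kernelAverage_le hT hs L zero_le_one (hφ.partialDeriv_eq_zero k)
          (hφ.norm_partialDeriv_le k) y
        calc _ ≤ _ := this
          _ = s * (v * (‖y‖ / s)) := by rw [hv]; field_simp
      have h5 : ‖∑ l, kernelAverage T L s (fun u => (C (s • u) k l - C 0 k l) * φ u)
            (generator (T l) y)‖ ≤ d * (B * s * 1 * (d * Z * M + v * β)) := by
        refine (norm_sum_le_of_le _ fun l _ =>
          hM' _ _ (hB s hs hsR 1 φ hφ k l).2.1 l).trans (by simp)
      refine (add_le_add h4 h5).trans ?_
      -- The error kernels are O(s), so for small s they contribute at most half of the supremum M.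
      have h6 : s * (d * (B * (d * Z))) * M ≤ 1 / 2 * M := by gcongr
      have h7 : s * (d * (B * (v * β))) ≤ 1 * (d * (B * (v * β))) := by gcongr
      rw [hA]
      linarith
  have hA0 : 0 ≤ A := by positivity
  refine (hscale (2 * A) (by positivity) (fun φ hφ k hk => hU ⟨⟨φ, hφ⟩, ⟨k, hk⟩⟩) b φ hφ i).trans ?_
  have hb := hφ.nonneg
  have h1 : A ≤ (v + d * (B * v)) * (‖y‖ / s + β) := by
    rw [hA]
    have : 0 ≤ v * β + d * (B * v) * (‖y‖ / s) := by positivity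
    linarith
  calc b * (d * Z * (2 * A) + v * β)
      ≤ b * (d * Z * (2 * ((v + d * (B * v)) * (‖y‖ / s + β))) + v * (‖y‖ / s + β)) := by
        gcongr; linarith
    _ = _ := by ring

end KernelEstimate

/-! ### Commutators of averages with generators and semigroups. -/

section CommutatorEstimate

open MeasureTheory

variable {𝕜 H : Type*} [RCLike 𝕜] [NormedAddCommGroup H] [InnerProductSpace 𝕜 H] {d : ℕ}
  {T : Fin d → ℝ → H →L[𝕜] H} (hT : ∀ i, IsContractionSemigroup (T i))
  [NormedSpace ℝ H] [IsScalarTower ℝ 𝕜 H]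

/-- The distance of `g` from its average at scale `s`, and the derivatives of that average, in
units of `s`. -/
noncomputable def approxDefect (T : Fin d → ℝ → H →L[𝕜] H) (L : List (Fin d))
    (P : Finset (Fin d)) (κ : EuclideanSpace ℝ (Fin d) → 𝕜) (s : ℝ) (g : H) : ℝ :=
  ∑ k ∈ P, ‖s⁻¹ • kernelAverage T L s (partialDeriv k κ) g‖ +
    ‖s⁻¹ • (g - kernelAverage T L s κ g)‖

omit [IsScalarTower ℝ 𝕜 H] in
theorem approxDefect_nonneg (L : List (Fin d)) (P : Finset (Fin d))
    (κ : EuclideanSpace ℝ (Fin d) → 𝕜) (s : ℝ) (g : H) : 0 ≤ approxDefect T L P κ s g := by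
  unfold approxDefect; positivity

omit [IsScalarTower ℝ 𝕜 H] in
theorem norm_partial_le_approxDefect {L : List (Fin d)} {P : Finset (Fin d)}
    {κ : EuclideanSpace ℝ (Fin d) → 𝕜} {s : ℝ} {g : H} {k : Fin d} (hk : k ∈ P) :
    ‖s⁻¹ • kernelAverage T L s (partialDeriv k κ) g‖ ≤ approxDefect T L P κ s g :=
  (Finset.single_le_sum (f := fun k => ‖s⁻¹ • kernelAverage T L s (partialDeriv k κ) g‖)
    (fun _ _ => norm_nonneg _) hk).trans (le_add_of_nonneg_right (norm_nonneg _))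

omit [IsScalarTower ℝ 𝕜 H] in
theorem norm_sub_le_approxDefect {L : List (Fin d)} {P : Finset (Fin d)}
    {κ : EuclideanSpace ℝ (Fin d) → 𝕜} {s : ℝ} {g : H} :
    ‖s⁻¹ • (g - kernelAverage T L s κ g)‖ ≤ approxDefect T L P κ s g :=
  le_add_of_nonneg_left (Finset.sum_nonneg fun _ _ => norm_nonneg _)

variable {L : List (Fin d)} {δ : ℝ} {E C : EuclideanSpace ℝ (Fin d) → Fin d → Fin d → 𝕜}
  (hinv : ∀ i, ∀ t : ℝ, 0 ≤ t → ∀ f ∈ sobolevSpace T 1, T i t f ∈ sobolevSpace T 1)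
  (hL : ListCommutesVia T L δ E C)

include hT hinv hL in
-- As E(0) = I, freezing E at 0 displays the commutator of D_i with the average as a sum over
-- kernels of size O(s).
theorem generator_kernelAverage [CompleteSpace H] {s b b' : ℝ} (hs : 0 < s)
    (hsδ : 2 * s ≤ δ) {φ : EuclideanSpace ℝ (Fin d) → 𝕜} (hφ : IsKernel b φ) {y : H}
    (hy : y ∈ sobolevSpace T 1) (i : Fin d)
    (hE : ∀ l, IsKernel b' fun u => (E (s • u) i l - E 0 i l) * φ u) :
    generator (T i) (kernelAverage T L s φ y) =
      ∑ l, kernelAverage T L s (fun u => (E (s • u) i l - E 0 i l) * φ u) (generator (T l) y) +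
        kernelAverage T L s φ (generator (T i) y) := by
  rw [(kernelAverage_mem_and_generator hT hinv hL hs hsδ hφ hy i).generator_eq,
    Finset.sum_congr rfl fun l _ => kernelAverage_mul_eq (ψ := fun t => E t i l) hT hs L hφ
      (hE l) _, Finset.sum_add_distrib]
  simp [hL.zero]

include hT hinv hL in
/-- Bound for commutators with averages in terms of the defect. -/
theorem exists_kernelAverage_commutator_le [CompleteSpace H] (hδ : 0 < δ)
    {P : Finset (Fin d)} (hP : ∀ k ∈ P, L.count k = 1) {Z : ℝ} (hZ : 0 ≤ Z)
    {κ : EuclideanSpace ℝ (Fin d) → 𝕜} {b : ℝ} (hκ : IsKernel b κ) :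
    ∃ K, 0 ≤ K ∧ ∀ᶠ s in 𝓝[>] (0 : ℝ), ∀ g ∈ sobolevSpace T 1, ∀ β, ControlledBy T P Z β g →
      ∀ a φ, IsKernel a φ → ∀ i,
        ‖∑ l, kernelAverage T L s (fun u => (E (s • u) i l - E 0 i l) * φ u) (generator (T l) g)‖ ≤
          K * a * s * (approxDefect T L P κ s g + ‖g‖ + β) := by
  obtain ⟨B, hB0, hB⟩ := hL.exists_isKernel_mul
  obtain ⟨K₁, hK₁, hev⟩ := exists_norm_kernelAverage_generator_le hT hinv hL hδ hP hZ
  set v := kernelVolume d with hv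
  have hv0 : 0 ≤ v := kernelVolume_nonneg
  have hb := hκ.nonneg
  set a₁ := 1 + d * (K₁ * B * b) with ha₁
  set K₂ := d * (K₁ * B * b) + (d * Z * a₁ + v * b) with hK₂
  have ha₁0 : 0 ≤ a₁ := by positivity
  have hK₂0 : 0 ≤ K₂ := by positivity
  refine ⟨d * (B * (v * K₂ + K₁ * (1 + (1 + (d * Z + 1) * K₂)))), by positivity, ?_⟩
  filter_upwards [eventually_scale hδ d, hev]
    with s ⟨hs, hsδ, hsR, hs1⟩ hL1 g hg β hc a φ hφ i
  obtain ⟨z, w, hz, hw, hzw⟩ := id hc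
  have hβ : 0 ≤ β := (norm_nonneg _).trans (hw i)
  set θ := approxDefect T L P κ s g with hθ
  have hθ0 : 0 ≤ θ := approxDefect_nonneg L P κ s g
  set N := θ + ‖g‖ + β with hN
  have hN0 : 0 ≤ N := by positivity
  -- The O(s) size of the kernel cancels the 1/s of the general bound.
  have hgain : ∀ c : ℝ, 0 ≤ c → K₁ * (B * s * c) * (‖g‖ / s + β) ≤ K₁ * B * c * N := by
    intro c hc
    have : s * (‖g‖ / s + β) ≤ N := by
      rw [mul_add, mul_div_cancel₀ _ hs.ne', hN]
      nlinarith
    calc K₁ * (B * s * c) * (‖g‖ / s + β) = K₁ * B * c * (s * (‖g‖ / s + β)) := by ring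
      _ ≤ _ := by gcongr
  -- averages of the generators
  have hJP : ∀ k ∈ P, ‖kernelAverage T L s κ (generator (T k) g)‖ ≤ a₁ * N := by
    intro k hk
    rw [kernelAverage_generator_eq hT hinv hL hs hsδ hκ hg (hP k hk)
      fun l => (hB s hs hsR b κ hκ k l).2.1]
    refine (norm_sub_le _ _).trans ?_
    have h1 : ‖-(s⁻¹ • kernelAverage T L s (partialDeriv k κ) g)‖ ≤ N := by
      rw [norm_neg]
      refine (norm_partial_le_approxDefect hk).trans ?_
      rw [hN]; linarith [norm_nonneg g]
    have h2 : ‖∑ l, kernelAverage T L s (fun u => (C (s • u) k l - C 0 k l) * κ u)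
        (generator (T l) g)‖ ≤ d * (K₁ * B * b * N) :=
      (norm_sum_le_of_le _ fun l _ => (hL1 g hg β hc _ _ (hB s hs hsR b κ hκ k l).2.1 l).trans
        (hgain b hb)).trans (by simp)
    rw [ha₁]
    linarith
  have hJ : ∀ i, ‖kernelAverage T L s κ (generator (T i) g)‖ ≤ (d * Z * a₁ + v * b) * N := by
    intro i
    refine (norm_kernelAverage_generator_le hT hZ hc hs hκ hJP (by positivity) i).trans ?_
    have : v * b * β ≤ v * b * N := by gcongr; rw [hN]; linarith [norm_nonneg g]
    rw [← hv]
    linarith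
  -- Split g into the smooth part x, whose generators are bounded by K₂N, and the remainder g − x,
  -- which has norm at most sθ. On the remainder the bound ‖g − x‖/s of the averages is harmless.
  -- Applying that bound to g directly would lose a factor s.
  set x := kernelAverage T L s κ g with hx
  have hxmem : x ∈ sobolevSpace T 1 := kernelAverage_mem_sobolevSpace_one hT hinv hL hs hsδ hκ hg
  have hDx : ∀ i, ‖generator (T i) x‖ ≤ K₂ * N := by
    intro i
    rw [hx, generator_kernelAverage hT hinv hL hs hsδ hκ hg i
      fun l => (hB s hs hsR b κ hκ i l).1]
    refine (norm_add_le _ _).trans ?_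
    have h2 : ‖∑ l, kernelAverage T L s (fun u => (E (s • u) i l - E 0 i l) * κ u)
        (generator (T l) g)‖ ≤ d * (K₁ * B * b * N) :=
      (norm_sum_le_of_le _ fun l _ => (hL1 g hg β hc _ _ (hB s hs hsR b κ hκ i l).1 l).trans
        (hgain b hb)).trans (by simp)
    have := hJ i
    rw [hK₂]
    linarith
  have hymem : g - x ∈ sobolevSpace T 1 := sub_mem_sobolevSpace hg hxmem
  have hDy : ∀ i, generator (T i) (g - x) = generator (T i) g - generator (T i) x := fun i =>
    ((hasGenerator_of_mem_succ hg i).sub (hasGenerator_of_mem_succ hxmem i)).generator_eq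
  -- The remainder obeys the same relations between generators as g, with the generators of x moved
  -- into the error.
  set β' := (1 + (d * Z + 1) * K₂) * N with hβ'
  have hcy : ControlledBy T P Z β' (g - x) := by
    refine ⟨z, fun i => w i + (∑ k ∈ P, z i k • generator (T k) x - generator (T i) x), hz,
      fun i => ?_, fun i => ?_⟩
    · have h1 : ‖∑ k ∈ P, z i k • generator (T k) x‖ ≤ d * (Z * (K₂ * N)) := by
        refine (norm_sum_le_of_le P (n := fun _ => Z * (K₂ * N)) fun k _ => ?_).trans ?_
        · rw [norm_smul]
          exact mul_le_mul (hz i k) (hDx k) (norm_nonneg _) hZ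
        · rw [Finset.sum_const, nsmul_eq_mul]
          gcongr
          exact (Finset.card_le_univ P).trans_eq (Fintype.card_fin d)
      have h2 := hDx i
      have h3 := hw i
      have h4 : β ≤ N := by rw [hN]; linarith [norm_nonneg g]
      refine (norm_add_le _ _).trans ((add_le_add_right (norm_sub_le _ _) _).trans ?_)
      rw [hβ']
      linarith
    · simp only [hDy, smul_sub, Finset.sum_sub_distrib]
      rw [hzw i]
      abel
  have hyθ : ‖g - x‖ / s ≤ N := by
    have : ‖s⁻¹ • (g - x)‖ ≤ θ := norm_sub_le_approxDefect
    rw [norm_smul, norm_inv, Real.norm_of_nonneg hs.le, inv_mul_eq_div] at this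
    refine this.trans ?_
    rw [hN]; linarith [norm_nonneg g]
  have ha := hφ.nonneg
  refine (norm_sum_le_of_le _ (n := fun _ => B * s * a * (v * K₂ +
    K₁ * (1 + (1 + (d * Z + 1) * K₂))) * N) fun l _ => ?_).trans (le_of_eq (by simp; ring))
  have hker := (hB s hs hsR a φ hφ i l).1
  have hsplit : generator (T l) g = generator (T l) x + generator (T l) (g - x) := by
    rw [hDy]; abel
  rw [hsplit, kernelAverage_add hT hs L hker.contDiff.continuous hker.eq_zero]
  refine (norm_add_le _ _).trans ((add_le_add (hker.norm_kernelAverage_le hT hs L _)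
    (hL1 _ hymem β' hcy _ _ hker l)).trans ?_)
  rw [← hv]
  calc v * (B * s * a) * ‖generator (T l) x‖ + K₁ * (B * s * a) * (‖g - x‖ / s + β')
      ≤ v * (B * s * a) * (K₂ * N) + K₁ * (B * s * a) * (N + β') := by
        gcongr
        exact hDx l
    _ = _ := by rw [hβ']; ring

omit [NormedSpace ℝ H] [IsScalarTower ℝ 𝕜 H] in
include hT in
theorem eventually_norm_listOrbit_smul_sub_le (L : List (Fin d)) (f : H) {ε : ℝ} (hε : 0 < ε) :
    ∀ᶠ s in 𝓝[>] (0 : ℝ), ∀ u ∈ kernelSupport d, ‖listOrbit T (s • u) L f - f‖ ≤ ε := by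
  have h := (continuousOn_listOrbit hT L f 0 fun _ => le_rfl).tendsto
  rw [listOrbit_zero hT L 0 fun _ _ => rfl] at h
  obtain ⟨δ, hδ, hd⟩ := Metric.tendsto_nhdsWithin_nhds.1 h ε hε
  filter_upwards [self_mem_nhdsWithin, eventually_mul_le (kernelRadius d) (half_pos hδ)]
    with s hs hsδ u hu
  have hs : (0 : ℝ) < s := hs
  have h1 := hd (x := s • u)
    (fun k => (smul_mem_of_mem_kernelRegion hs le_rfl (kernelSupport_subset hu) k).1) (by
      rw [dist_zero_right, norm_smul, Real.norm_of_nonneg hs.le]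
      calc s * ‖u‖ ≤ s * kernelRadius d := by gcongr; exact norm_le_kernelRadius hu
        _ < δ := by linarith)
  rw [dist_eq_norm] at h1
  exact h1.le

omit [IsScalarTower ℝ 𝕜 H] in
include hT in
theorem kernelAverage_sub_integral_smul [CompleteSpace H] {s : ℝ} (hs : 0 < s) (L : List (Fin d))
    {φ : EuclideanSpace ℝ (Fin d) → 𝕜} (hφ : Continuous φ)
    (hz : ∀ u, u ∉ kernelSupport d → φ u = 0) (f : H) :
    kernelAverage T L s φ f - (∫ u, φ u) • f = ∫ u, φ u • (listOrbit T (s • u) L f - f) := by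
  rw [← integral_smul_const, kernelAverage, ← integral_sub
    (integrable_kernelAverage hT hs L hφ hz f) (integrable_kernel_smul hφ hz continuousOn_const)]
  simp only [smul_sub]

omit [IsScalarTower ℝ 𝕜 H] in
include hT in
theorem tendsto_kernelAverage [CompleteSpace H] (L : List (Fin d)) {φ : EuclideanSpace ℝ (Fin d) → 𝕜} {b : ℝ}
    (hφ : IsKernel b φ) (f : H) :
    Tendsto (fun s => kernelAverage T L s φ f) (𝓝[>] 0) (𝓝 ((∫ u, φ u) • f)) := by
  rw [Metric.tendsto_nhds]
  intro ε hε
  set c := kernelVolume d * b with hc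
  have hc0 : 0 ≤ c := mul_nonneg kernelVolume_nonneg hφ.nonneg
  have hpos : 0 < c + 1 := by linarith
  filter_upwards [self_mem_nhdsWithin, eventually_norm_listOrbit_smul_sub_le hT L f
    (div_pos hε hpos)] with s hs h
  rw [dist_eq_norm, kernelAverage_sub_integral_smul hT hs L hφ.contDiff.continuous hφ.eq_zero]
  refine (norm_integral_kernel_le hφ.nonneg hφ.eq_zero hφ.norm_le h).trans_lt ?_
  rw [← hc, mul_div_assoc', div_lt_iff₀ hpos]
  nlinarith

omit [IsScalarTower ℝ 𝕜 H] in
include hT in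
theorem tendsto_kernelAverage_mul [CompleteSpace H] (L : List (Fin d)) {φ ψ : EuclideanSpace ℝ (Fin d) → 𝕜} {b : ℝ}
    (hφ : IsKernel b φ) (hψ : ContDiffOn ℝ 1 ψ (Metric.ball 0 1)) (f : H) :
    Tendsto (fun s => kernelAverage T L s (fun u => ψ (s • u) * φ u) f) (𝓝[>] 0)
      (𝓝 (ψ 0 • (∫ u, φ u) • f)) := by
  obtain ⟨B, hB0, hB⟩ := exists_isKernel_mul hψ
  have h1 : Tendsto (fun s => kernelAverage T L s (fun u => (ψ (s • u) - ψ 0) * φ u) f)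
      (𝓝[>] 0) (𝓝 0) := by
    refine squeeze_zero_norm' (a := fun s => s * (kernelVolume d * B * b * ‖f‖)) ?_ ?_
    · filter_upwards [eventually_scale one_pos d] with s ⟨hs, _, hsR, _⟩
      refine ((hB s hs hsR b φ hφ).2.norm_kernelAverage_le hT hs L f).trans (le_of_eq ?_)
      ring
    · have : Continuous fun s : ℝ => s * (kernelVolume d * B * b * ‖f‖) := by fun_prop
      simpa using (this.tendsto 0).mono_left nhdsWithin_le_nhds
  have h2 := h1.add ((tendsto_kernelAverage hT L hφ f).const_smul (ψ 0))
  rw [zero_add] at h2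
  refine h2.congr' ?_
  filter_upwards [eventually_scale one_pos d] with s ⟨hs, _, hsR, _⟩
  exact (kernelAverage_mul_eq hT hs L hφ (hB s hs hsR b φ hφ).2 f).symm

include hT hinv hL in
-- The generator D_k is recovered as a limit of bounded operators, so that bounds uniform in s pass
-- to D_k along orbits of T_m.
theorem tendsto_smul_kernelAverage_partialDeriv [CompleteSpace H] (hδ : 0 < δ)
    {φ : EuclideanSpace ℝ (Fin d) → 𝕜} {b : ℝ} (hφ : IsKernel b φ) (h1 : ∫ u, φ u = 1)
    {y : H} (hy : y ∈ sobolevSpace T 1) {k : Fin d} (hk : L.count k = 1) :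
    Tendsto (fun s : ℝ => s⁻¹ • kernelAverage T L s (partialDeriv k φ) y) (𝓝[>] 0)
      (𝓝 (-generator (T k) y)) := by
  have h2 : Tendsto (fun s : ℝ => -∑ l, kernelAverage T L s (fun u => C (s • u) k l * φ u)
      (generator (T l) y)) (𝓝[>] 0)
      (𝓝 (-∑ l, C 0 k l • (∫ u, φ u) • generator (T l) y)) :=
    (tendsto_finsetSum _ fun l _ => tendsto_kernelAverage_mul hT L hφ
      (ψ := fun t => C t k l) (hL.contDiff' k l).contDiffOn _).neg
  have h3 : ∑ l, C 0 k l • (∫ u, φ u) • generator (T l) y = generator (T k) y := by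
    simp [hL.zero', h1, hk]
  rw [h3] at h2
  refine h2.congr' ?_
  filter_upwards [eventually_scale hδ d] with s ⟨hs, hsδ, _, _⟩
  exact (smul_kernelAverage_partialDeriv hT hinv hL hs hsδ hφ hy k).symm

include hT in
theorem norm_listOrbit_sub_le {t : EuclideanSpace ℝ (Fin d)} {τ : ℝ}
    (ht : ∀ k, 0 ≤ t k ∧ t k ≤ τ) (L : List (Fin d)) {y : H} (hy : y ∈ sobolevSpace T 1) :
    ‖listOrbit T t L y - y‖ ≤ L.length * (τ * graphNorm T y) := by
  induction L with
  | nil => simp [listOrbit]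
  | cons a L ih =>
    have h1 : listOrbit T t (a :: L) y - y =
        T a (t a) (listOrbit T t L y - y) + (T a (t a) y - y) := by
      rw [listOrbit_cons_apply, map_sub]; abel
    rw [h1, List.length_cons, Nat.cast_succ, add_mul, one_mul]
    have hg := norm_generator_le_graphNorm (T := T) y a
    refine (norm_add_le _ _).trans (add_le_add (((hT a).norm_apply_le (ht a).1 _).trans ih)
      (((hT a).norm_sub_le (hasGenerator_of_mem_succ hy a) (ht a).1).trans ?_))
    exact mul_le_mul (ht a).2 hg (norm_nonneg _) ((ht a).1.trans (ht a).2)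

/-- Duhamel's formula for the commutator of A with S(σ), as a mean value inequality for ρ ↦ S(σ − ρ)
A S(ρ)h − ρW. The case W = 0 gives bounds, general W gives derivatives. -/
theorem IsContractionSemigroup.norm_commute_orbit_le {S : ℝ → H →L[𝕜] H}
    (hS : IsContractionSemigroup S) (A : H →L[𝕜] H) {h h' W : H} (hh : HasGenerator S h h')
    {σ c : ℝ} (hσ : 0 ≤ σ) {w : ℝ → H}
    (hw : ∀ ρ ∈ Set.Ico 0 σ, HasGenerator S (A (S ρ h)) (w ρ))
    (hc : ∀ ρ ∈ Set.Ico 0 σ, ‖S (σ - ρ) (A (S ρ h') - w ρ) - W‖ ≤ c) :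
    ‖A (S σ h) - S σ (A h) - σ • W‖ ≤ c * σ := by
  have hA : ∀ ρ, 0 ≤ ρ → HasDerivWithinAt (fun ρ => A (S ρ h)) (A (S ρ h')) (Set.Ici ρ) ρ :=
    fun ρ hρ => (A.restrictScalars ℝ).hasFDerivAt.comp_hasDerivWithinAt ρ
      ((hS.hasDerivWithinAt_orbit hh hρ).mono (Set.Ici_subset_Ici.2 hρ))
  have := norm_image_sub_le_of_norm_deriv_right_le_segment (a := 0) (b := σ) (C := c)
    (f := fun ρ => S (σ - ρ) (A (S ρ h)) - ρ • W)
    (f' := fun ρ => S (σ - ρ) (A (S ρ h') - w ρ) - (1 : ℝ) • W) ?_ ?_ ?_ σ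
    (Set.right_mem_Icc.2 hσ)
  · simp only [hS.zero_apply, sub_self, sub_zero, zero_smul] at this
    rwa [sub_right_comm] at this
  · refine ContinuousOn.sub (hS.continuousOn_apply (continuous_const.sub continuous_id).continuousOn
      (fun x hx => sub_nonneg.2 hx.2) ?_) (continuous_id.smul continuous_const).continuousOn
    exact A.continuous.comp_continuousOn ((hS.continuousOn h).mono Set.Icc_subset_Ici_self)
  · exact fun ρ hρ => (hS.hasDerivWithinAt_duhamel hρ.2 (hA ρ hρ.1) (hw ρ hρ)).sub
      ((hasDerivWithinAt_id ρ _).smul_const W)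
  · intro ρ hρ
    rw [one_smul]
    exact hc ρ hρ

include hT hinv hL in
theorem norm_kernelAverage_orbit_sub_le [CompleteSpace H] {s b b' : ℝ} (hs : 0 < s)
    (hsδ : 2 * s ≤ δ) {φ : EuclideanSpace ℝ (Fin d) → 𝕜} (hφ : IsKernel b φ) {y : H}
    (hy : y ∈ sobolevSpace T 1) (m : Fin d)
    (hE : ∀ l, IsKernel b' fun u => (E (s • u) m l - E 0 m l) * φ u) {σ c : ℝ} (hσ : 0 ≤ σ) {W : H}
    (hc : ∀ ρ ∈ Set.Ico 0 σ, ‖T m (σ - ρ) (-(s⁻¹ • ∑ l, kernelAverage T L s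
      (fun u => (E (s • u) m l - E 0 m l) * φ u) (generator (T l) (T m ρ y)))) - W‖ ≤ c) :
    ‖s⁻¹ • kernelAverage T L s φ (T m σ y) - T m σ (s⁻¹ • kernelAverage T L s φ y) - σ • W‖ ≤
      c * σ := by
  obtain ⟨A, hA⟩ := exists_clm_kernelAverage hT hs L hφ
  have hA' : ∀ f, (((s : 𝕜)⁻¹) • A) f = s⁻¹ • kernelAverage T L s φ f := fun f => by
    rw [smul_apply, hA, IsContractionSemigroup.ofReal_inv_smul]
  have hgen := hasGenerator_of_mem_succ hy m
  have := (hT m).norm_commute_orbit_le (((s : 𝕜)⁻¹) • A) hgen hσ (W := W) (c := c)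
    (w := fun ρ => s⁻¹ • generator (T m) (kernelAverage T L s φ (T m ρ y))) ?_ ?_
  · simpa only [hA'] using this
  · intro ρ hρ
    rw [hA', ← IsContractionSemigroup.ofReal_inv_smul (𝕜 := 𝕜),
      ← IsContractionSemigroup.ofReal_inv_smul (𝕜 := 𝕜)]
    refine HasGenerator.smul _ ?_
    exact hasGenerator_of_mem_succ (kernelAverage_mem_sobolevSpace_one hT hinv hL hs hsδ hφ
      (hinv m ρ hρ.1 y hy)) m
  · intro ρ hρ
    convert hc ρ hρ using 4
    rw [hA', generator_kernelAverage hT hinv hL hs hsδ hφ (hinv m ρ hρ.1 y hy) m hE,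
      ((hT m).hasGenerator_orbit hgen hρ.1).generator_eq, smul_add]
    abel

end CommutatorEstimate

/-! ### Uniform control of the defect along an orbit. -/

section OrbitEstimate

open MeasureTheory

variable {𝕜 H : Type*} [RCLike 𝕜] [NormedAddCommGroup H] [InnerProductSpace 𝕜 H] {d : ℕ}
  {T : Fin d → ℝ → H →L[𝕜] H} (hT : ∀ i, IsContractionSemigroup (T i))
  [NormedSpace ℝ H] [IsScalarTower ℝ 𝕜 H] [CompleteSpace H]
  {L : List (Fin d)} {δ : ℝ} {E C : EuclideanSpace ℝ (Fin d) → Fin d → Fin d → 𝕜}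
  (hinv : ∀ i, ∀ t : ℝ, 0 ≤ t → ∀ f ∈ sobolevSpace T 1, T i t f ∈ sobolevSpace T 1)
  (hL : ListCommutesVia T L δ E C) (hδ : 0 < δ)
  {P : Finset (Fin d)} {κ : EuclideanSpace ℝ (Fin d) → 𝕜} {b : ℝ} (hκ : IsKernel b κ)
  (hκ1 : ∫ u, κ u = 1)

include hT hinv hL hδ hκ hκ1 in
-- Initial value for the orbit estimate: integration by parts moves the derivative from the kernel
-- to h, and P(su)h − h is O(s) in the graph norm.
theorem exists_approxDefect_le_graphNorm : ∃ K, 0 ≤ K ∧ ∀ᶠ s in 𝓝[>] (0 : ℝ),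
    ∀ h ∈ sobolevSpace T 1, approxDefect T L P κ s h ≤ K * graphNorm T h := by
  obtain ⟨B, hB0, hB⟩ := hL.exists_isKernel_mul
  set v := kernelVolume d with hv
  have hv0 : 0 ≤ v := kernelVolume_nonneg
  have hb := hκ.nonneg
  refine ⟨d * (d * (v * (B * b))) + v * b * (L.length * 2), by positivity, ?_⟩
  filter_upwards [eventually_scale hδ d] with s ⟨hs, hsδ, hsR, _⟩ h hh
  have hG := graphNorm_nonneg (T := T) h
  rw [add_mul]
  refine add_le_add ?_ ?_
  · refine (Finset.sum_le_card_nsmul _ _ (d * (v * (B * b)) * graphNorm T h) fun k _ => ?_).trans ?_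
    · rw [smul_kernelAverage_partialDeriv hT hinv hL hs hsδ hκ hh k, norm_neg]
      refine (norm_sum_le_of_le _ (n := fun _ => v * (B * b) * graphNorm T h) fun l _ => ?_).trans
        (le_of_eq (by simp; ring))
      refine ((hB s hs hsR b κ hκ k l).2.2.norm_kernelAverage_le hT hs L _).trans ?_
      rw [← hv]
      gcongr
      exact norm_generator_le_graphNorm h l
    · have hcard : (P.card : ℝ) ≤ d := by
        exact_mod_cast (Finset.card_le_univ P).trans_eq (Fintype.card_fin d)
      have := mul_le_mul_of_nonneg_right hcard
        (show 0 ≤ d * (v * (B * b)) * graphNorm T h by positivity)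
      rw [nsmul_eq_mul]
      linarith
  · have h1 := kernelAverage_sub_integral_smul hT hs L hκ.contDiff.continuous hκ.eq_zero h
    rw [hκ1, one_smul] at h1
    rw [norm_smul, norm_sub_rev, h1, norm_inv, Real.norm_of_nonneg hs.le, inv_mul_le_iff₀ hs]
    refine (norm_integral_kernel_le hb hκ.eq_zero hκ.norm_le
      (M := L.length * (2 * s * graphNorm T h)) fun u hu => ?_).trans
      (le_of_eq (by rw [hv]; ring))
    exact norm_listOrbit_sub_le hT
      (smul_mem_of_mem_kernelRegion hs le_rfl (kernelSupport_subset hu)) L hh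

include hT hinv hL hδ hκ hκ1 in
/-- The defect of the orbit of `T m` stays bounded on a time interval independent of the scale. -/
theorem exists_approxDefect_orbit_le (hκ' : ∀ k, IsKernel b (partialDeriv k κ))
    (hP : ∀ k ∈ P, L.count k = 1) {m : Fin d} {Z ρ₁ : ℝ} (hZ : 0 ≤ Z) (hρ₁ : 0 < ρ₁)
    (hctl : ∀ ρ, 0 ≤ ρ → ρ ≤ ρ₁ → ∀ h ∈ sobolevSpace T 1,
      ControlledBy T P Z (Z * graphNorm T h) (T m ρ h)) :
    ∃ K σ₀, 0 ≤ K ∧ 0 < σ₀ ∧ σ₀ ≤ ρ₁ ∧ ∀ᶠ s in 𝓝[>] (0 : ℝ), ∀ h ∈ sobolevSpace T 1,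
      ∀ σ, 0 ≤ σ → σ ≤ σ₀ → ∀ k ∈ P,
      ‖s⁻¹ • kernelAverage T L s (partialDeriv k κ) (T m σ h)‖ ≤ K * graphNorm T h ∧
      ‖s⁻¹ • kernelAverage T L s (partialDeriv k κ) (T m σ h) -
        T m σ (s⁻¹ • kernelAverage T L s (partialDeriv k κ) h)‖ ≤ K * graphNorm T h * σ := by
  obtain ⟨B, hB0, hB⟩ := hL.exists_isKernel_mul
  obtain ⟨K₀, hK₀, hev₀⟩ := exists_approxDefect_le_graphNorm (P := P) hT hinv hL hδ hκ hκ1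
  obtain ⟨K₁, hK₁, hev₁⟩ := exists_kernelAverage_commutator_le hT hinv hL hδ hP hZ hκ
  have hb := hκ.nonneg
  -- The time σ₀ is chosen before s, so short that the d + 1 commutator errors in the defect absorb
  -- at most half of its supremum.
  obtain ⟨σ₀, ⟨hσ₀1, hσ₀2⟩, hσ₀⟩ := ((eventually_mul_le ((d + 1) * (K₁ * b)) (half_pos one_pos)).and
    (eventually_mul_le 1 hρ₁) |>.and self_mem_nhdsWithin).exists
  have hσ₀ : 0 < σ₀ := hσ₀
  rw [mul_one] at hσ₀2
  refine ⟨2 * (K₀ + (1 + Z) / 2) + K₁ * b * (2 * (K₀ + (1 + Z) / 2) + (1 + Z)), σ₀,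
    by positivity, hσ₀, hσ₀2, ?_⟩
  filter_upwards [eventually_scale hδ d, hev₀, hev₁] with s ⟨hs, hsδ, hsR, _⟩ hθ₀ hcom h hh
  set G := graphNorm T h with hG
  have hG0 : 0 ≤ G := graphNorm_nonneg h
  have hh' : ∀ σ, 0 ≤ σ → T m σ h ∈ sobolevSpace T 1 := fun σ hσ => hinv m σ hσ h hh
  -- one step of Duhamel's formula
  have step : ∀ M, 0 ≤ M → (∀ σ : Set.Icc 0 σ₀, approxDefect T L P κ s (T m σ h) ≤ M) →
      ∀ σ, 0 ≤ σ → σ ≤ σ₀ → ∀ φ, IsKernel b φ →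
      ‖s⁻¹ • kernelAverage T L s φ (T m σ h) - T m σ (s⁻¹ • kernelAverage T L s φ h)‖ ≤
        K₁ * b * (M + (1 + Z) * G) * σ := by
    intro M hM0 hM σ hσ hσ' φ hφ
    have := norm_kernelAverage_orbit_sub_le (W := 0) hT hinv hL hs hsδ hφ hh m
      (fun l => (hB s hs hsR b φ hφ m l).1) hσ (c := K₁ * b * (M + (1 + Z) * G)) ?_
    · simpa using this
    · intro ρ hρ
      rw [sub_zero]
      refine ((hT m).norm_apply_le (sub_nonneg.2 hρ.2.le) _).trans ?_
      rw [norm_neg, norm_smul, norm_inv, Real.norm_of_nonneg hs.le, inv_mul_le_iff₀ hs]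
      refine (hcom _ (hh' ρ hρ.1) _ (hctl ρ hρ.1 (hρ.2.le.trans (hσ'.trans hσ₀2)) h hh) b φ hφ
        m).trans ?_
      have h1 := hM ⟨ρ, hρ.1, hρ.2.le.trans hσ'⟩
      have h2 := ((hT m).norm_apply_le hρ.1 h).trans (norm_le_graphNorm (T := T) h)
      calc _ ≤ K₁ * b * s * (M + G + Z * G) := by gcongr
        _ = _ := by ring
  have hbound : ∀ σ : Set.Icc 0 σ₀, approxDefect T L P κ s (T m σ h) ≤
      2 * ((K₀ + (1 + Z) / 2) * G) := by
    refine le_two_mul_of_self_bound ?_ ?_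
    · refine ⟨∑ k ∈ P, s⁻¹ * (kernelVolume d * b * ‖h‖) + s⁻¹ * (‖h‖ + kernelVolume d * b * ‖h‖), ?_⟩
      rintro _ ⟨⟨σ, hσ⟩, rfl⟩
      have h1 := (hT m).norm_apply_le hσ.1 h
      have hv0 : 0 ≤ kernelVolume d := kernelVolume_nonneg
      refine add_le_add (Finset.sum_le_sum fun k _ => ?_) ?_
      · rw [norm_smul, norm_inv, Real.norm_of_nonneg hs.le]
        gcongr
        refine ((hκ' k).norm_kernelAverage_le hT hs L _).trans ?_
        gcongr
      · rw [norm_smul, norm_inv, Real.norm_of_nonneg hs.le]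
        gcongr
        refine (norm_sub_le _ _).trans (add_le_add h1 ((hκ.norm_kernelAverage_le hT hs L _).trans ?_))
        gcongr
    · rintro M hM ⟨σ, hσ⟩
      have hM0 : 0 ≤ M := (approxDefect_nonneg _ _ _ _ _).trans (hM ⟨0, le_rfl, hσ₀.le⟩)
      set e := K₁ * b * (M + (1 + Z) * G) * σ with he
      have he0 : 0 ≤ e := by have := hσ.1; positivity
      have hst := step M hM0 hM σ hσ.1 hσ.2
      have h1 : approxDefect T L P κ s (T m σ h) ≤ approxDefect T L P κ s h + (d + 1) * e := by
        have h2 : ∑ k ∈ P, ‖s⁻¹ • kernelAverage T L s (partialDeriv k κ) (T m σ h)‖ ≤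
            ∑ k ∈ P, ‖s⁻¹ • kernelAverage T L s (partialDeriv k κ) h‖ + d * e := by
          refine (Finset.sum_le_sum (g := fun k =>
            ‖s⁻¹ • kernelAverage T L s (partialDeriv k κ) h‖ + e) fun k _ => ?_).trans ?_
          · have h3 := hst _ (hκ' k)
            have h4 := norm_le_norm_add_norm_sub' (s⁻¹ • kernelAverage T L s (partialDeriv k κ) (T m σ h))
              (T m σ (s⁻¹ • kernelAverage T L s (partialDeriv k κ) h))
            have h5 := (hT m).norm_apply_le hσ.1 (s⁻¹ • kernelAverage T L s (partialDeriv k κ) h)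
            linarith
          · rw [Finset.sum_add_distrib, Finset.sum_const, nsmul_eq_mul]
            gcongr
            exact (Finset.card_le_univ P).trans_eq (Fintype.card_fin d)
        have h6 : ‖s⁻¹ • (T m σ h - kernelAverage T L s κ (T m σ h))‖ ≤
            ‖s⁻¹ • (h - kernelAverage T L s κ h)‖ + e := by
          have h3 := hst _ hκ
          have h5 := (hT m).norm_apply_le hσ.1 (s⁻¹ • (h - kernelAverage T L s κ h))
          have h7 : s⁻¹ • (T m σ h - kernelAverage T L s κ (T m σ h)) =
              T m σ (s⁻¹ • (h - kernelAverage T L s κ h)) -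
              (s⁻¹ • kernelAverage T L s κ (T m σ h) - T m σ (s⁻¹ • kernelAverage T L s κ h)) := by
            simp only [ContinuousLinearMap.map_smul_of_tower, map_sub, smul_sub]
            abel
          rw [h7]
          refine (norm_sub_le _ _).trans (add_le_add h5 h3)
        simp only [approxDefect]
        linarith
      have h2 : (d + 1) * e ≤ 1 / 2 * (M + (1 + Z) * G) := by
        calc (d + 1) * e = (σ * ((d + 1) * (K₁ * b))) * (M + (1 + Z) * G) := by rw [he]; ring
          _ ≤ (σ₀ * ((d + 1) * (K₁ * b))) * (M + (1 + Z) * G) := by gcongr; exact hσ.2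
          _ ≤ _ := by gcongr
      have h3 := hθ₀ h hh
      simp only
      linarith
  intro σ hσ hσ' k hk
  have hM0 : 0 ≤ 2 * ((K₀ + (1 + Z) / 2) * G) := by positivity
  constructor
  · refine (norm_partial_le_approxDefect hk).trans ((hbound ⟨σ, hσ, hσ'⟩).trans ?_)
    have : 0 ≤ K₁ * b * (2 * (K₀ + (1 + Z) / 2) + (1 + Z)) * G := by positivity
    linarith
  · refine (step _ hM0 hbound σ hσ hσ' _ (hκ' k)).trans ?_
    have : 0 ≤ 2 * (K₀ + (1 + Z) / 2) * G * σ := by positivity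
    linarith

end OrbitEstimate

/-! ### Derivative at time zero of the commutator of a generator with a semigroup. -/

section CommutatorDerivative

open MeasureTheory

variable {𝕜 H : Type*} [RCLike 𝕜] [NormedAddCommGroup H] [InnerProductSpace 𝕜 H] {d : ℕ}
  {T : Fin d → ℝ → H →L[𝕜] H} (hT : ∀ i, IsContractionSemigroup (T i))
  [NormedSpace ℝ H] [IsScalarTower ℝ 𝕜 H]

include hT in
-- Dominated convergence: s⁻¹(ψ(su) − ψ(0)) tends to Dψ(0)u and P(su)f to f, so c = ∫ Dψ(0)u φ(u)
-- du, the same for all f.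
theorem exists_tendsto_kernelAverage_increment [CompleteSpace H] (L : List (Fin d))
    {φ ψ : EuclideanSpace ℝ (Fin d) → 𝕜} {b : ℝ} (hφ : IsKernel b φ)
    (hψ : ContDiffOn ℝ 1 ψ (Metric.ball 0 1)) :
    ∃ c : 𝕜, ∀ f, Tendsto (fun s : ℝ => s⁻¹ • kernelAverage T L s
      (fun u => (ψ (s • u) - ψ 0) * φ u) f) (𝓝[>] 0) (𝓝 (c • f)) := by
  obtain ⟨B, hB0, hB⟩ := exists_isKernel_mul hψ
  have hb := hφ.nonneg
  refine ⟨∫ u, fderiv ℝ ψ 0 u * φ u, fun f => ?_⟩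
  rw [← integral_smul_const]
  simp only [kernelAverage, ← integral_smul]
  refine tendsto_integral_filter_of_dominated_convergence
    ((kernelSupport d).indicator fun _ => B * b * ‖f‖) ?_ ?_ ?_ ?_
  · filter_upwards [eventually_scale one_pos d] with s ⟨hs, _, hsR, _⟩
    have hk := (hB s hs hsR b φ hφ).2
    exact (integrable_kernelAverage hT hs L hk.contDiff.continuous hk.eq_zero
      f).aestronglyMeasurable.const_smul _
  · filter_upwards [eventually_scale one_pos d] with s ⟨hs, _, hsR, _⟩
    refine Eventually.of_forall fun u => ?_
    have hk := (hB s hs hsR b φ hφ).2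
    by_cases hu : u ∈ kernelSupport d
    · rw [Set.indicator_of_mem hu, norm_smul, norm_smul, norm_inv, Real.norm_of_nonneg hs.le,
        inv_mul_le_iff₀ hs]
      have h1 := norm_listOrbit_apply_le hT (fun k => (smul_mem_of_mem_kernelRegion hs le_rfl
        (kernelSupport_subset hu) k).1) L f
      calc _ ≤ B * s * b * ‖f‖ :=
            mul_le_mul (hk.norm_le u) h1 (norm_nonneg _) hk.nonneg
        _ = _ := by ring
    · rw [Set.indicator_of_notMem hu, hk.eq_zero u hu, zero_smul, smul_zero, norm_zero]
  · exact (integrable_indicator_iff isClosed_kernelSupport.measurableSet).2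
      (integrableOn_const isCompact_kernelSupport.measure_ne_top)
  · refine Eventually.of_forall fun u => ?_
    by_cases hu : u ∈ kernelSupport d
    swap
    · simp [hφ.eq_zero u hu]
    have h1 : HasFDerivAt ψ (fderiv ℝ ψ 0) 0 :=
      (((hψ 0 (Metric.mem_ball_self one_pos)).contDiffAt
        (Metric.isOpen_ball.mem_nhds (Metric.mem_ball_self one_pos))).differentiableAt
        one_ne_zero).hasFDerivAt
    have h2 := h1.hasLineDerivAt u
    have h3 : Tendsto (fun s : ℝ => s⁻¹ • (ψ (s • u) - ψ 0)) (𝓝[>] 0) (𝓝 (fderiv ℝ ψ 0 u)) := by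
      have := h2.tendsto_slope_zero_right
      simpa using this
    have h4 : Tendsto (fun s : ℝ => listOrbit T (s • u) L f) (𝓝[>] 0) (𝓝 f) := by
      rw [Metric.tendsto_nhds]
      intro ε hε
      filter_upwards [eventually_norm_listOrbit_smul_sub_le hT L f (half_pos hε)] with s hs
      rw [dist_eq_norm]
      exact (hs u hu).trans_lt (half_lt_self hε)
    refine ((h3.mul_const (φ u)).smul h4).congr fun s => ?_
    rw [← smul_assoc, smul_mul_assoc]

variable [CompleteSpace H]
  {L : List (Fin d)} {δ : ℝ} {E C : EuclideanSpace ℝ (Fin d) → Fin d → Fin d → 𝕜}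
  (hinv : ∀ i, ∀ t : ℝ, 0 ≤ t → ∀ f ∈ sobolevSpace T 1, T i t f ∈ sobolevSpace T 1)
  (hL : ListCommutesVia T L δ E C) (hδ : 0 < δ)
  {κ : EuclideanSpace ℝ (Fin d) → 𝕜} {b : ℝ} (hκ : IsKernel b κ)
  (hκ1 : ∫ u, κ u = 1)

include hT hinv hL hδ hκ hκ1 in
/-- If the generators are continuous along the orbit of `y`, then the commutator of the generators
with `T m` is differentiable at `0`. -/
theorem tendsto_commutator_of_continuous {k m : Fin d} (hκ' : IsKernel b (partialDeriv k κ))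
    (hk : L.count k = 1) {c : Fin d → 𝕜}
    (hc : ∀ l f, Tendsto (fun s : ℝ => s⁻¹ • kernelAverage T L s
      (fun u => (E (s • u) m l - E 0 m l) * partialDeriv k κ u) f) (𝓝[>] 0) (𝓝 (c l • f)))
    {y : H} (hy : y ∈ sobolevSpace T 1)
    (hcont : ∀ l, ContinuousWithinAt (fun ρ => generator (T l) (T m ρ y)) (Set.Ici 0) 0) :
    Tendsto (fun t : ℝ => t⁻¹ • (generator (T k) (T m t y) - T m t (generator (T k) y))) (𝓝[>] 0)
      (𝓝 (∑ l, c l • generator (T l) y)) := by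
  -- The sign arises because s⁻¹ A_{∂_kκ} approximates −D_k.
  set W : H := -∑ l, c l • generator (T l) y with hW
  obtain ⟨B, hB0, hB⟩ := hL.exists_isKernel_mul
  set v := kernelVolume d with hv
  have hv0 : 0 ≤ v := kernelVolume_nonneg
  have hb := hκ.nonneg
  have hcom : Tendsto (fun s : ℝ => -(s⁻¹ • ∑ l, kernelAverage T L s
      (fun u => (E (s • u) m l - E 0 m l) * partialDeriv k κ u) (generator (T l) y)))
      (𝓝[>] 0) (𝓝 W) := by
    simp only [Finset.smul_sum]
    exact (tendsto_finsetSum _ fun l _ => hc l _).neg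
  have key : ∀ ε > 0, ∃ τ > 0, ∀ σ, 0 ≤ σ → σ ≤ τ →
      ‖generator (T k) (T m σ y) - T m σ (generator (T k) y) + σ • W‖ ≤ ε * σ := by
    -- The Duhamel integrand differs from W by three terms of size ε/3: moving from T_m(ρ)y to y,
    -- the limit s → 0 at y, and the action of T_m(σ − ρ) on W. The time τ does not depend on s, so
    -- s → 0 may be taken at fixed σ.
    intro ε hε
    set e := ε / 3 / (d * (v * (B * b)) + 1) with he
    have hq : 0 < d * (v * (B * b)) + 1 := by positivity
    have he0 : 0 < e := by positivity
    have hev : ∀ᶠ ρ in 𝓝[≥] (0 : ℝ), ∀ l, ‖generator (T l) (T m ρ y) - generator (T l) y‖ ≤ e := by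
      rw [eventually_all]
      intro l
      have h1 := (hcont l).tendsto
      rw [(hT m).zero_apply] at h1
      have h2 := (tendsto_iff_norm_sub_tendsto_zero.1 h1)
      exact h2.eventually_le_const he0
    obtain ⟨τ₁, hτ₁, h₁⟩ := mem_nhdsGE_iff_exists_Ico_subset.1 hev
    obtain ⟨τ₂, hτ₂, h₂⟩ := (hT m).eventually_norm_orbit_sub_le W (ε := ε / 3) (by positivity)
    have hτ₁ : (0 : ℝ) < τ₁ := hτ₁
    refine ⟨min τ₁ τ₂, lt_min hτ₁ hτ₂, fun σ hσ hσ' => ?_⟩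
    have hlim : Tendsto (fun s : ℝ => ‖s⁻¹ • kernelAverage T L s (partialDeriv k κ) (T m σ y) -
        T m σ (s⁻¹ • kernelAverage T L s (partialDeriv k κ) y) - σ • W‖) (𝓝[>] 0)
        (𝓝 ‖-generator (T k) (T m σ y) - T m σ (-generator (T k) y) - σ • W‖) :=
      (((tendsto_smul_kernelAverage_partialDeriv hT hinv hL hδ hκ hκ1 (hinv m σ hσ y hy) hk).sub
        (((T m σ).continuous.tendsto _).comp
          (tendsto_smul_kernelAverage_partialDeriv hT hinv hL hδ hκ hκ1 hy hk))).sub_const _).norm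
    have hnorm : ‖-generator (T k) (T m σ y) - T m σ (-generator (T k) y) - σ • W‖ =
        ‖generator (T k) (T m σ y) - T m σ (generator (T k) y) + σ • W‖ := by
      rw [← norm_neg, map_neg]
      congr 1
      abel
    rw [hnorm] at hlim
    refine le_of_tendsto hlim ?_
    have hclose : ∀ᶠ s in 𝓝[>] (0 : ℝ), ‖-(s⁻¹ • ∑ l, kernelAverage T L s
      (fun u => (E (s • u) m l - E 0 m l) * partialDeriv k κ u) (generator (T l) y)) - W‖ ≤ ε / 3 :=
      (tendsto_iff_norm_sub_tendsto_zero.1 hcom).eventually_le_const (by positivity)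
    filter_upwards [eventually_scale hδ d, hclose] with s ⟨hs, hsδ, hsR, _⟩ hcl
    have hker := fun l => (hB s hs hsR b _ hκ' m l).1
    refine norm_kernelAverage_orbit_sub_le hT hinv hL hs hsδ hκ' hy m hker hσ fun ρ hρ => ?_
    have hσρ : 0 ≤ σ - ρ := sub_nonneg.2 hρ.2.le
    set G := fun g : H => -(s⁻¹ • ∑ l, kernelAverage T L s
      (fun u => (E (s • u) m l - E 0 m l) * partialDeriv k κ u) (generator (T l) g)) with hG
    have h3 : ‖G (T m ρ y) - G y‖ ≤ ε / 3 := by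
      have h4 : G (T m ρ y) - G y = -(s⁻¹ • ∑ l, kernelAverage T L s
          (fun u => (E (s • u) m l - E 0 m l) * partialDeriv k κ u)
          (generator (T l) (T m ρ y) - generator (T l) y)) := by
        rw [Finset.sum_congr rfl fun l _ => kernelAverage_sub hT hs L (hker l).contDiff.continuous
          (hker l).eq_zero _ _, Finset.sum_sub_distrib, smul_sub, neg_sub]
        exact neg_sub_neg _ _
      rw [h4, norm_neg, norm_smul, norm_inv, Real.norm_of_nonneg hs.le, inv_mul_le_iff₀ hs]
      refine (norm_sum_le_of_le _ (n := fun _ => v * (B * s * b) * e) fun l _ =>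
        ((hker l).norm_kernelAverage_le hT hs L _).trans ?_).trans ?_
      · have hvB := (hker l).nonneg
        gcongr
        exact h₁ ⟨hρ.1, hρ.2.trans_le (hσ'.trans (min_le_left _ _))⟩ l
      · simp only [Finset.sum_const, Finset.card_univ, Fintype.card_fin, nsmul_eq_mul]
        have h5 : (d * (v * (B * b)) + 1) * e = ε / 3 := by rw [he]; field_simp
        calc d * (v * (B * s * b) * e) = s * (d * (v * (B * b)) * e) := by ring
          _ ≤ s * ((d * (v * (B * b)) + 1) * e) := by gcongr; linarith
          _ = _ := by rw [h5]
    have h6 := h₂ (σ - ρ) hσρ (by linarith [hρ.1, hσ'.trans (min_le_right τ₁ τ₂)])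
    have h7 : T m (σ - ρ) (G (T m ρ y)) - W =
        T m (σ - ρ) (G (T m ρ y) - G y) + T m (σ - ρ) (G y - W) + (T m (σ - ρ) W - W) := by
      simp only [map_sub]; abel
    show ‖T m (σ - ρ) (G (T m ρ y)) - W‖ ≤ ε
    rw [h7]
    refine (norm_add₃_le).trans ?_
    have h8 := (hT m).norm_apply_le hσρ (G (T m ρ y) - G y)
    have h9 := (hT m).norm_apply_le hσρ (G y - W)
    linarith [show ‖G y - W‖ ≤ ε / 3 from hcl]
  rw [Metric.tendsto_nhds]
  intro ε hε
  obtain ⟨τ, hτ, h⟩ := key (ε / 2) (half_pos hε)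
  filter_upwards [Ioo_mem_nhdsGT hτ] with t ht
  have h1 := h t ht.1.le ht.2.le
  rw [dist_eq_norm]
  have h2 : t⁻¹ • (generator (T k) (T m t y) - T m t (generator (T k) y)) -
      ∑ l, c l • generator (T l) y =
      t⁻¹ • (generator (T k) (T m t y) - T m t (generator (T k) y) + t • W) := by
    rw [smul_add _ _ (t • W), inv_smul_smul₀ ht.1.ne', hW, ← sub_eq_add_neg]
  rw [h2, norm_smul, norm_inv, Real.norm_of_nonneg ht.1.le, inv_mul_lt_iff₀ ht.1]
  nlinarith [ht.1]

end CommutatorDerivative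

/-! ### Linear systems with constant coefficients. -/

section MatrixExponential

variable {𝕜 : Type*} [RCLike 𝕜] {d : ℕ}

/-- The fundamental solution of a linear system with constant coefficients. -/
theorem exists_fundamental_solution (Γ : Fin d → Fin d → 𝕜) : ∃ E : ℝ → Fin d → Fin d → 𝕜,
    (∀ i l, E 0 i l = if i = l then 1 else 0) ∧ (∀ i l, ContDiff ℝ 1 fun t => E t i l) ∧
    ∀ i l t, HasDerivAt (fun t => E t i l) (∑ p, Γ i p * E t p l) t := by
  let A : (Fin d → 𝕜) →L[ℝ] (Fin d → 𝕜) := ContinuousLinearMap.pi fun i =>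
    ∑ p, Γ i p • ContinuousLinearMap.proj (R := ℝ) p
  have hA : ∀ x i, A x i = ∑ p, Γ i p * x p := fun x i => by
    simp [A]
  have hder : ∀ i l t, HasDerivAt (fun t : ℝ => NormedSpace.exp (t • A) (Pi.single l 1) i)
      (∑ p, Γ i p * NormedSpace.exp (t • A) (Pi.single l 1) p) t := by
    intro i l t
    have h1 := hasDerivAt_exp_smul_const' (𝕂 := ℝ) A t
    have h2 := h1.clm_apply (hasDerivAt_const t (Pi.single l (1 : 𝕜)))
    have h3 := (hasDerivAt_pi.1 h2) i
    simpa [hA] using h3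
  refine ⟨fun t i l => NormedSpace.exp (t • A) (Pi.single l 1) i, fun i l => ?_, fun i l => ?_, hder⟩
  · show NormedSpace.exp ((0 : ℝ) • A) (Pi.single l 1) i = _
    have h0 : (0 : ℝ) • A = 0 := zero_smul ℝ A
    rw [h0, NormedSpace.exp_zero]
    simp [Pi.single_apply]
  · refine contDiff_one_iff_deriv.2 ⟨fun t => (hder i l t).differentiableAt, ?_⟩
    have : deriv (fun t : ℝ => NormedSpace.exp (t • A) (Pi.single l (1 : 𝕜)) i) =
        fun t => ∑ p, Γ i p * NormedSpace.exp (t • A) (Pi.single l 1) p :=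
      funext fun t => (hder i l t).deriv
    rw [this]
    refine continuous_finsetSum _ fun p _ => continuous_const.mul ?_
    exact continuous_iff_continuousAt.2 fun t => (hder p l t).continuousAt

end MatrixExponential

/-! ### From regular orbits to the commutation rule. -/

section CommutationOfOrbit

open MeasureTheory

variable {𝕜 H : Type*} [RCLike 𝕜] [NormedAddCommGroup H] [InnerProductSpace 𝕜 H] {d : ℕ}
  {T : Fin d → ℝ → H →L[𝕜] H} (hT : ∀ i, IsContractionSemigroup (T i))
  [NormedSpace ℝ H] [IsScalarTower ℝ 𝕜 H]
  (hinv : ∀ i, ∀ t : ℝ, 0 ≤ t → ∀ f ∈ sobolevSpace T 1, T i t f ∈ sobolevSpace T 1)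

/-- Along orbits of `T m`, the generators are bounded on `[0, σ₀]`, continuous at `0`, and their
commutators with `T m` are differentiable at `0` with matrix `Γ`. -/
structure HasRegularOrbits (T : Fin d → ℝ → H →L[𝕜] H) (m : Fin d) (K σ₀ : ℝ)
    (Γ : Fin d → Fin d → 𝕜) : Prop where
  norm_le : ∀ y ∈ sobolevSpace T 1, ∀ i σ, 0 ≤ σ → σ ≤ σ₀ →
    ‖generator (T i) (T m σ y)‖ ≤ K * graphNorm T y
  continuousWithinAt : ∀ y ∈ sobolevSpace T 1, ∀ i,
    ContinuousWithinAt (fun ρ => generator (T i) (T m ρ y)) (Set.Ici 0) 0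
  tendsto : ∀ y ∈ sobolevSpace T 1, ∀ i,
    Tendsto (fun t : ℝ => t⁻¹ • (generator (T i) (T m t y) - T m t (generator (T i) y))) (𝓝[>] 0)
      (𝓝 (∑ l, Γ i l • generator (T l) y))

variable {m : Fin d} {K σ₀ : ℝ} {Γ : Fin d → Fin d → 𝕜}
  (hreg : HasRegularOrbits T m K σ₀ Γ)
include hT hinv hreg

omit [IsScalarTower ℝ 𝕜 H] in
-- D_i T_m(a + τ)y − D_i T_m(a)y = D_i T_m(a)(T_m(τ)y − y). The uniform bound reduces continuity on
-- the interval to continuity at 0 in the graph norm.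
theorem HasRegularOrbits.continuousOn {y : H} (hy : y ∈ sobolevSpace T 1) (i : Fin d) :
    ContinuousOn (fun ρ => generator (T i) (T m ρ y)) (Set.Icc 0 σ₀) := by
  intro ρ hρ
  have hmem : ∀ τ, 0 ≤ τ → T m τ y ∈ sobolevSpace T 1 := fun τ hτ => hinv m τ hτ y hy
  have h0 : Tendsto (fun τ => graphNorm T (T m τ y - y)) (𝓝[≥] 0) (𝓝 0) := by
    have h1 : Tendsto (fun τ => ‖T m τ y - y‖ +
        ∑ j, ‖generator (T j) (T m τ y) - generator (T j) y‖) (𝓝[≥] 0) (𝓝 (0 + ∑ j : Fin d, 0)) := by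
      refine Tendsto.add ?_ (tendsto_finsetSum _ fun j _ => ?_)
      · have := ((hT m).continuousOn y 0 Set.self_mem_Ici).tendsto
        rw [(hT m).zero_apply] at this
        exact tendsto_iff_norm_sub_tendsto_zero.1 this
      · have := (hreg.continuousWithinAt y hy j).tendsto
        rw [(hT m).zero_apply] at this
        exact tendsto_iff_norm_sub_tendsto_zero.1 this
    simp only [Finset.sum_const_zero, add_zero] at h1
    refine h1.congr' ?_
    filter_upwards [self_mem_nhdsWithin] with τ hτ
    rw [graphNorm]
    congr 1
    refine Finset.sum_congr rfl fun j _ => ?_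
    rw [((hasGenerator_of_mem_succ (hmem τ hτ) j).sub (hasGenerator_of_mem_succ hy j)).generator_eq]
  have habs : Tendsto (fun t : ℝ => |t - ρ|) (𝓝[Set.Icc 0 σ₀] ρ) (𝓝[≥] 0) := by
    refine tendsto_nhdsWithin_iff.2 ⟨?_, Eventually.of_forall fun t => Set.mem_Ici.2 (abs_nonneg _)⟩
    have : Continuous fun t : ℝ => |t - ρ| := by fun_prop
    simpa using (this.tendsto ρ).mono_left nhdsWithin_le_nhds
  have h2 := (h0.comp habs).const_mul K
  rw [mul_zero] at h2
  have key : ∀ a τ, 0 ≤ a → 0 ≤ τ → a ≤ σ₀ →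
      ‖generator (T i) (T m (a + τ) y) - generator (T i) (T m a y)‖ ≤
        K * graphNorm T (T m τ y - y) := by
    intro a τ ha hτ haσ
    have h3 := hreg.norm_le (T m τ y - y) (sub_mem_sobolevSpace (hmem τ hτ) hy) i a ha haσ
    rw [map_sub, ← (hT m).add_apply ha hτ, ((hasGenerator_of_mem_succ (hmem _ (add_nonneg ha hτ)) i).sub
      (hasGenerator_of_mem_succ (hmem a ha) i)).generator_eq] at h3
    exact h3
  refine tendsto_iff_norm_sub_tendsto_zero.2 (squeeze_zero_norm' ?_ h2)
  filter_upwards [self_mem_nhdsWithin] with t ht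
  rw [norm_norm]
  rcases le_total ρ t with h | h
  · have := key ρ (t - ρ) hρ.1 (sub_nonneg.2 h) hρ.2
    rw [add_sub_cancel] at this
    simpa [abs_of_nonneg (sub_nonneg.2 h)] using this
  · have := key t (ρ - t) ht.1 (sub_nonneg.2 h) ht.2
    rw [add_sub_cancel, norm_sub_rev] at this
    rw [Function.comp_apply, abs_sub_comm, abs_of_nonneg (sub_nonneg.2 h)]
    exact this

omit [IsScalarTower ℝ 𝕜 H] in
-- The slope is T_m(σ − x) applied to the commutator quotient at the vector T_m(ρ)y, which again
-- lies in H^1.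
theorem HasRegularOrbits.hasDerivWithinAt {y : H} (hy : y ∈ sobolevSpace T 1) (i : Fin d)
    {σ ρ : ℝ} (hρ : 0 ≤ ρ) (hρσ : ρ < σ) :
    HasDerivWithinAt (fun ρ => T m (σ - ρ) (generator (T i) (T m ρ y)))
      (∑ l, Γ i l • T m (σ - ρ) (generator (T l) (T m ρ y))) (Set.Ici ρ) ρ := by
  rw [hasDerivWithinAt_iff_tendsto_slope, Set.Ici_sdiff_left]
  have hsub : Tendsto (fun x => x - ρ) (𝓝[>] ρ) (𝓝[>] 0) := by
    refine tendsto_nhdsWithin_iff.2 ⟨?_, ?_⟩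
    · have : Continuous fun x : ℝ => x - ρ := by fun_prop
      simpa using (this.tendsto ρ).mono_left nhdsWithin_le_nhds
    · filter_upwards [self_mem_nhdsWithin] with x hx
      exact sub_pos.2 (Set.mem_Ioi.1 hx)
  have h1 : Tendsto (fun x => σ - x) (𝓝[>] ρ) (𝓝 (σ - ρ)) :=
    ((continuous_const.sub continuous_id).tendsto ρ).mono_left nhdsWithin_le_nhds
  have h2 : ∀ᶠ x in 𝓝[>] ρ, 0 ≤ σ - x := by
    filter_upwards [Ioo_mem_nhdsGT hρσ] with x hx using sub_nonneg.2 hx.2.le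
  have h3 := (hT m).tendsto_apply (sub_nonneg.2 hρσ.le) h1 h2
    ((hreg.tendsto _ (hinv m ρ hρ y hy) i).comp hsub)
  simp only [map_sum, map_smul] at h3
  refine h3.congr' ?_
  filter_upwards [Ioo_mem_nhdsGT hρσ] with x hx
  simp only [Function.comp_apply, slope_def_module]
  have hxρ : 0 ≤ x - ρ := sub_nonneg.2 hx.1.le
  have h4 : σ - ρ = (σ - x) + (x - ρ) := by ring
  rw [h4, (hT m).add_apply (sub_nonneg.2 hx.2.le) hxρ, ← (hT m).add_apply hxρ hρ, sub_add_cancel,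
    ContinuousLinearMap.map_smul_of_tower, map_sub]

omit [IsScalarTower ℝ 𝕜 H] in
-- Both T_m(σ − ρ) D_i T_m(ρ)y and ∑_p E_ip(ρ) T_m(σ) D_p y solve X' = ΓX with value T_m(σ) D_i y at
-- ρ = 0. Equality at ρ = σ is the commutation rule.
theorem HasRegularOrbits.exists_commutesVia : ∃ E, CommutesVia T m σ₀ E := by
  obtain ⟨E, hE0, hE1, hE⟩ := exists_fundamental_solution Γ
  refine ⟨E, hE1, hE0, fun σ hσ hσ₀ y hy i => ?_⟩
  let V : (Fin d → H) →L[𝕜] (Fin d → H) := ContinuousLinearMap.pi fun i =>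
    ∑ p, Γ i p • ContinuousLinearMap.proj p
  have hV : ∀ x, V x = fun i => ∑ p, Γ i p • x p := fun x => by
    ext i; simp [V]
  have huniq := ODE_solution_unique (v := fun _ => V) (K := ‖V‖₊) (a := 0) (b := σ)
    (f := fun ρ i => T m (σ - ρ) (generator (T i) (T m ρ y)))
    (g := fun ρ i => ∑ p, E ρ i p • T m σ (generator (T p) y))
    (fun _ => V.lipschitz) ?_ ?_ ?_ ?_ ?_ (Set.right_mem_Icc.2 hσ)
  · have := congrFun huniq i
    simpa [(hT m).zero_apply] using this
  · refine continuousOn_pi.2 fun i => (hT m).continuousOn_apply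
      (continuous_const.sub continuous_id).continuousOn (fun x hx => sub_nonneg.2 hx.2) ?_
    exact (hreg.continuousOn hT hinv hy i).mono (Set.Icc_subset_Icc_right hσ₀)
  · intro ρ hρ
    rw [hV]
    exact hasDerivWithinAt_pi.2 fun i => hreg.hasDerivWithinAt hT hinv hy i hρ.1 hρ.2
  · exact continuousOn_pi.2 fun i => continuousOn_finsetSum _ fun p _ =>
      ((hE1 i p).continuous.smul continuous_const).continuousOn
  · intro ρ hρ
    rw [hV]
    refine hasDerivWithinAt_pi.2 fun i => ?_
    have h1 : HasDerivAt (fun ρ => ∑ p, E ρ i p • T m σ (generator (T p) y))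
        (∑ p, (∑ q, Γ i q * E ρ q p) • T m σ (generator (T p) y)) ρ :=
      HasDerivAt.fun_sum fun p _ => (hE i p ρ).smul_const _
    refine h1.hasDerivWithinAt.congr_deriv ?_
    simp only [Finset.sum_smul, Finset.smul_sum, mul_smul]
    exact Finset.sum_comm
  · funext i
    simp [(hT m).zero_apply, hE0]

end CommutationOfOrbit

/-! ### Induction over the semigroups. -/

section CommutationInduction

open MeasureTheory

variable {𝕜 H : Type*} [RCLike 𝕜] [NormedAddCommGroup H] [InnerProductSpace 𝕜 H] {d : ℕ}
  {T : Fin d → ℝ → H →L[𝕜] H} (hT : ∀ i, IsContractionSemigroup (T i))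
  [NormedSpace ℝ H] [IsScalarTower ℝ 𝕜 H] [CompleteSpace H]
  (hinv : ∀ i, ∀ t : ℝ, 0 ≤ t → ∀ f ∈ sobolevSpace T 1, T i t f ∈ sobolevSpace T 1)
  {ζ : Fin d → Fin d → EuclideanSpace ℝ (Fin d) → 𝕜}
  (hζ1 : ∀ i k, ContDiffOn ℝ 1 (ζ i k) (Metric.ball 0 1))
  (hζ : ∀ i, ∀ f ∈ sobolevSpace T 1, ∀ t ∈ Metric.ball (0 : EuclideanSpace ℝ (Fin d)) 1,
      (∀ k, 0 ≤ t k) → ∃ v : Fin d → H, (∀ k, HasOrbitPartialDeriv T f k t (v k)) ∧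
        generator (T i) (orbitMap T f t) = ∑ k, ζ i k t • v k)

include hT hinv hζ1 hζ in
-- For k < m regularity comes from the averages over the semigroups already treated; for k ≥ m the
-- structure identity involves only T_m(ρ) D_k y, which is continuous. The identity then transfers
-- regularity to all D_i.
theorem exists_hasRegularOrbits {δ : ℝ} (hδ : 0 < δ) (m : Fin d)
    (hlt : ∀ k < m, ∃ E, CommutesVia T k δ E) :
    ∃ K σ₀ Γ, 0 < σ₀ ∧ HasRegularOrbits T m K σ₀ Γ := by
  set L := (List.finRange d).filter (· < m) with hLdef
  set P : Finset (Fin d) := Finset.univ.filter (· < m) with hPdef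
  obtain ⟨E, C, hL⟩ := exists_listCommutesVia hT hinv (δ := δ) L fun k hk => hlt k (by
    simpa [hLdef] using hk)
  have hP : ∀ k ∈ P, L.count k = 1 := fun k hk =>
    List.count_eq_one_of_mem ((List.nodup_finRange d).filter _) (by
      simpa [hLdef, hPdef] using hk)
  obtain ⟨κ, b, hκ, hκ', hκ1⟩ := exists_unit_kernel 𝕜 d
  set e : ℝ → EuclideanSpace ℝ (Fin d) := fun ρ => EuclideanSpace.single m ρ with he
  have hnorm : ∀ ρ, ‖e ρ‖ = |ρ| := fun ρ => by simp [he]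
  have he0 : e 0 = 0 := by simp [he]
  -- bound for the coefficients
  obtain ⟨Z, hZ, hζZ⟩ : ∃ Z, 0 ≤ Z ∧ ∀ ρ, 0 ≤ ρ → ρ ≤ 1 / 2 → ∀ i k, ‖ζ i k (e ρ)‖ ≤ Z := by
    have h1 : ∀ i k, ∃ M, ∀ t ∈ Metric.closedBall (0 : EuclideanSpace ℝ (Fin d)) (1 / 2),
        ‖ζ i k t‖ ≤ M := fun i k =>
      (isCompact_closedBall _ _).exists_bound_of_continuousOn
        ((hζ1 i k).continuousOn.mono (Metric.closedBall_subset_ball (by norm_num)))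
    choose M hM using h1
    refine ⟨∑ i, ∑ k, |M i k|, by positivity, fun ρ h0 h2 i k => ?_⟩
    refine (hM i k (e ρ) (by simpa [hnorm, abs_of_nonneg h0] using h2)).trans
      ((le_abs_self _).trans ?_)
    exact (Finset.single_le_sum (f := fun k => |M i k|) (fun _ _ => abs_nonneg _)
      (Finset.mem_univ k)).trans (Finset.single_le_sum (f := fun i => ∑ k, |M i k|)
      (fun _ _ => Finset.sum_nonneg fun _ _ => abs_nonneg _) (Finset.mem_univ i))
  have hR : ∀ ρ, 0 ≤ ρ → ρ < 1 → ∀ y ∈ sobolevSpace T 1, ∀ i,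
      generator (T i) (T m ρ y) = ∑ k, ζ i k (e ρ) •
        (if k < m then generator (T k) (T m ρ y) else T m ρ (generator (T k) y)) :=
    fun ρ h0 h1 y hy i => generator_orbit_eq_sum hT hinv hζ m h0 h1 hy i
  have hctl : ∀ ρ, 0 ≤ ρ → ρ ≤ 1 / 2 → ∀ h ∈ sobolevSpace T 1,
      ControlledBy T P Z (Z * graphNorm T h) (T m ρ h) := by
    intro ρ h0 h2 h hh
    refine ⟨fun i k => ζ i k (e ρ), fun i => ∑ k, if k < m then 0 else
      ζ i k (e ρ) • T m ρ (generator (T k) h), hζZ ρ h0 h2, fun i => ?_, fun i => ?_⟩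
    · calc _ ≤ ∑ k, Z * ‖generator (T k) h‖ := norm_sum_le_of_le _ fun k _ => by
            split_ifs
            · rw [norm_zero]; positivity
            · rw [norm_smul]
              exact mul_le_mul (hζZ ρ h0 h2 i k) ((hT m).norm_apply_le h0 _) (norm_nonneg _) hZ
        _ ≤ Z * graphNorm T h := by
            rw [← Finset.mul_sum]
            gcongr
            exact le_add_of_nonneg_left (norm_nonneg h)
    · rw [hR ρ h0 (by linarith) h hh i, hPdef, Finset.sum_filter, ← Finset.sum_add_distrib]
      refine Finset.sum_congr rfl fun k _ => ?_
      split_ifs <;> simp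
  obtain ⟨K, σ₀, hK, hσ₀, hσ₀1, hev⟩ := exists_approxDefect_orbit_le hT hinv hL hδ hκ hκ1 hκ' hP hZ
    (half_pos one_pos) hctl
  have hlim : ∀ k ∈ P, ∀ y ∈ sobolevSpace T 1, Tendsto (fun s : ℝ => s⁻¹ • kernelAverage T L s
      (partialDeriv k κ) y) (𝓝[>] 0) (𝓝 (-generator (T k) y)) := fun k hk y hy =>
    tendsto_smul_kernelAverage_partialDeriv hT hinv hL hδ hκ hκ1 hy (hP k hk)
  have hmem : ∀ σ, 0 ≤ σ → ∀ y ∈ sobolevSpace T 1, T m σ y ∈ sobolevSpace T 1 :=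
    fun σ hσ y hy => hinv m σ hσ y hy
  have hboundP : ∀ k, k < m → ∀ y ∈ sobolevSpace T 1, ∀ σ, 0 ≤ σ → σ ≤ σ₀ →
      ‖generator (T k) (T m σ y)‖ ≤ K * graphNorm T y ∧
      ‖generator (T k) (T m σ y) - T m σ (generator (T k) y)‖ ≤ K * graphNorm T y * σ := by
    intro k hk y hy σ hσ hσ'
    have hkP : k ∈ P := by simpa [hPdef] using hk
    have h1 := hlim k hkP _ (hmem σ hσ y hy)
    have h2 := h1.sub (((T m σ).continuous.tendsto _).comp (hlim k hkP y hy))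
    constructor
    · rw [← norm_neg]
      refine le_of_tendsto h1.norm ?_
      filter_upwards [hev] with s hs using (hs y hy σ hσ hσ' k hkP).1
    · rw [← norm_neg, neg_sub', ← map_neg]
      refine le_of_tendsto h2.norm ?_
      filter_upwards [hev] with s hs using (hs y hy σ hσ hσ' k hkP).2
  have horbit : ∀ v : H, Tendsto (fun ρ => T m ρ v) (𝓝[≥] 0) (𝓝 v) := fun v => by
    have := ((hT m).continuousOn v 0 Set.self_mem_Ici).tendsto
    rwa [(hT m).zero_apply] at this
  have hIco : ∀ {c : ℝ}, 0 < c → ∀ᶠ ρ in 𝓝[≥] (0 : ℝ), 0 ≤ ρ ∧ ρ < c := fun hc => by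
    filter_upwards [Ico_mem_nhdsGE hc] with ρ hρ using hρ
  have hcontP : ∀ k, k < m → ∀ y ∈ sobolevSpace T 1,
      Tendsto (fun ρ => generator (T k) (T m ρ y)) (𝓝[≥] 0) (𝓝 (generator (T k) y)) := by
    intro k hk y hy
    have h1 : Tendsto (fun σ => generator (T k) (T m σ y) - T m σ (generator (T k) y)) (𝓝[≥] 0)
        (𝓝 0) := by
      refine squeeze_zero_norm' (a := fun σ => K * graphNorm T y * σ) ?_ ?_
      · filter_upwards [hIco hσ₀] with σ hσ using (hboundP k hk y hy σ hσ.1 hσ.2.le).2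
      · have : Continuous fun σ : ℝ => K * graphNorm T y * σ := by fun_prop
        simpa using (this.tendsto 0).mono_left nhdsWithin_le_nhds
    simpa using h1.add (horbit (generator (T k) y))
  set X : Fin d → H → ℝ → H := fun k y ρ =>
    if k < m then generator (T k) (T m ρ y) else T m ρ (generator (T k) y) with hX
  have hXlim : ∀ k, ∀ y ∈ sobolevSpace T 1,
      Tendsto (X k y) (𝓝[≥] 0) (𝓝 (generator (T k) y)) := by
    intro k y hy
    by_cases hk : k < m
    · simpa [hX, hk] using hcontP k hk y hy
    · simpa [hX, hk] using horbit (generator (T k) y)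
  have hζd : ∀ i k, DifferentiableAt ℝ (ζ i k) 0 := fun i k =>
    ((hζ1 i k 0 (Metric.mem_ball_self one_pos)).contDiffAt
      (Metric.isOpen_ball.mem_nhds (Metric.mem_ball_self one_pos))).differentiableAt one_ne_zero
  have hζlim : ∀ i k, Tendsto (fun ρ => ζ i k (e ρ)) (𝓝 0) (𝓝 (ζ i k 0)) := fun i k => by
    have h1 : Tendsto e (𝓝 0) (𝓝 0) := by
      rw [tendsto_zero_iff_norm_tendsto_zero]
      simp only [hnorm]
      simpa using (continuous_abs (G := ℝ)).tendsto 0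
    exact (hζd i k).continuousAt.tendsto.comp h1
  -- The matrix ζ(0) need not be the identity when the generators are linearly dependent, but it
  -- fixes the vector of generators.
  have hzero : ∀ y ∈ sobolevSpace T 1, ∀ i,
      generator (T i) y = ∑ k, ζ i k 0 • generator (T k) y := fun y hy i => by
    have := hR 0 le_rfl one_pos y hy i
    simpa only [(hT m).zero_apply, ite_self, he0] using this
  have hcont : ∀ y ∈ sobolevSpace T 1, ∀ i,
      ContinuousWithinAt (fun ρ => generator (T i) (T m ρ y)) (Set.Ici 0) 0 := by
    intro y hy i
    have h1 : Tendsto (fun ρ => ∑ k, ζ i k (e ρ) • X k y ρ) (𝓝[≥] 0)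
        (𝓝 (∑ k, ζ i k 0 • generator (T k) y)) :=
      tendsto_finsetSum _ fun k _ => ((hζlim i k).mono_left nhdsWithin_le_nhds).smul (hXlim k y hy)
    rw [← hzero y hy i] at h1
    rw [ContinuousWithinAt, (hT m).zero_apply]
    refine h1.congr' ?_
    filter_upwards [hIco one_pos] with ρ hρ
    exact (hR ρ hρ.1 hρ.2 y hy i).symm
  choose c hc using fun k l => exists_tendsto_kernelAverage_increment (ψ := fun t => E t m l) hT L
    (hκ' k) (hL.contDiff m l).contDiffOn
  have hcomP : ∀ k, k < m → ∀ y ∈ sobolevSpace T 1,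
      Tendsto (fun t : ℝ => t⁻¹ • (generator (T k) (T m t y) - T m t (generator (T k) y))) (𝓝[>] 0)
        (𝓝 (∑ l, c k l • generator (T l) y)) := fun k hk y hy =>
    tendsto_commutator_of_continuous hT hinv hL hδ hκ hκ1 (hκ' k)
      (hP k (by simpa [hPdef] using hk)) (hc k) hy (hcont y hy)
  -- Γ comes from the product rule for the structure identity at time 0: one part differentiates ζ
  -- along e_m, the other uses the commutators of D_k with k < m; for k ≥ m no commutator occurs. In
  -- K + 1, the 1 covers the terms T_m(σ) D_k y.
  refine ⟨d * (Z * (K + 1)), σ₀, fun i l => fderiv ℝ (ζ i l) 0 (EuclideanSpace.single m 1) +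
    ∑ k, ζ i k 0 * (if k < m then c k l else 0), hσ₀, ?_, hcont, ?_⟩
  · intro y hy i σ hσ hσ'
    have hG := graphNorm_nonneg (T := T) y
    rw [hR σ hσ (by linarith) y hy i]
    refine (norm_sum_le_of_le _ (n := fun _ => Z * ((K + 1) * graphNorm T y)) fun k _ => ?_).trans
      (le_of_eq (by simp; ring))
    rw [norm_smul]
    refine mul_le_mul (hζZ σ hσ (hσ'.trans hσ₀1) i k) ?_ (norm_nonneg _) hZ
    split_ifs with hk
    · refine (hboundP k hk y hy σ hσ hσ').1.trans ?_
      gcongr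
      linarith
    · refine ((hT m).norm_apply_le hσ _).trans ((norm_generator_le_graphNorm y k).trans ?_)
      nlinarith
  · intro y hy i
    have hslope : ∀ k, Tendsto (fun t : ℝ => t⁻¹ • (ζ i k (e t) - ζ i k 0)) (𝓝[>] 0)
        (𝓝 (fderiv ℝ (ζ i k) 0 (EuclideanSpace.single m 1))) := fun k => by
      have h1 := ((hζd i k).hasFDerivAt.hasLineDerivAt
        (EuclideanSpace.single m (1 : ℝ))).tendsto_slope_zero_right
      have h2 : ∀ t : ℝ, t • EuclideanSpace.single m (1 : ℝ) = e t := fun t => by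
        ext j
        by_cases hj : j = m <;> simp [he, hj]
      simpa [h2] using h1
    have h1 : Tendsto (fun t : ℝ => ∑ k, ((t⁻¹ • (ζ i k (e t) - ζ i k 0)) • X k y t +
        ζ i k 0 • (if k < m then
          t⁻¹ • (generator (T k) (T m t y) - T m t (generator (T k) y)) else 0))) (𝓝[>] 0)
        (𝓝 (∑ k, (fderiv ℝ (ζ i k) 0 (EuclideanSpace.single m 1) • generator (T k) y +
          ζ i k 0 • (if k < m then ∑ l, c k l • generator (T l) y else 0)))) := by
      refine tendsto_finsetSum _ fun k _ => ((hslope k).smul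
        ((hXlim k y hy).mono_left (nhdsWithin_mono _ Set.Ioi_subset_Ici_self))).add
        (Tendsto.const_smul ?_ _)
      split_ifs with hk
      · exact hcomP k hk y hy
      · exact tendsto_const_nhds
    have h2 : ∑ k, (fderiv ℝ (ζ i k) 0 (EuclideanSpace.single m 1) • generator (T k) y +
          ζ i k 0 • (if k < m then ∑ l, c k l • generator (T l) y else 0)) =
        ∑ l, (fderiv ℝ (ζ i l) 0 (EuclideanSpace.single m 1) +
          ∑ k, ζ i k 0 * (if k < m then c k l else 0)) • generator (T l) y := by
      simp only [add_smul, Finset.sum_add_distrib, Finset.sum_smul]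
      congr 1
      rw [Finset.sum_comm]
      refine Finset.sum_congr rfl fun k _ => ?_
      split_ifs <;> simp [Finset.smul_sum, mul_smul]
    rw [h2] at h1
    refine h1.congr' ?_
    filter_upwards [Ioo_mem_nhdsGT one_pos] with t ht
    rw [hR t ht.1.le ht.2 y hy i]
    conv_rhs => rw [hzero y hy i]
    simp only [map_sum, map_smul]
    rw [← Finset.sum_sub_distrib, Finset.smul_sum]
    refine Finset.sum_congr rfl fun k _ => ?_
    simp only [hX]
    split_ifs with hk
    · rw [smul_assoc, smul_comm (ζ i k 0), ← smul_add]
      congr 1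
      rw [sub_smul, smul_sub]
      abel
    · rw [smul_zero, add_zero, smul_assoc, sub_smul]

include hT hinv hζ1 hζ in
theorem exists_commutesVia : ∃ δ, 0 < δ ∧ ∀ m, ∃ E, CommutesVia T m δ E := by
  have mono : ∀ {m δ δ' E}, δ' ≤ δ → CommutesVia T m δ E → CommutesVia T m δ' E := fun h hE =>
    ⟨hE.contDiff, hE.zero, fun t h0 h1 => hE.generator_eq t h0 (h1.trans h)⟩
  have key : ∀ n : ℕ, ∃ δ, 0 < δ ∧ ∀ m : Fin d, (m : ℕ) < n → ∃ E, CommutesVia T m δ E := by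
    intro n
    induction n with
    | zero => exact ⟨1, one_pos, fun m hm => absurd hm (Nat.not_lt_zero _)⟩
    | succ n ih =>
      obtain ⟨δ, hδ, h⟩ := ih
      by_cases hn : n < d
      · obtain ⟨K, σ₀, Γ, hσ₀, hreg⟩ := exists_hasRegularOrbits hT hinv hζ1 hζ hδ ⟨n, hn⟩
          fun k hk => h k hk
        obtain ⟨E, hE⟩ := hreg.exists_commutesVia hT hinv
        refine ⟨min δ σ₀, lt_min hδ hσ₀, fun m hm => ?_⟩
        rcases Nat.lt_succ_iff_lt_or_eq.1 hm with h1 | h1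
        · obtain ⟨E', hE'⟩ := h m h1
          exact ⟨E', mono (min_le_left _ _) hE'⟩
        · have : m = ⟨n, hn⟩ := Fin.ext h1
          rw [this]
          exact ⟨E, mono (min_le_right _ _) hE⟩
      · exact ⟨δ, hδ, fun m _ => h m (by omega)⟩
  obtain ⟨δ, hδ, h⟩ := key d
  exact ⟨δ, hδ, fun m => h m m.2⟩

end CommutationInduction

/-! ### Recursion and subadditivity of the Sobolev norm. -/

section SobolevNorm

variable {𝕜 H : Type*} [RCLike 𝕜] [NormedAddCommGroup H] [InnerProductSpace 𝕜 H] {d : ℕ}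
  {T : Fin d → ℝ → H →L[𝕜] H}

theorem sobolevNorm_zero (f : H) : sobolevNorm T 0 f = ‖f‖ := by
  simp [sobolevNorm]

theorem mixedDeriv_snoc {k : ℕ} (j : Fin k → Fin d) (i : Fin d) (f : H) :
    mixedDeriv T (Fin.snoc j i : Fin (k + 1) → Fin d) f = mixedDeriv T j (generator (T i) f) := by
  rw [mixedDeriv, List.ofFn_succ', List.concat_eq_append, List.foldr_append]
  simp [mixedDeriv]

theorem sum_norm_mixedDeriv_succ (k : ℕ) (f : H) :
    ∑ j : Fin (k + 1) → Fin d, ‖mixedDeriv T j f‖ =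
      ∑ i, ∑ j : Fin k → Fin d, ‖mixedDeriv T j (generator (T i) f)‖ := by
  rw [← Fintype.sum_prod_type']
  refine (Fintype.sum_equiv (Fin.snocEquiv fun _ : Fin (k + 1) => Fin d) _ _ fun p => ?_).symm
  rw [← mixedDeriv_snoc]
  rfl

theorem sobolevNorm_eq_sum_range (r : ℕ) (f : H) :
    sobolevNorm T r f = ∑ k ∈ Finset.range (r + 1), ∑ j : Fin k → Fin d, ‖mixedDeriv T j f‖ := by
  have h : Finset.Ico (0 + 1) (r + 1) = Finset.Icc 1 r := by ext; simp
  rw [Finset.range_eq_Ico, Finset.sum_eq_sum_Ico_succ_bot (Nat.succ_pos r), h, sobolevNorm]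
  simp [mixedDeriv]

theorem sobolevNorm_succ (r : ℕ) (f : H) :
    sobolevNorm T (r + 1) f = ‖f‖ + ∑ i, sobolevNorm T r (generator (T i) f) := by
  simp only [sobolevNorm_eq_sum_range]
  rw [Finset.sum_range_succ', add_comm, Finset.sum_comm]
  congr 1
  · simp [mixedDeriv]
  · exact Finset.sum_congr rfl fun k _ => sum_norm_mixedDeriv_succ k f

theorem sobolevNorm_nonneg (r : ℕ) (f : H) : 0 ≤ sobolevNorm T r f := by
  unfold sobolevNorm; positivity

theorem norm_le_sobolevNorm (r : ℕ) (f : H) : ‖f‖ ≤ sobolevNorm T r f :=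
  le_add_of_nonneg_right (by positivity)

theorem sobolevNorm_generator_le (r : ℕ) (f : H) (i : Fin d) :
    sobolevNorm T r (generator (T i) f) ≤ sobolevNorm T (r + 1) f := by
  rw [sobolevNorm_succ]
  exact (Finset.single_le_sum (f := fun i => sobolevNorm T r (generator (T i) f))
    (fun _ _ => sobolevNorm_nonneg _ _) (Finset.mem_univ i)).trans
    (le_add_of_nonneg_left (norm_nonneg f))

theorem sobolevNorm_le_succ (r : ℕ) (f : H) : sobolevNorm T r f ≤ sobolevNorm T (r + 1) f := by
  rw [sobolevNorm_eq_sum_range, sobolevNorm_eq_sum_range, Finset.sum_range_succ _ (r + 1)]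
  exact le_add_of_nonneg_right (by positivity)

theorem sobolevNorm_le_succ_of {r : ℕ} {f : H} {a b : ℝ} (ha : ‖f‖ ≤ a)
    (hb : ∀ i, sobolevNorm T r (generator (T i) f) ≤ b) :
    sobolevNorm T (r + 1) f ≤ a + d * b := by
  rw [sobolevNorm_succ]
  exact add_le_add ha ((Finset.sum_le_card_nsmul _ _ b fun i _ => hb i).trans (by simp))

theorem sobolevNorm_add_le {r : ℕ} {f g : H} (hf : f ∈ sobolevSpace T r)
    (hg : g ∈ sobolevSpace T r) :
    sobolevNorm T r (f + g) ≤ sobolevNorm T r f + sobolevNorm T r g := by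
  induction r generalizing f g with
  | zero => simpa only [sobolevNorm_zero] using norm_add_le f g
  | succ r ih =>
    rw [sobolevNorm_succ, sobolevNorm_succ, sobolevNorm_succ, add_add_add_comm,
      ← Finset.sum_add_distrib]
    refine add_le_add (norm_add_le f g) (Finset.sum_le_sum fun i _ => ?_)
    rw [((hasGenerator_of_mem_succ hf i).add (hasGenerator_of_mem_succ hg i)).generator_eq]
    exact ih (hf i).2 (hg i).2

theorem sobolevNorm_smul {r : ℕ} (c : 𝕜) {f : H} (hf : f ∈ sobolevSpace T r) :
    sobolevNorm T r (c • f) = ‖c‖ * sobolevNorm T r f := by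
  induction r generalizing f with
  | zero => simpa only [sobolevNorm_zero] using norm_smul c f
  | succ r ih =>
    rw [sobolevNorm_succ, sobolevNorm_succ, norm_smul, mul_add, Finset.mul_sum]
    congr 1
    refine Finset.sum_congr rfl fun i _ => ?_
    rw [((hasGenerator_of_mem_succ hf i).smul c).generator_eq, ih (hf i).2]

theorem sobolevNorm_sum_le {ι : Type*} {r : ℕ} (s : Finset ι) {f : ι → H}
    (hf : ∀ i ∈ s, f i ∈ sobolevSpace T r) :
    sobolevNorm T r (∑ i ∈ s, f i) ≤ ∑ i ∈ s, sobolevNorm T r (f i) := by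
  classical
  induction s using Finset.induction_on with
  | empty =>
    have := sobolevNorm_smul (0 : 𝕜) (zero_mem_sobolevSpace (T := T) r)
    simp only [smul_zero, norm_zero, zero_mul] at this
    simp [this]
  | insert a s ha ih =>
    rw [Finset.sum_insert ha, Finset.sum_insert ha]
    have h1 : ∀ i ∈ s, f i ∈ sobolevSpace T r := fun i hi => hf i (Finset.mem_insert_of_mem hi)
    exact (sobolevNorm_add_le (hf a (Finset.mem_insert_self _ _)) (sum_mem_sobolevSpace s h1)).trans
      (by gcongr; exact ih h1)

end SobolevNorm

/-! ### Products of differences and the mixed modulus. -/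

section Differences

variable {𝕜 H : Type*} [RCLike 𝕜] [NormedAddCommGroup H] [InnerProductSpace 𝕜 H] {d : ℕ}

/-- The product of the differences `T_j(τ) - I` over a list of pairs `(j, τ)`. -/
noncomputable def differenceOp (T : Fin d → ℝ → H →L[𝕜] H) (w : List (Fin d × ℝ)) : H →L[𝕜] H :=
  (w.map fun p => T p.1 p.2 - 1).prod

/-- All products of `n` differences with step at most `s` have norm at most `b` at `f`. -/
def DifferenceBound (T : Fin d → ℝ → H →L[𝕜] H) (n : ℕ) (s b : ℝ) (f : H) : Prop :=
  ∀ w : List (Fin d × ℝ), w.length = n → (∀ p ∈ w, 0 ≤ p.2 ∧ p.2 ≤ s) → ‖differenceOp T w f‖ ≤ b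

variable {T : Fin d → ℝ → H →L[𝕜] H}

theorem differenceOp_nil (f : H) : differenceOp T [] f = f := rfl

theorem differenceOp_cons (p : Fin d × ℝ) (w : List (Fin d × ℝ)) (f : H) :
    differenceOp T (p :: w) f = T p.1 p.2 (differenceOp T w f) - differenceOp T w f := by
  simp [differenceOp]

theorem differenceOp_ofFn {r : ℕ} (j : Fin r → Fin d) (τ : Fin r → ℝ) :
    (List.ofFn fun i => T (j i) (τ i) - 1).prod =
      differenceOp T (List.ofFn fun i => (j i, τ i)) := by
  rw [differenceOp, List.map_ofFn]
  rfl

variable (hT : ∀ i, IsContractionSemigroup (T i))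
include hT

theorem norm_differenceOp_le (w : List (Fin d × ℝ)) (hw : ∀ p ∈ w, 0 ≤ p.2) (f : H) :
    ‖differenceOp T w f‖ ≤ 2 ^ w.length * ‖f‖ := by
  induction w with
  | nil => simp [differenceOp_nil]
  | cons p w ih =>
    rw [differenceOp_cons, List.length_cons, pow_succ']
    have h1 := ih fun q hq => hw q (List.mem_cons_of_mem _ hq)
    have h2 := (hT p.1).norm_apply_le (hw p List.mem_cons_self) (differenceOp T w f)
    refine (norm_sub_le _ _).trans ?_
    linarith

theorem differenceBound_mixedModulus {r : ℕ} {s : ℝ} (f : H) :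
    DifferenceBound T r s (mixedModulus T r s f) f := by
  intro w hw hws
  subst hw
  have hnonneg : ∀ j : Fin w.length → Fin d, 0 ≤ ⨆ τ : Fin w.length → Set.Icc (0 : ℝ) s,
      ‖(List.ofFn fun i => T (j i) (τ i : ℝ) - 1).prod f‖ := fun j =>
    Real.iSup_nonneg fun τ => norm_nonneg _
  refine le_trans ?_ (Finset.single_le_sum (fun j _ => hnonneg j)
    (Finset.mem_univ fun i => (w.get i).1))
  refine le_trans (le_of_eq ?_) (le_ciSup ?_
    (fun i => ⟨(w.get i).2, hws _ (List.get_mem w i)⟩ : Fin w.length → Set.Icc (0 : ℝ) s))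
  · rw [differenceOp_ofFn (T := T) (fun i => (w.get i).1) fun i => (w.get i).2]
    congr 3
    exact (List.ofFn_get w).symm
  · refine ⟨2 ^ w.length * ‖f‖, ?_⟩
    rintro _ ⟨τ, rfl⟩
    simp only
    rw [differenceOp_ofFn (T := T) (fun i => (w.get i).1) fun i => (τ i : ℝ)]
    refine (norm_differenceOp_le hT _ (fun p hp => ?_) f).trans (by simp)
    obtain ⟨i, rfl⟩ := (List.mem_ofFn' _ _).1 hp
    exact (τ i).2.1

omit hT in
theorem mixedModulus_le {r : ℕ} {s b : ℝ} {f : H} (hs : 0 ≤ s) (h : DifferenceBound T r s b f) :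
    mixedModulus T r s f ≤ d ^ r * b := by
  have : Nonempty (Fin r → Set.Icc (0 : ℝ) s) := ⟨fun _ => ⟨0, le_rfl, hs⟩⟩
  refine (Finset.sum_le_card_nsmul _ _ b fun j _ => ciSup_le fun τ => ?_).trans ?_
  · rw [differenceOp_ofFn (T := T) j fun i => (τ i : ℝ)]
    refine h _ (by simp) fun p hp => ?_
    obtain ⟨i, rfl⟩ := (List.mem_ofFn' _ _).1 hp
    exact (τ i).2
  · simp

end Differences

/-! ### Differences of Sobolev vectors: the lower bound. -/

section LowerBound

variable {𝕜 H : Type*} [RCLike 𝕜] [NormedAddCommGroup H] [InnerProductSpace 𝕜 H] {d : ℕ}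
  {T : Fin d → ℝ → H →L[𝕜] H} (hT : ∀ i, IsContractionSemigroup (T i))
  [NormedSpace ℝ H] [IsScalarTower ℝ 𝕜 H]
  {δ : ℝ} (hδ : 0 < δ) (hcomm : ∀ m, ∃ E, CommutesVia T m δ E)
include hT hδ hcomm

omit [NormedSpace ℝ H] [IsScalarTower ℝ 𝕜 H] hT in
theorem exists_coefficient_bound : ∃ (E : Fin d → ℝ → Fin d → Fin d → 𝕜) (M : ℝ), 0 ≤ M ∧
    (∀ m, CommutesVia T m δ (E m)) ∧ ∀ m t, 0 ≤ t → t ≤ δ → ∀ i l, ‖E m t i l‖ ≤ M ∧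
      ‖E m t i l - if i = l then 1 else 0‖ ≤ M * t := by
  choose E hE using hcomm
  have h1 : ∀ m i l, ∃ M, 0 ≤ M ∧ ∀ t ∈ Set.Icc 0 δ, ‖E m t i l‖ ≤ M ∧
      ‖E m t i l - if i = l then 1 else 0‖ ≤ M * t := by
    intro m i l
    have hc := (hE m).contDiff i l
    obtain ⟨M₁, hM₁⟩ := isCompact_Icc.exists_bound_of_continuousOn (s := Set.Icc 0 δ)
      hc.continuous.continuousOn
    obtain ⟨M₂, hM₂⟩ := isCompact_Icc.exists_bound_of_continuousOn (s := Set.Icc 0 δ)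
      (hc.continuous_deriv le_rfl).continuousOn
    refine ⟨max (max M₁ M₂) 0, le_max_right _ _, fun t ht =>
      ⟨(hM₁ t ht).trans ((le_max_left _ _).trans (le_max_left _ _)), ?_⟩⟩
    have := (convex_Icc 0 δ).norm_image_sub_le_of_norm_deriv_le
      (fun x _ => (hc.differentiable one_ne_zero) x) hM₂ (Set.left_mem_Icc.2 hδ.le) ht
    rw [(hE m).zero, sub_zero, Real.norm_of_nonneg ht.1] at this
    refine this.trans (mul_le_mul_of_nonneg_right ?_ ht.1)
    exact (le_max_right _ _).trans (le_max_left _ _)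
  choose M hM0 hM using h1
  have hle : ∀ m i l, M m i l ≤ ∑ m, ∑ i, ∑ l, M m i l := fun m i l =>
    (Finset.single_le_sum (f := fun l => M m i l) (fun l _ => hM0 m i l) (Finset.mem_univ l)).trans
    ((Finset.single_le_sum (f := fun i => ∑ l, M m i l)
      (fun i _ => Finset.sum_nonneg fun l _ => hM0 m i l) (Finset.mem_univ i)).trans
    (Finset.single_le_sum (f := fun m => ∑ i, ∑ l, M m i l)
      (fun m _ => Finset.sum_nonneg fun i _ => Finset.sum_nonneg fun l _ => hM0 m i l)
      (Finset.mem_univ m)))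
  refine ⟨E, ∑ m, ∑ i, ∑ l, M m i l, Finset.sum_nonneg fun m _ => Finset.sum_nonneg fun i _ =>
    Finset.sum_nonneg fun l _ => hM0 m i l, hE, fun m t h0 h1 i l => ?_⟩
  obtain ⟨h2, h3⟩ := hM m i l t ⟨h0, h1⟩
  exact ⟨h2.trans (hle m i l), h3.trans (mul_le_mul_of_nonneg_right (hle m i l) h0)⟩

variable (hinv : ∀ i, ∀ t : ℝ, 0 ≤ t → ∀ f ∈ sobolevSpace T 1, T i t f ∈ sobolevSpace T 1)
include hinv

omit [NormedSpace ℝ H] [IsScalarTower ℝ 𝕜 H] in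
/-- The semigroups act boundedly on the Sobolev spaces for short times. -/
theorem exists_sobolevNorm_orbit_le (r : ℕ) : ∃ K, 0 ≤ K ∧ ∀ m t, 0 ≤ t → t ≤ δ →
    ∀ f ∈ sobolevSpace T r, T m t f ∈ sobolevSpace T r ∧
      sobolevNorm T r (T m t f) ≤ K * sobolevNorm T r f := by
  obtain ⟨E, M, hM, hE, hEM⟩ := exists_coefficient_bound hδ hcomm
  induction r with
  | zero =>
    refine ⟨1, zero_le_one, fun m t h0 _ f _ => ⟨Set.mem_univ _, ?_⟩⟩
    rw [sobolevNorm_zero, sobolevNorm_zero, one_mul]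
    exact (hT m).norm_apply_le h0 f
  | succ r ih =>
    obtain ⟨K, hK, ih⟩ := ih
    refine ⟨1 + d * (d * (M * K)), by positivity, fun m t h0 h1 f hf => ?_⟩
    have hf1 := sobolevSpace_succ_subset_one r hf
    have hg := (hE m).generator_eq t h0 h1 f hf1
    have hterm : ∀ i l, E m t i l • T m t (generator (T l) f) ∈ sobolevSpace T r := fun i l =>
      smul_mem_sobolevSpace _ (ih m t h0 h1 _ (hf l).2).1
    refine ⟨fun i => ⟨(hinv m t h0 f hf1 i).1, ?_⟩, ?_⟩
    · rw [hg i]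
      exact sum_mem_sobolevSpace _ fun l _ => hterm i l
    · rw [add_mul, one_mul, mul_assoc]
      refine sobolevNorm_le_succ_of (((hT m).norm_apply_le h0 f).trans (norm_le_sobolevNorm _ f))
        fun i => ?_
      rw [hg i]
      refine (sobolevNorm_sum_le _ fun l _ => hterm i l).trans
        ((Finset.sum_le_card_nsmul _ _ (M * K * sobolevNorm T (r + 1) f) fun l _ => ?_).trans
          (le_of_eq (by simp; ring)))
      rw [sobolevNorm_smul _ (ih m t h0 h1 _ (hf l).2).1, mul_assoc]
      refine mul_le_mul (hEM m t h0 h1 i l).1 ((ih m t h0 h1 _ (hf l).2).2.trans ?_)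
        (sobolevNorm_nonneg _ _) hM
      gcongr
      exact sobolevNorm_generator_le r f l

/-- D_i(T_m(t)f − f) is ∑_l (E(t) − I)_il T_m(t) D_l f plus T_m(t) D_i f − D_i f. The first part is
O(t) because E is C¹ with E(0) = I, the second by induction on r. -/
theorem exists_sobolevNorm_orbit_sub_le (r : ℕ) : ∃ K, 0 ≤ K ∧ ∀ m t, 0 ≤ t → t ≤ δ →
    ∀ f ∈ sobolevSpace T (r + 1), T m t f - f ∈ sobolevSpace T r ∧
      sobolevNorm T r (T m t f - f) ≤ K * t * sobolevNorm T (r + 1) f := by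
  obtain ⟨E, M, hM, hE, hEM⟩ := exists_coefficient_bound hδ hcomm
  have hbase : ∀ r m t, 0 ≤ t → ∀ f ∈ sobolevSpace T (r + 1),
      ‖T m t f - f‖ ≤ t * sobolevNorm T (r + 1) f := fun r m t h0 f hf => by
    refine ((hT m).norm_sub_le (hasGenerator_of_mem_succ hf m) h0).trans ?_
    gcongr
    exact (norm_le_sobolevNorm r _).trans (sobolevNorm_generator_le r f m)
  induction r with
  | zero =>
    refine ⟨1, zero_le_one, fun m t h0 _ f hf => ⟨Set.mem_univ _, ?_⟩⟩
    rw [sobolevNorm_zero, one_mul]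
    exact hbase 0 m t h0 f hf
  | succ r ih =>
    obtain ⟨K₂, hK₂, ih⟩ := ih
    obtain ⟨K₁, hK₁, hK⟩ := exists_sobolevNorm_orbit_le hT hδ hcomm hinv r
    refine ⟨1 + d * (d * (M * K₁) + K₂), by positivity, fun m t h0 h1 f hf => ?_⟩
    have hf1 := sobolevSpace_succ_subset_one _ hf
    have hTf := hinv m t h0 f hf1
    have hD : ∀ l, generator (T l) f ∈ sobolevSpace T r := fun l =>
      sobolevSpace_succ_subset r (hf l).2
    have hg : ∀ i, generator (T i) (T m t f - f) =
        ∑ l, (E m t i l - if i = l then 1 else 0) • T m t (generator (T l) f) +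
          (T m t (generator (T i) f) - generator (T i) f) := fun i => by
      rw [((hasGenerator_of_mem_succ hTf i).sub (hasGenerator_of_mem_succ hf1 i)).generator_eq,
        (hE m).generator_eq t h0 h1 f hf1 i]
      simp [sub_smul, Finset.sum_sub_distrib]
    have hterm : ∀ i l, (E m t i l - if i = l then 1 else 0) • T m t (generator (T l) f) ∈
        sobolevSpace T r := fun i l => smul_mem_sobolevSpace _ (hK m t h0 h1 _ (hD l)).1
    have hrest : ∀ i, T m t (generator (T i) f) - generator (T i) f ∈ sobolevSpace T r := fun i =>
      (ih m t h0 h1 _ (hf i).2).1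
    refine ⟨fun i => ⟨(sub_mem_sobolevSpace hTf hf1 i).1, ?_⟩, ?_⟩
    · rw [hg i]
      exact add_mem_sobolevSpace (sum_mem_sobolevSpace _ fun l _ => hterm i l) (hrest i)
    · have hN := sobolevNorm_nonneg (T := T) (r + 1 + 1) f
      refine (sobolevNorm_le_succ_of (hbase _ m t h0 f hf)
        (b := (d * (M * K₁) + K₂) * t * sobolevNorm T (r + 1 + 1) f) fun i => ?_).trans
        (le_of_eq (by ring))
      rw [hg i]
      refine (sobolevNorm_add_le (sum_mem_sobolevSpace _ fun l _ => hterm i l) (hrest i)).trans ?_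
      rw [add_mul, add_mul]
      refine add_le_add ?_ ((ih m t h0 h1 _ (hf i).2).2.trans ?_)
      · refine (sobolevNorm_sum_le _ fun l _ => hterm i l).trans
          ((Finset.sum_le_card_nsmul _ _ (M * t * (K₁ * sobolevNorm T (r + 1 + 1) f))
            fun l _ => ?_).trans (le_of_eq (by simp; ring)))
        rw [sobolevNorm_smul _ (hK m t h0 h1 _ (hD l)).1]
        refine mul_le_mul (hEM m t h0 h1 i l).2 ((hK m t h0 h1 _ (hD l)).2.trans ?_)
          (sobolevNorm_nonneg _ _) (by positivity)
        gcongr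
        exact (sobolevNorm_generator_le r f l).trans (sobolevNorm_le_succ _ f)
      · gcongr
        exact sobolevNorm_generator_le _ f i

theorem exists_sobolevNorm_differenceOp_le (n k : ℕ) : ∃ K, 0 ≤ K ∧ ∀ s, 0 ≤ s → s ≤ δ →
    ∀ w : List (Fin d × ℝ), w.length = n → (∀ p ∈ w, 0 ≤ p.2 ∧ p.2 ≤ s) →
    ∀ f ∈ sobolevSpace T (k + n), differenceOp T w f ∈ sobolevSpace T k ∧
      sobolevNorm T k (differenceOp T w f) ≤ K * s ^ n * sobolevNorm T (k + n) f := by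
  induction n generalizing k with
  | zero =>
    refine ⟨1, zero_le_one, fun s _ _ w hw _ f hf => ?_⟩
    rw [List.length_eq_zero_iff.1 hw]
    simpa [differenceOp_nil] using hf
  | succ n ih =>
    obtain ⟨K₁, hK₁, h₁⟩ := ih (k + 1)
    obtain ⟨K₂, hK₂, h₂⟩ := exists_sobolevNorm_orbit_sub_le hT hδ hcomm hinv k
    refine ⟨K₂ * K₁, by positivity, fun s h0 h1 w hw hws f hf => ?_⟩
    obtain ⟨p, w, rfl⟩ := List.exists_cons_of_length_eq_add_one hw
    have hidx : k + (n + 1) = k + 1 + n := by omega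
    rw [hidx] at hf ⊢
    have hp := hws p List.mem_cons_self
    obtain ⟨h3, h4⟩ := h₁ s h0 h1 w (by simpa using hw)
      (fun q hq => hws q (List.mem_cons_of_mem _ hq)) f hf
    obtain ⟨h5, h6⟩ := h₂ p.1 p.2 hp.1 (hp.2.trans h1) _ h3
    rw [differenceOp_cons]
    refine ⟨h5, h6.trans ?_⟩
    have hN := sobolevNorm_nonneg (T := T) (k + 1 + n) f
    calc K₂ * p.2 * sobolevNorm T (k + 1) (differenceOp T w f)
        ≤ K₂ * s * (K₁ * s ^ n * sobolevNorm T (k + 1 + n) f) := by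
          refine mul_le_mul (mul_le_mul_of_nonneg_left hp.2 hK₂) h4 (sobolevNorm_nonneg _ _)
            (by positivity)
      _ = _ := by ring

theorem exists_mixedModulus_le (r : ℕ) : ∃ C, 0 ≤ C ∧ ∀ s, 0 ≤ s → ∀ f, ∀ g ∈ sobolevSpace T r,
    mixedModulus T r s f ≤ C * (‖f - g‖ + s ^ r * sobolevNorm T r g) := by
  obtain ⟨K, hK, h⟩ := exists_sobolevNorm_differenceOp_le hT hδ hcomm hinv r 0
  simp only [zero_add, sobolevNorm_zero] at h
  -- 2^r bounds the differences of f − g, K those of g when s ≤ δ. For s ≥ δ the trivial bound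
  -- 2^r‖g‖ suffices, as (s/δ)^r ≥ 1.
  set A := 2 ^ r + K + 2 ^ r * (δ⁻¹) ^ r with hA
  refine ⟨d ^ r * A, by positivity, fun s hs f g hg => ?_⟩
  rw [mul_assoc]
  have hN := sobolevNorm_nonneg (T := T) r g
  refine mixedModulus_le hs fun w hw hws => ?_
  have h1 : ‖differenceOp T w (f - g)‖ ≤ 2 ^ r * ‖f - g‖ :=
    hw ▸ norm_differenceOp_le hT w (fun p hp => (hws p hp).1) (f - g)
  have h2 : ‖differenceOp T w g‖ ≤ (K + 2 ^ r * (δ⁻¹) ^ r) * (s ^ r * sobolevNorm T r g) := by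
    rcases le_total s δ with hsδ | hsδ
    · refine (h s hs hsδ w hw hws g hg).2.trans ?_
      have : 0 ≤ 2 ^ r * (δ⁻¹) ^ r * (s ^ r * sobolevNorm T r g) := by positivity
      linarith
    · have h3 : ‖differenceOp T w g‖ ≤ 2 ^ r * ‖g‖ :=
        hw ▸ norm_differenceOp_le hT w (fun p hp => (hws p hp).1) g
      have h4 : 1 ≤ (δ⁻¹) ^ r * s ^ r := by
        rw [← mul_pow]
        refine one_le_pow₀ ?_
        rw [inv_mul_eq_div, one_le_div hδ]
        exact hsδ
      have h5 : 0 ≤ K * (s ^ r * sobolevNorm T r g) := by positivity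
      calc ‖differenceOp T w g‖ ≤ 2 ^ r * (1 * sobolevNorm T r g) := by
            rw [one_mul]; refine h3.trans ?_; gcongr; exact norm_le_sobolevNorm r g
        _ ≤ 2 ^ r * ((δ⁻¹) ^ r * s ^ r * sobolevNorm T r g) := by gcongr
        _ ≤ _ := by linarith
  have h3 : differenceOp T w f = differenceOp T w (f - g) + differenceOp T w g := by
    rw [← map_add, sub_add_cancel]
  rw [h3]
  refine (norm_add_le _ _).trans ((add_le_add h1 h2).trans ?_)
  have h4 : 0 ≤ 2 ^ r * (s ^ r * sobolevNorm T r g) := by positivity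
  have h5 : 0 ≤ (K + 2 ^ r * (δ⁻¹) ^ r) * ‖f - g‖ := by positivity
  rw [hA]
  linarith

end LowerBound

/-! ### Stability of difference bounds under semigroups and averages. -/

section DifferenceBound

open MeasureTheory

variable {𝕜 H : Type*} [RCLike 𝕜] [NormedAddCommGroup H] [InnerProductSpace 𝕜 H] {d : ℕ}
  {T : Fin d → ℝ → H →L[𝕜] H}

theorem differenceOp_append (w w' : List (Fin d × ℝ)) (f : H) :
    differenceOp T (w ++ w') f = differenceOp T w (differenceOp T w' f) := by
  simp [differenceOp]

namespace DifferenceBound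

variable {n : ℕ} {s b c : ℝ} {f g : H}

theorem mono (h : DifferenceBound T n s b f) (hb : b ≤ c) : DifferenceBound T n s c f :=
  fun w hw hws => (h w hw hws).trans hb

theorem add (h : DifferenceBound T n s b f) (h' : DifferenceBound T n s c g) :
    DifferenceBound T n s (b + c) (f + g) := fun w hw hws => by
  rw [map_add]
  exact (norm_add_le _ _).trans (add_le_add (h w hw hws) (h' w hw hws))

theorem sub (h : DifferenceBound T n s b f) (h' : DifferenceBound T n s c g) :
    DifferenceBound T n s (b + c) (f - g) := fun w hw hws => by
  rw [map_sub]
  exact (norm_sub_le _ _).trans (add_le_add (h w hw hws) (h' w hw hws))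

theorem neg (h : DifferenceBound T n s b f) : DifferenceBound T n s b (-f) := fun w hw hws => by
  rw [map_neg, norm_neg]
  exact h w hw hws

theorem sum {ι : Type*} (I : Finset ι) {F : ι → H} (h : ∀ i ∈ I, DifferenceBound T n s b (F i)) :
    DifferenceBound T n s (I.card * b) (∑ i ∈ I, F i) := fun w hw hws => by
  rw [map_sum]
  exact (norm_sum_le_of_le I fun i hi => h i hi w hw hws).trans (by simp)

theorem real_smul [NormedSpace ℝ H] [IsScalarTower ℝ 𝕜 H] {a : ℝ} (ha : 0 ≤ a)
    (h : DifferenceBound T n s b f) : DifferenceBound T n s (a * b) (a • f) := fun w hw hws => by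
  rw [ContinuousLinearMap.map_smul_of_tower, norm_smul, Real.norm_of_nonneg ha]
  exact mul_le_mul_of_nonneg_left (h w hw hws) ha

theorem apply_sub (h : DifferenceBound T (n + 1) s b f) (a : Fin d) {t : ℝ} (h0 : 0 ≤ t)
    (hts : t ≤ s) : DifferenceBound T n s b (T a t f - f) := fun w hw hws => by
  have := h (w ++ [(a, t)]) (by simp [hw]) fun p hp => by
    rcases List.mem_append.1 hp with hp | hp
    · exact hws p hp
    · rw [List.mem_singleton.1 hp]
      exact ⟨h0, hts⟩
  rwa [differenceOp_append, differenceOp_cons, differenceOp_nil] at this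

variable (hT : ∀ i, IsContractionSemigroup (T i))
include hT

theorem succ (h : DifferenceBound T n s b f) : DifferenceBound T (n + 1) s (2 * b) f :=
  fun w hw hws => by
    obtain ⟨p, w, rfl⟩ := List.exists_cons_of_length_eq_add_one hw
    have h1 := h w (by simpa using hw) fun q hq => hws q (List.mem_cons_of_mem _ hq)
    have h2 := (hT p.1).norm_apply_le (hws p List.mem_cons_self).1 (differenceOp T w f)
    rw [differenceOp_cons]
    refine (norm_sub_le _ _).trans ?_
    linarith

/-- T_a(t) does not commute with differences; writing T_a(t)f = f + (T_a(t)f − f) makes the second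
term one more difference, whence 3 = 1 + 2. -/
theorem apply (h : DifferenceBound T n s b f) (a : Fin d) {t : ℝ} (h0 : 0 ≤ t) (hts : t ≤ s) :
    DifferenceBound T n s (3 * b) (T a t f) := by
  have := h.add ((h.succ hT).apply_sub a h0 hts)
  rw [add_sub_cancel] at this
  exact this.mono (by linarith)

theorem listOrbit (h : DifferenceBound T n s b f) {t : EuclideanSpace ℝ (Fin d)}
    (ht : ∀ k, 0 ≤ t k ∧ t k ≤ s) (L : List (Fin d)) :
    DifferenceBound T n s (3 ^ L.length * b) (listOrbit T t L f) := by
  induction L with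
  | nil => simpa [_root_.listOrbit] using h
  | cons a L ih =>
    rw [listOrbit_cons_apply, List.length_cons, pow_succ', mul_assoc]
    exact ih.apply hT a (ht a).1 (ht a).2

/-- Telescoping over the factors; each summand contains one difference, which lowers the order by
one. The base 4 leaves room for 3 from `apply` plus 1. -/
theorem listOrbit_sub (hb : 0 ≤ b) (h : DifferenceBound T (n + 1) s b f)
    {t : EuclideanSpace ℝ (Fin d)} (ht : ∀ k, 0 ≤ t k ∧ t k ≤ s) (L : List (Fin d)) :
    DifferenceBound T n s (4 ^ L.length * b) (_root_.listOrbit T t L f - f) := by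
  induction L with
  | nil =>
    intro w _ _
    simpa [_root_.listOrbit] using hb
  | cons a L ih =>
    have h1 : _root_.listOrbit T t (a :: L) f - f =
        T a (t a) (_root_.listOrbit T t L f - f) + (T a (t a) f - f) := by
      rw [listOrbit_cons_apply, map_sub]; abel
    rw [h1]
    refine ((ih.apply hT a (ht a).1 (ht a).2).add (h.apply_sub a (ht a).1 (ht a).2)).mono ?_
    have : 1 * b ≤ 4 ^ L.length * b := by gcongr; exact one_le_pow₀ (by norm_num)
    rw [List.length_cons, pow_succ']
    linarith

variable [NormedSpace ℝ H] [IsScalarTower ℝ 𝕜 H] [CompleteSpace H]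

omit [IsScalarTower ℝ 𝕜 H] hT in
theorem integral {q : EuclideanSpace ℝ (Fin d) → 𝕜} {F : EuclideanSpace ℝ (Fin d) → H}
    (hc : 0 ≤ c) (hq : Continuous q) (hz : ∀ u, u ∉ kernelSupport d → q u = 0)
    (hqc : ∀ u, ‖q u‖ ≤ c) (hF : ContinuousOn F (kernelRegion d))
    (h : ∀ u ∈ kernelSupport d, DifferenceBound T n s b (F u)) :
    DifferenceBound T n s (kernelVolume d * c * b) (∫ u, q u • F u) := fun w hw hws => by
  rw [← (differenceOp T w).integral_comp_comm (integrable_kernel_smul hq hz hF)]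
  simp only [map_smul]
  exact norm_integral_kernel_le hc hz hqc fun u hu => h u hu w hw hws

omit [IsScalarTower ℝ 𝕜 H] in
theorem kernelAverage {σ : ℝ} (hσ : 0 < σ) (hσs : 2 * σ ≤ s) (L : List (Fin d))
    {q : EuclideanSpace ℝ (Fin d) → 𝕜} (hc : 0 ≤ c) (hq : Continuous q)
    (hz : ∀ u, u ∉ kernelSupport d → q u = 0) (hqc : ∀ u, ‖q u‖ ≤ c)
    (h : DifferenceBound T n s b f) :
    DifferenceBound T n s (kernelVolume d * c * (3 ^ L.length * b)) (kernelAverage T L σ q f) :=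
  integral hc hq hz hqc (continuousOn_listOrbit_smul hT hσ L f) fun _ hu =>
    h.listOrbit hT (smul_mem_of_mem_kernelRegion hσ hσs (kernelSupport_subset hu)) L

omit [IsScalarTower ℝ 𝕜 H] in
theorem kernelAverage_sub_integral {σ : ℝ} (hσ : 0 < σ) (hσs : 2 * σ ≤ s) (L : List (Fin d))
    {q : EuclideanSpace ℝ (Fin d) → 𝕜} (hc : 0 ≤ c) (hq : Continuous q)
    (hz : ∀ u, u ∉ kernelSupport d → q u = 0) (hqc : ∀ u, ‖q u‖ ≤ c) (hb : 0 ≤ b)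
    (h : DifferenceBound T (n + 1) s b f) :
    DifferenceBound T n s (kernelVolume d * c * (4 ^ L.length * b))
      (_root_.kernelAverage T L σ q f - (∫ u, q u) • f) := by
  rw [kernelAverage_sub_integral_smul hT hσ L hq hz]
  exact integral hc hq hz hqc ((continuousOn_listOrbit_smul hT hσ L f).sub continuousOn_const)
    fun _ hu => h.listOrbit_sub hT hb
      (smul_mem_of_mem_kernelRegion hσ hσs (kernelSupport_subset hu)) L

end DifferenceBound

/-- With mean zero, f can be subtracted under the average at no cost, so averages against
derivatives of kernels see only differences of f. -/
theorem IsKernel.integral_partialDeriv {φ : EuclideanSpace ℝ (Fin d) → 𝕜} {b : ℝ}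
    (hφ : IsKernel b φ) (k : Fin d) : ∫ u, partialDeriv k φ u = 0 := by
  have hint : ∀ q : EuclideanSpace ℝ (Fin d) → 𝕜, Continuous q →
      (∀ u, u ∉ kernelSupport d → q u = 0) → Integrable q := fun q hq hz => by
    simpa using integrable_kernel_smul (F := fun _ => (1 : 𝕜)) hq hz continuousOn_const
  have h := integral_bilinear_hasLineDerivAt_right_eq_neg_left_of_integrable (μ := volume)
    (B := ContinuousLinearMap.mul ℝ 𝕜) (f := φ) (f' := partialDeriv k φ)
    (g := fun _ => (1 : 𝕜)) (g' := fun _ => 0) (v := EuclideanSpace.single k 1)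
    (by simpa using hint _ (hφ.continuous_partialDeriv k) (hφ.partialDeriv_eq_zero k))
    (by simp) (by simpa using hint _ hφ.contDiff.continuous hφ.eq_zero)
    (fun u _ => (hφ.contDiff.differentiable one_ne_zero u).hasFDerivAt.hasLineDerivAt _)
    (fun u _ => by
      have := (hasFDerivAt_const (𝕜 := ℝ) (1 : 𝕜) u).hasLineDerivAt (EuclideanSpace.single k 1)
      simpa using this)
  simpa using h.symm

end DifferenceBound

/-! ### Averages over the full product trade differences for derivatives. -/

section DerivativeBound

open MeasureTheory

variable {𝕜 H : Type*} [RCLike 𝕜] [NormedAddCommGroup H] [InnerProductSpace 𝕜 H] {d : ℕ}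

/-- All derivatives of `f` of order `p` satisfy a bound for differences of order `n`. -/
def DerivativeBound (T : Fin d → ℝ → H →L[𝕜] H) (n : ℕ) (s b : ℝ) : ℕ → H → Prop
  | 0, f => DifferenceBound T n s b f
  | p + 1, f => ∀ i, DerivativeBound T n s b p (generator (T i) f)

variable {T : Fin d → ℝ → H →L[𝕜] H}

theorem DerivativeBound.mono {n p : ℕ} {s b c : ℝ} {f : H} (h : DerivativeBound T n s b p f)
    (hb : b ≤ c) : DerivativeBound T n s c p f := by
  induction p generalizing f with
  | zero => exact DifferenceBound.mono h hb
  | succ p ih => exact fun i => ih (h i)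

theorem DerivativeBound.sum {ι : Type*} {n p : ℕ} {s b : ℝ} (I : Finset ι) {F : ι → H}
    (hF : ∀ i ∈ I, F i ∈ sobolevSpace T p) (h : ∀ i ∈ I, DerivativeBound T n s b p (F i)) :
    DerivativeBound T n s (I.card * b) p (∑ i ∈ I, F i) := by
  induction p generalizing F with
  | zero => exact DifferenceBound.sum I h
  | succ p ih =>
    intro j
    rw [(HasGenerator.sum I fun i hi => hasGenerator_of_mem_succ (hF i hi) j).generator_eq]
    exact ih (fun i hi => (hF i hi j).2) fun i hi => h i hi j

theorem DerivativeBound.sum_norm_mixedDeriv_le {p : ℕ} {s b : ℝ} {f : H}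
    (h : DerivativeBound T 0 s b p f) : ∑ j : Fin p → Fin d, ‖mixedDeriv T j f‖ ≤ d ^ p * b := by
  induction p generalizing f with
  | zero =>
    have := h [] rfl (by simp)
    simpa [mixedDeriv, differenceOp_nil] using this
  | succ p ih =>
    rw [sum_norm_mixedDeriv_succ, pow_succ', mul_assoc]
    exact (Finset.sum_le_card_nsmul _ _ _ fun i _ => ih (h i)).trans (by simp)

variable (hT : ∀ i, IsContractionSemigroup (T i))
  [NormedSpace ℝ H] [IsScalarTower ℝ 𝕜 H] [CompleteSpace H]
  (hinv : ∀ i, ∀ t : ℝ, 0 ≤ t → ∀ f ∈ sobolevSpace T 1, T i t f ∈ sobolevSpace T 1)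
  {ζ : Fin d → Fin d → EuclideanSpace ℝ (Fin d) → 𝕜}
  (hζ1 : ∀ i k, ContDiffOn ℝ 1 (ζ i k) (Metric.ball 0 1))
  (hζ : ∀ i, ∀ f ∈ sobolevSpace T 1, ∀ t ∈ Metric.ball (0 : EuclideanSpace ℝ (Fin d)) 1,
      (∀ k, 0 ≤ t k) → ∃ v : Fin d → H, (∀ k, HasOrbitPartialDeriv T f k t (v k)) ∧
        generator (T i) (orbitMap T f t) = ∑ k, ζ i k t • v k)
  {δ : ℝ} (hδ : 0 < δ) {E C : EuclideanSpace ℝ (Fin d) → Fin d → Fin d → 𝕜}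
  (hL : ListCommutesVia T (List.finRange d) δ E C)
include hT hinv hζ1 hζ hδ hL

/-- The averages over the full product regularize: the structural identity allows to integrate by
parts. -/
theorem exists_hasGenerator_kernelAverage (hdense : Dense (sobolevSpace T 1)) :
    ∃ B, 0 ≤ B ∧ ∀ᶠ s in 𝓝[>] (0 : ℝ), ∀ b (φ : EuclideanSpace ℝ (Fin d) → 𝕜), IsKernel b φ →
      ∀ i, ∃ ψ : Fin d → EuclideanSpace ℝ (Fin d) → 𝕜, (∀ l, IsKernel (B * b) (ψ l)) ∧
        ∀ f, HasGenerator (T i) (kernelAverage T (List.finRange d) s φ f)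
          (-∑ l, s⁻¹ • kernelAverage T (List.finRange d) s (partialDeriv l (ψ l)) f) := by
  obtain ⟨B, hB0, hB⟩ := exists_isKernel_mul_family hζ1
  refine ⟨B, hB0, ?_⟩
  filter_upwards [eventually_scale hδ d] with s ⟨hs, hsδ, hsR, _⟩ b φ hφ i
  set L := List.finRange d with hLd
  set ψ : Fin d → EuclideanSpace ℝ (Fin d) → 𝕜 := fun l u => ζ i l (s • u) * φ u with hψ
  have hψk : ∀ l, IsKernel (B * b) (ψ l) := fun l => (hB i l s hs hsR b φ hφ).1
  refine ⟨ψ, hψk, fun f => ?_⟩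
  have hcore : ∀ y ∈ sobolevSpace T 1, HasGenerator (T i) (kernelAverage T L s φ y)
      (-∑ l, s⁻¹ • kernelAverage T L s (partialDeriv l (ψ l)) y) := by
    intro y hy
    have hpt : ∀ u ∈ kernelSupport d, HasGenerator (T i) (listOrbit T (s • u) L y)
        (∑ l, ζ i l (s • u) • listPartial T l (s • u) L y) := by
      intro u hu
      have hu' := smul_mem_of_mem_kernelRegion hs hsδ (kernelSupport_subset hu)
      have hpos : ∀ k, 0 ≤ (s • u) k := fun k => (hu' k).1
      have hball : s • u ∈ Metric.ball (0 : EuclideanSpace ℝ (Fin d)) 1 := by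
        rw [mem_ball_zero_iff, norm_smul, Real.norm_of_nonneg hs.le]
        have := mul_le_mul_of_nonneg_left (norm_le_kernelRadius hu) hs.le
        linarith
      obtain ⟨v, hv, hgen⟩ := hζ i y hy _ hball hpos
      have h1 := hasGenerator_of_mem_succ (listOrbit_mem_sobolevSpace_one hinv hpos L hy) i
      rw [← orbitMap_eq_listOrbit, hgen, orbitMap_eq_listOrbit] at h1
      simpa only [(hasOrbitPartialDeriv_iff hT hinv hpos _ hy).1 (hv _)] using h1
    have hint : ∀ l, Integrable fun u => ψ l u • listPartial T l (s • u) L y := fun l =>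
      integrable_kernel_smul (hψk l).contDiff.continuous (hψk l).eq_zero
        (continuousOn_listPartial_smul hT hL hs hsδ hy l)
    have h2 : ∑ l, ∫ u, ψ l u • listPartial T l (s • u) L y =
        -∑ l, s⁻¹ • kernelAverage T L s (partialDeriv l (ψ l)) y := by
      rw [← Finset.sum_neg_distrib]
      exact Finset.sum_congr rfl fun l _ =>
        integral_smul_listPartial hT hinv hL hs hsδ (hψk l) hy l
    rw [← h2, ← integral_finsetSum _ fun l _ => hint l]
    refine (hT i).hasGenerator_integral
      (integrable_kernelAverage hT hs L hφ.contDiff.continuous hφ.eq_zero y)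
      (integrable_finsetSum _ fun l _ => hint l) fun u => ?_
    by_cases hu : u ∈ kernelSupport d
    · have h3 := (hpt u hu).smul (φ u)
      rw [Finset.smul_sum] at h3
      simpa only [hψ, smul_smul, mul_comm (φ u)] using h3
    · simpa [hψ, hφ.eq_zero u hu] using HasGenerator.zero (T := T i)
  -- The right-hand side involves no derivative of f, so both sides are bounded in f and closedness
  -- of the generator extends the formula from the dense space H^1 to all of H.
  have hne : (𝓝[sobolevSpace T 1] f).NeBot := mem_closure_iff_nhdsWithin_neBot.1 (hdense f)
  have hcont : ∀ q : EuclideanSpace ℝ (Fin d) → 𝕜, ∀ c, Continuous q →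
      (∀ u, u ∉ kernelSupport d → q u = 0) → (∀ u, ‖q u‖ ≤ c) → 0 ≤ c →
      Tendsto (kernelAverage T L s q) (𝓝[sobolevSpace T 1] f) (𝓝 (kernelAverage T L s q f)) := by
    intro q c hq hz hqc hc
    refine tendsto_iff_norm_sub_tendsto_zero.2 (squeeze_zero_norm'
      (a := fun y => kernelVolume d * c * ‖y - f‖) (Eventually.of_forall fun y => ?_) ?_)
    · rw [norm_norm, ← kernelAverage_sub hT hs L hq hz]
      exact norm_kernelAverage_le hT hs L hc hz hqc _
    · have : Continuous fun y : H => kernelVolume d * c * ‖y - f‖ := by fun_prop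
      simpa using (this.tendsto f).mono_left nhdsWithin_le_nhds
  refine (hT i).hasGenerator_of_tendsto
    (eventually_nhdsWithin_of_forall hcore)
    (hcont φ b hφ.contDiff.continuous hφ.eq_zero hφ.norm_le hφ.nonneg)
    (tendsto_finsetSum _ fun l _ => (hcont _ (B * b) ((hψk l).continuous_partialDeriv l)
      ((hψk l).partialDeriv_eq_zero l) ((hψk l).norm_partialDeriv_le l) (hψk l).nonneg).const_smul
        s⁻¹).neg

/-- Each average gains one derivative at the cost of one difference. -/
theorem exists_derivativeBound_kernelAverage (hdense : Dense (sobolevSpace T 1)) (p : ℕ) :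
    ∃ K, 0 ≤ K ∧ ∀ᶠ s in 𝓝[>] (0 : ℝ), ∀ n b (φ : EuclideanSpace ℝ (Fin d) → 𝕜), IsKernel b φ →
      ∀ β, 0 ≤ β → ∀ y ∈ sobolevSpace T p, DerivativeBound T (n + 1) (2 * s) β p y →
        kernelAverage T (List.finRange d) s φ y ∈ sobolevSpace T (p + 1) ∧
        DerivativeBound T n (2 * s) (K * b * s⁻¹ * β) (p + 1)
          (kernelAverage T (List.finRange d) s φ y) := by
  set L := List.finRange d with hLd
  have hv0 := kernelVolume_nonneg (d := d)
  induction p with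
  | zero =>
    obtain ⟨B, hB0, hev⟩ := exists_hasGenerator_kernelAverage hT hinv hζ1 hζ hδ hL hdense
    refine ⟨d * (kernelVolume d * B * 4 ^ L.length), by positivity, ?_⟩
    filter_upwards [hev, self_mem_nhdsWithin] with s hgen hs n b φ hφ β hβ y _ hy
    have hs : (0 : ℝ) < s := hs
    choose ψ hψ hψgen using hgen b φ hφ
    refine ⟨mem_sobolevSpace_one fun i => hψgen i y, fun i => ?_⟩
    rw [(hψgen i y).generator_eq]
    have h1 : ∀ l ∈ Finset.univ, DifferenceBound T n (2 * s)
        (s⁻¹ * (kernelVolume d * (B * b) * (4 ^ L.length * β)))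
        (s⁻¹ • kernelAverage T L s (partialDeriv l (ψ i l)) y) := fun l _ => by
      have h2 := DifferenceBound.kernelAverage_sub_integral hT hs le_rfl L (hψ i l).nonneg
        ((hψ i l).continuous_partialDeriv l) ((hψ i l).partialDeriv_eq_zero l)
        ((hψ i l).norm_partialDeriv_le l) hβ hy
      rw [(hψ i l).integral_partialDeriv l, zero_smul, sub_zero] at h2
      exact h2.real_smul (inv_nonneg.2 hs.le)
    refine ((DifferenceBound.sum _ h1).neg).mono (le_of_eq ?_)
    simp only [Finset.card_univ, Fintype.card_fin]
    ring
  | succ p ih =>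
    obtain ⟨K, hK, hev⟩ := ih
    obtain ⟨B, hB0, hB⟩ := exists_isKernel_mul_family (ψ := fun i l t => E t i l)
      fun i l => (hL.contDiff i l).contDiffOn
    refine ⟨d * (K * B), by positivity, ?_⟩
    filter_upwards [hev, eventually_scale hδ d] with s hs' ⟨hs, hsδ, hsR, _⟩ n b φ hφ β hβ y hy hyb
    have hgen := fun i => kernelAverage_mem_and_generator hT hinv hL hs hsδ hφ
      (sobolevSpace_succ_subset_one p hy) i
    -- One generator is moved through the average onto y by the commutation rule; the induction
    -- hypothesis then applies to D_l y with the kernel E_il(su) φ(u).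
    have hterm := fun i l => hs' n (B * b) _ (hB i l s hs hsR b φ hφ).1 β hβ (generator (T l) y)
      (hy l).2 (hyb l)
    refine ⟨mem_sobolevSpace_of_hasGenerator hgen fun i =>
      sum_mem_sobolevSpace _ fun l _ => (hterm i l).1, fun i => ?_⟩
    rw [(hgen i).generator_eq]
    refine (DerivativeBound.sum _ (fun l _ => (hterm i l).1) fun l _ => (hterm i l).2).mono
      (le_of_eq ?_)
    simp only [Finset.card_univ, Fintype.card_fin]
    ring

/-- Each application of the average spends one of the n + p available differences and gains one
derivative, at the price of s⁻¹. -/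
theorem exists_derivativeBound_iterate (hdense : Dense (sobolevSpace T 1))
    {κ : EuclideanSpace ℝ (Fin d) → 𝕜} {b : ℝ} (hκ : IsKernel b κ) (p : ℕ) :
    ∃ K, 0 ≤ K ∧ ∀ᶠ s in 𝓝[>] (0 : ℝ), ∀ n β, 0 ≤ β → ∀ f,
      DifferenceBound T (n + p) (2 * s) β f →
        (kernelAverage T (List.finRange d) s κ)^[p] f ∈ sobolevSpace T p ∧
        DerivativeBound T n (2 * s) (K * (s⁻¹) ^ p * β) p
          ((kernelAverage T (List.finRange d) s κ)^[p] f) := by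
  induction p with
  | zero =>
    refine ⟨1, zero_le_one, Eventually.of_forall fun s n β _ f hf => ⟨Set.mem_univ _, ?_⟩⟩
    simpa [DerivativeBound] using hf
  | succ p ih =>
    obtain ⟨K₁, hK₁, h₁⟩ := ih
    obtain ⟨K₂, hK₂, h₂⟩ := exists_derivativeBound_kernelAverage hT hinv hζ1 hζ hδ hL hdense p
    have hb := hκ.nonneg
    refine ⟨K₂ * b * K₁, by positivity, ?_⟩
    filter_upwards [h₁, h₂, self_mem_nhdsWithin] with s h₁ h₂ hs n β hβ f hf
    have hs : (0 : ℝ) < s := hs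
    have hidx : n + (p + 1) = n + 1 + p := by omega
    rw [hidx] at hf
    obtain ⟨h3, h4⟩ := h₁ (n + 1) β hβ f hf
    obtain ⟨h5, h6⟩ := h₂ n b κ hκ _ (by positivity) _ h3 h4
    rw [Function.iterate_succ_apply']
    refine ⟨h5, h6.mono (le_of_eq ?_)⟩
    ring

end DerivativeBound

/-! ### Intermediate derivatives by Landau–Kolmogorov interpolation. -/

section Interpolation

theorem exists_interpolation_step {M : ℝ} (hM : 1 ≤ M) (r k : ℕ) (hk : k < r) {ε : ℝ}
    (hε : 0 < ε) : ∃ C, 0 ≤ C ∧ ∀ a : ℕ → ℝ, (∀ j, 0 ≤ a j) →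
      (∀ j, j + 2 ≤ r → ∀ δ, 0 < δ → δ * a (j + 1) ≤ M * (a j + δ ^ 2 * a (j + 2))) →
      a k ≤ ε * a (k + 1) + C * a 0 := by
  induction k generalizing ε with
  | zero =>
    refine ⟨1, zero_le_one, fun a ha _ => ?_⟩
    have := mul_nonneg hε.le (ha (0 + 1))
    linarith
  | succ k ih =>
    have hM0 : 0 < M := by linarith
    -- With 2Mδ = ε the coefficient of a (k + 2) comes out right, and ε replaced by δ/(2M) in the
    -- induction hypothesis leaves δ/2 of a (k + 1) to absorb.
    set δ := ε / (2 * M) with hδ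
    have hδ0 : 0 < δ := by positivity
    obtain ⟨C, hC, h⟩ := ih (by omega) (ε := δ / (2 * M)) (by positivity)
    refine ⟨2 * M * C / δ, by positivity, fun a ha hj => ?_⟩
    have h1 := h a ha hj
    have h2 := hj k (by omega) δ hδ0
    have h3 : M * a k ≤ δ / 2 * a (k + 1) + M * C * a 0 := by
      calc M * a k ≤ M * (δ / (2 * M) * a (k + 1) + C * a 0) := by gcongr
        _ = _ := by field_simp
    have h4 : δ * a (k + 1) ≤ δ * (ε * a (k + 1 + 1) + 2 * M * C / δ * a 0) := by
      have h5 : δ * (ε * a (k + 1 + 1) + 2 * M * C / δ * a 0) =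
          2 * (M * δ ^ 2 * a (k + 2)) + 2 * (M * C * a 0) := by
        rw [hδ]; field_simp
      rw [h5]
      linarith
    exact le_of_mul_le_mul_left h4 hδ0

theorem exists_interpolation {M : ℝ} (hM : 1 ≤ M) (r m : ℕ) : ∃ C, 0 ≤ C ∧ ∀ a : ℕ → ℝ,
      (∀ j, 0 ≤ a j) →
      (∀ j, j + 2 ≤ r → ∀ δ, 0 < δ → δ * a (j + 1) ≤ M * (a j + δ ^ 2 * a (j + 2))) →
      a (r - m) ≤ a r + C * a 0 := by
  induction m with
  | zero => exact ⟨0, le_rfl, fun a _ _ => by simp⟩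
  | succ m ih =>
    obtain ⟨C₁, hC₁, h₁⟩ := ih
    by_cases hm : m < r
    · obtain ⟨C₂, hC₂, h₂⟩ := exists_interpolation_step hM r (r - (m + 1)) (by omega) one_pos
      refine ⟨C₂ + C₁, by positivity, fun a ha hj => ?_⟩
      have h3 := h₁ a ha hj
      have h4 := h₂ a ha hj
      have h5 : r - (m + 1) + 1 = r - m := by omega
      rw [h5] at h4
      linarith
    · have h5 : r - (m + 1) = r - m := by omega
      rw [h5]
      exact ⟨C₁, hC₁, h₁⟩

variable {𝕜 H : Type*} [RCLike 𝕜] [NormedAddCommGroup H] [InnerProductSpace 𝕜 H] {d : ℕ}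
  {T : Fin d → ℝ → H →L[𝕜] H} (hT : ∀ i, IsContractionSemigroup (T i))
  [NormedSpace ℝ H] [IsScalarTower ℝ 𝕜 H]
include hT

theorem mul_sum_norm_mixedDeriv_le (k : ℕ) {f : H} (hf : f ∈ sobolevSpace T (k + 2)) {δ : ℝ}
    (hδ : 0 < δ) : δ * ∑ j : Fin (k + 1) → Fin d, ‖mixedDeriv T j f‖ ≤
      (2 * d + 1) * (∑ j : Fin k → Fin d, ‖mixedDeriv T j f‖ +
        δ ^ 2 * ∑ j : Fin (k + 2) → Fin d, ‖mixedDeriv T j f‖) := by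
  induction k generalizing f with
  | zero =>
    have h0 : ∀ g : H, ∑ j : Fin 0 → Fin d, ‖mixedDeriv T j g‖ = ‖g‖ := fun g => by
      simp [mixedDeriv]
    simp only [sum_norm_mixedDeriv_succ, h0]
    rw [Finset.mul_sum]
    refine (Finset.sum_le_sum (g := fun i => 2 * ‖f‖ +
      δ ^ 2 * ∑ j, ‖generator (T j) (generator (T i) f)‖) fun i _ => ?_).trans ?_
    · refine ((hT i).mul_norm_generator_le hδ.le (hasGenerator_of_mem_succ hf i)
        (hasGenerator_of_mem_succ (hf i).2 i)).trans ?_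
      gcongr
      exact Finset.single_le_sum (f := fun j => ‖generator (T j) (generator (T i) f)‖)
        (fun _ _ => norm_nonneg _) (Finset.mem_univ i)
    · rw [Finset.sum_add_distrib, Finset.sum_const, ← Finset.mul_sum]
      simp only [ Finset.card_univ, Fintype.card_fin, nsmul_eq_mul]
      have h1 : 0 ≤ d * (δ ^ 2 * ∑ i, ∑ j, ‖generator (T j) (generator (T i) f)‖) := by positivity
      have h2 := norm_nonneg f
      linarith
  | succ k ih =>
    rw [sum_norm_mixedDeriv_succ, sum_norm_mixedDeriv_succ k, sum_norm_mixedDeriv_succ (k + 2),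
      Finset.mul_sum, Finset.mul_sum, ← Finset.sum_add_distrib, Finset.mul_sum]
    exact Finset.sum_le_sum fun i _ => ih (hf i).2

omit hT [NormedSpace ℝ H] [IsScalarTower ℝ 𝕜 H] in
theorem sobolevSpace_antitone {k r : ℕ} (hkr : k ≤ r) : sobolevSpace T r ⊆ sobolevSpace T k := by
  induction r, hkr using Nat.le_induction with
  | base => exact subset_rfl
  | succ r _ ih => exact (sobolevSpace_succ_subset r).trans ih

/-- The Sobolev norm is controlled by the derivatives of top order. -/
theorem exists_sobolevNorm_le (r : ℕ) : ∃ C, 0 ≤ C ∧ ∀ f ∈ sobolevSpace T r,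
    sobolevNorm T r f ≤ C * (‖f‖ + ∑ j : Fin r → Fin d, ‖mixedDeriv T j f‖) := by
  choose C hC h using exists_interpolation (M := 2 * d + 1) (by
    have : (0 : ℝ) ≤ d := d.cast_nonneg
    linarith) r
  refine ⟨(r + 1) + ∑ m ∈ Finset.range (r + 1), C m,
    add_nonneg (by positivity) (Finset.sum_nonneg fun m _ => hC m), fun f hf => ?_⟩
  set a : ℕ → ℝ := fun k => ∑ j : Fin k → Fin d, ‖mixedDeriv T j f‖ with ha
  have ha0 : ∀ k, 0 ≤ a k := fun k => by positivity
  have hf0 : a 0 = ‖f‖ := by simp [ha, mixedDeriv]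
  have h1 := fun m => h m a ha0 fun j hj δ hδ =>
    mul_sum_norm_mixedDeriv_le hT j (sobolevSpace_antitone hj hf) hδ
  have h2 : sobolevNorm T r f = ∑ m ∈ Finset.range (r + 1), a (r - m) := by
    rw [sobolevNorm_eq_sum_range, ← Finset.sum_range_reflect]
    rfl
  rw [h2]
  refine (Finset.sum_le_sum fun m _ => h1 m).trans ?_
  rw [Finset.sum_add_distrib, ← Finset.sum_mul, hf0]
  simp only [Finset.sum_const, Finset.card_range, nsmul_eq_mul, Nat.cast_succ]
  have h3 : 0 ≤ ∑ m ∈ Finset.range (r + 1), C m := Finset.sum_nonneg fun m _ => hC m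
  have h4 : 0 ≤ (∑ m ∈ Finset.range (r + 1), C m) * a r := mul_nonneg h3 (ha0 r)
  have h5 : 0 ≤ ((r : ℝ) + 1) * ‖f‖ := by positivity
  show _ ≤ _ * (‖f‖ + a r)
  linarith

end Interpolation

/-! ### Construction of the approximant. -/

section Approximation

variable {𝕜 H : Type*} [RCLike 𝕜] [NormedAddCommGroup H] [InnerProductSpace 𝕜 H] {d : ℕ}

/-- `A` multiplies bounds for differences by at most `c`. -/
def PreservesDifferences (T : Fin d → ℝ → H →L[𝕜] H) (s c : ℝ) (A : H →L[𝕜] H) : Prop :=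
  0 ≤ c ∧ ∀ n b f, 0 ≤ b → DifferenceBound T n s b f → DifferenceBound T n s (c * b) (A f)

namespace PreservesDifferences

variable {T : Fin d → ℝ → H →L[𝕜] H} {s c c' : ℝ} {A A' : H →L[𝕜] H}

theorem one : PreservesDifferences T s 1 (1 : H →L[𝕜] H) :=
  ⟨zero_le_one, fun _ _ _ _ h => by simpa using h⟩

theorem mul (h : PreservesDifferences T s c A) (h' : PreservesDifferences T s c' A') :
    PreservesDifferences T s (c * c') (A * A') :=
  ⟨mul_nonneg h.1 h'.1, fun n b f hb hf => by
    rw [mul_assoc]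
    exact h.2 n _ _ (mul_nonneg h'.1 hb) (h'.2 n b f hb hf)⟩

theorem pow (h : PreservesDifferences T s c A) (k : ℕ) :
    PreservesDifferences T s (c ^ k) (A ^ k) := by
  induction k with
  | zero => simpa using one
  | succ k ih =>
    rw [pow_succ, pow_succ]
    exact ih.mul h

theorem sub (h : PreservesDifferences T s c A) (h' : PreservesDifferences T s c' A') :
    PreservesDifferences T s (c + c') (A - A') :=
  ⟨add_nonneg h.1 h'.1, fun n b f hb hf => by
    rw [add_mul]
    exact (h.2 n b f hb hf).sub (h'.2 n b f hb hf)⟩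

theorem geom_sum (h : PreservesDifferences T s c A) (k : ℕ) :
    PreservesDifferences T s (∑ i ∈ Finset.range k, c ^ i) (∑ i ∈ Finset.range k, A ^ i) := by
  induction k with
  | zero => exact ⟨by simp, fun n b f _ _ w _ _ => by simp⟩
  | succ k ih =>
    rw [Finset.sum_range_succ, Finset.sum_range_succ]
    refine ⟨add_nonneg ih.1 (h.pow k).1, fun n b f hb hf => ?_⟩
    rw [add_mul]
    exact (ih.2 n b f hb hf).add ((h.pow k).2 n b f hb hf)

end PreservesDifferences

theorem differenceBound_zero_iff {T : Fin d → ℝ → H →L[𝕜] H} {s b : ℝ} {f : H} :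
    DifferenceBound T 0 s b f ↔ ‖f‖ ≤ b := by
  constructor
  · intro h
    simpa [differenceOp_nil] using h [] rfl (by simp)
  · intro h w hw _
    rw [List.length_eq_zero_iff.1 hw]
    simpa [differenceOp_nil] using h

variable {T : Fin d → ℝ → H →L[𝕜] H} (hT : ∀ i, IsContractionSemigroup (T i))
  [NormedSpace ℝ H] [IsScalarTower ℝ 𝕜 H] [CompleteSpace H]
  (hinv : ∀ i, ∀ t : ℝ, 0 ≤ t → ∀ f ∈ sobolevSpace T 1, T i t f ∈ sobolevSpace T 1)
  {ζ : Fin d → Fin d → EuclideanSpace ℝ (Fin d) → 𝕜}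
  (hζ1 : ∀ i k, ContDiffOn ℝ 1 (ζ i k) (Metric.ball 0 1))
  (hζ : ∀ i, ∀ f ∈ sobolevSpace T 1, ∀ t ∈ Metric.ball (0 : EuclideanSpace ℝ (Fin d)) 1,
      (∀ k, 0 ≤ t k) → ∃ v : Fin d → H, (∀ k, HasOrbitPartialDeriv T f k t (v k)) ∧
        generator (T i) (orbitMap T f t) = ∑ k, ζ i k t • v k)
  {δ : ℝ} (hδ : 0 < δ) {E C : EuclideanSpace ℝ (Fin d) → Fin d → Fin d → 𝕜}
  (hL : ListCommutesVia T (List.finRange d) δ E C)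
  (hdense : Dense (sobolevSpace T 1))
include hT hinv hζ1 hζ hδ hL hdense

/-- The approximant g = A^r Q₂ f reconciles two demands: the factor A^r supplies r derivatives,
while 1 − A^r Q₂ = (1 − A^r)^r = Q₁(1 − A)^r contains r factors 1 − A, each spending one difference.
-/
theorem exists_approximation (r : ℕ) : ∃ K, 0 ≤ K ∧ ∀ᶠ s in 𝓝[>] (0 : ℝ), ∀ β, 0 ≤ β → ∀ f,
    DifferenceBound T r (2 * s) β f → ∃ g ∈ sobolevSpace T r, ‖f - g‖ ≤ K * β ∧
      ‖g‖ ≤ K * ‖f‖ ∧ s ^ r * ∑ j : Fin r → Fin d, ‖mixedDeriv T j g‖ ≤ K * β := by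
  obtain ⟨κ, b, hκ, -, hκ1⟩ := exists_unit_kernel 𝕜 d
  obtain ⟨K, hK, hev⟩ := exists_derivativeBound_iterate hT hinv hζ1 hζ hδ hL hdense hκ r
  have hb := hκ.nonneg
  have hv0 := kernelVolume_nonneg (d := d)
  set L := List.finRange d with hLd
  set c₁ := kernelVolume d * b * 3 ^ L.length with hc₁
  set c₂ := kernelVolume d * b * 4 ^ L.length with hc₂
  have hc₁0 : 0 ≤ c₁ := by positivity
  have hc₂0 : 0 ≤ c₂ := by positivity
  set q₁ := (∑ i ∈ Finset.range r, c₁ ^ i) ^ r with hq₁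
  set q₂ := ∑ i ∈ Finset.range r, (1 + c₁ ^ r) ^ i with hq₂
  have hq₁0 : 0 ≤ q₁ := by positivity
  have hq₂0 : 0 ≤ q₂ := by positivity
  refine ⟨q₁ * c₂ ^ r + c₁ ^ r * q₂ + d ^ r * (K * q₂), by positivity, ?_⟩
  filter_upwards [hev, self_mem_nhdsWithin] with s hs' hs β hβ f hf
  have hs : (0 : ℝ) < s := hs
  obtain ⟨A, hA⟩ := exists_clm_kernelAverage hT hs L hκ
  have hA' : (A : H → H) = kernelAverage T L s κ := funext hA
  have hpres : PreservesDifferences T (2 * s) c₁ A := ⟨hc₁0, fun n b' f hb' hf => by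
    rw [hA]
    exact (hf.kernelAverage hT hs le_rfl L hb hκ.contDiff.continuous hκ.eq_zero hκ.norm_le).mono
      (le_of_eq (by rw [hc₁]; ring))⟩
  -- Since the kernel has integral one, 1 − A is an average of differences and lowers the order by
  -- one.
  have hsub : ∀ k n f, DifferenceBound T (n + k) (2 * s) β f →
      DifferenceBound T n (2 * s) (c₂ ^ k * β) (((1 - A) ^ k) f) := by
    intro k
    induction k with
    | zero => intro n f h; simpa using h
    | succ k ih =>
      intro n f h
      have h1 := ih (n + 1) f (by rwa [add_right_comm, add_assoc])
      have h2 := h1.kernelAverage_sub_integral hT hs le_rfl L hb hκ.contDiff.continuous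
        hκ.eq_zero hκ.norm_le (by positivity)
      rw [hκ1, one_smul, ← hA] at h2
      have h3 : ((1 - A) ^ (k + 1)) f = -(A (((1 - A) ^ k) f) - ((1 - A) ^ k) f) := by
        rw [pow_succ']
        simp
      rw [h3]
      exact h2.neg.mono (le_of_eq (by rw [hc₂]; ring))
  set Q₁ : H →L[𝕜] H := (∑ i ∈ Finset.range r, A ^ i) ^ r with hQ₁
  set Q₂ : H →L[𝕜] H := ∑ i ∈ Finset.range r, (1 - A ^ r) ^ i with hQ₂
  have hQ₁p : PreservesDifferences T (2 * s) q₁ Q₁ := (hpres.geom_sum r).pow r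
  have hQ₂p : PreservesDifferences T (2 * s) q₂ Q₂ :=
    (PreservesDifferences.one.sub (hpres.pow r)).geom_sum r
  have hid₁ : (1 - A ^ r) ^ r = Q₁ * (1 - A) ^ r := by
    rw [← geom_sum_mul_neg, Commute.mul_pow]
    exact Commute.sub_right (Commute.one_right _)
      (Commute.sum_left _ _ _ fun i _ => (Commute.refl A).pow_left i)
  have hid₂ : A ^ r * Q₂ = 1 - (1 - A ^ r) ^ r := by
    have := mul_neg_geom_sum (1 - A ^ r) r
    rwa [sub_sub_cancel] at this
  have hQf := hQ₂p.2 r β f hβ hf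
  obtain ⟨h1, h2⟩ := hs' 0 (q₂ * β) (by positivity) (Q₂ f) (by simpa using hQf)
  have hiter : (kernelAverage T L s κ)^[r] (Q₂ f) = (A ^ r * Q₂) f := by
    rw [mul_apply_eq_comp, ← hA', FunLike.coe_pow_eq_iterate]
  rw [hiter] at h1 h2
  have e1 : ‖f - (A ^ r * Q₂) f‖ ≤ q₁ * c₂ ^ r * β := by
    have h3 : f - (A ^ r * Q₂) f = Q₁ (((1 - A) ^ r) f) := by
      rw [hid₂, hid₁]
      simp
    rw [h3, mul_assoc]
    exact differenceBound_zero_iff.1 (hQ₁p.2 0 _ _ (by positivity) (hsub r 0 f (by simpa using hf)))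
  have e2 : ‖(A ^ r * Q₂) f‖ ≤ c₁ ^ r * q₂ * ‖f‖ :=
    differenceBound_zero_iff.1 (((hpres.pow r).mul hQ₂p).2 0 _ _ (norm_nonneg f)
      (differenceBound_zero_iff.2 le_rfl))
  have e3 : s ^ r * ∑ j : Fin r → Fin d, ‖mixedDeriv T j ((A ^ r * Q₂) f)‖ ≤
      d ^ r * (K * q₂) * β := by
    refine (mul_le_mul_of_nonneg_left h2.sum_norm_mixedDeriv_le (by positivity)).trans (le_of_eq ?_)
    rw [inv_pow]
    field_simp
  refine ⟨_, h1, e1.trans ?_, e2.trans ?_, e3.trans ?_⟩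
  · gcongr
    have : 0 ≤ c₁ ^ r * q₂ := by positivity
    have : 0 ≤ d ^ r * (K * q₂) := by positivity
    linarith
  · gcongr
    have : 0 ≤ q₁ * c₂ ^ r := by positivity
    have : 0 ≤ d ^ r * (K * q₂) := by positivity
    linarith
  · gcongr
    have : 0 ≤ q₁ * c₂ ^ r := by positivity
    have : 0 ≤ c₁ ^ r * q₂ := by positivity
    linarith

end Approximation

/-! ### The K-functional and the conclusion. -/

section KFunctional

variable {𝕜 H : Type*} [RCLike 𝕜] [NormedAddCommGroup H] [InnerProductSpace 𝕜 H] {d : ℕ}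
  {T : Fin d → ℝ → H →L[𝕜] H}

theorem kFunctional_le {r : ℕ} {u : ℝ} (hu : 0 ≤ u) (f : H) {g : H} (hg : g ∈ sobolevSpace T r) :
    kFunctional T r u f ≤ ‖f - g‖ + u * sobolevNorm T r g := by
  refine ciInf_le (f := fun g : sobolevSpace T r => ‖f - (g : H)‖ + u * sobolevNorm T r (g : H))
    ⟨0, ?_⟩ ⟨g, hg⟩
  rintro _ ⟨g, rfl⟩
  exact add_nonneg (norm_nonneg _) (mul_nonneg hu (sobolevNorm_nonneg _ _))

theorem mixedModulus_nonneg (r : ℕ) (s : ℝ) (f : H) : 0 ≤ mixedModulus T r s f :=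
  Finset.sum_nonneg fun _ _ => Real.iSup_nonneg fun _ => norm_nonneg _

/-- Differences with small steps are small. -/
theorem eventually_differenceBound (hT : ∀ i, IsContractionSemigroup (T i)) (r : ℕ) (f : H) {β : ℝ}
    (hβ : 0 < β) : ∀ᶠ s in 𝓝[>] (0 : ℝ), DifferenceBound T (r + 1) (2 * s) β f := by
  induction r generalizing β with
  | zero =>
    choose τ hτ h using fun a => (hT a).eventually_norm_orbit_sub_le f hβ
    have hev : ∀ᶠ s in 𝓝[>] (0 : ℝ), ∀ a, s * 2 ≤ τ a :=
      eventually_all.2 fun a => eventually_mul_le 2 (hτ a)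
    filter_upwards [hev] with s hs w hw hws
    obtain ⟨p, rfl⟩ := List.length_eq_one_iff.1 hw
    rw [differenceOp_cons, differenceOp_nil]
    have hp := hws p List.mem_cons_self
    exact h p.1 p.2 hp.1 (hp.2.trans (by linarith [hs p.1]))
  | succ r ih =>
    filter_upwards [ih (half_pos hβ)] with s hs
    exact (hs.succ hT).mono (by linarith)

end KFunctional

theorem theorem3p3 {𝕜 H : Type*} [RCLike 𝕜] [NormedAddCommGroup H] [InnerProductSpace 𝕜 H]
    [CompleteSpace H] {d : ℕ} (T : Fin d → ℝ → H →L[𝕜] H)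
    (hT : ∀ i, IsContractionSemigroup (T i))
    (hdense : Dense (sobolevSpace T 1))
    (hinv : ∀ i, ∀ t : ℝ, 0 ≤ t → ∀ f ∈ sobolevSpace T 1, T i t f ∈ sobolevSpace T 1)
    (hstruct : SatisfiesStructureIdentity T)
    (r : ℕ) (hr : 1 ≤ r) :
    ∃ c C : ℝ, 0 < c ∧ 0 < C ∧ ∀ (f : H) (s : ℝ), 0 ≤ s →
      c * mixedModulus T r s f ≤ kFunctional T r (s ^ r) f ∧
      kFunctional T r (s ^ r) f ≤ C * (mixedModulus T r s f + s ^ r * ‖f‖) := by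
  -- The calculus in a real time variable uses the real structure underlying the 𝕜-structure.
  let _ : NormedSpace ℝ H := NormedSpace.restrictScalars ℝ 𝕜 H
  have : IsScalarTower ℝ 𝕜 H := IsScalarTower.of_algebraMap_smul fun _ _ => rfl
  obtain ⟨ζ, hsmooth, hζ⟩ := hstruct
  have hζ1 : ∀ i k, ContDiffOn ℝ 1 (ζ i k) (Metric.ball 0 1) := fun i k =>
    (hsmooth i k).of_le (by norm_cast)
  obtain ⟨δ, hδ, hcomm⟩ := exists_commutesVia hT hinv hζ1 hζ
  obtain ⟨A, hA, hlower⟩ := exists_mixedModulus_le hT hδ hcomm hinv r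
  obtain ⟨E, D, hL⟩ := exists_listCommutesVia hT hinv (List.finRange d) fun m _ => hcomm m
  obtain ⟨B, hB, happrox⟩ := exists_approximation hT hinv hζ1 hζ hδ hL hdense r
  obtain ⟨N, hN, hnorm⟩ := exists_sobolevNorm_le hT r
  obtain ⟨s₀, hs₀, hs₀'⟩ := mem_nhdsGT_iff_exists_Ioo_subset.1 happrox
  have hs₀ : (0 : ℝ) < s₀ := hs₀
  -- the upper bound for small `s`
  have hsmall : ∀ s, 0 < s → s < 2 * s₀ → ∀ f, kFunctional T r (s ^ r) f ≤
      (B + N * B * 2 ^ r + N * B) * (mixedModulus T r s f + s ^ r * ‖f‖) := by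
    intro s hs hss f
    set Ω := mixedModulus T r s f with hΩ
    have hΩ0 : 0 ≤ Ω := mixedModulus_nonneg r s f
    -- Averages at scale σ use times up to 2σ, so the approximant is taken at scale s/2.
    have hdb : DifferenceBound T r (2 * (s / 2)) Ω f := by
      rw [mul_div_cancel₀ s two_ne_zero]
      exact differenceBound_mixedModulus hT f
    obtain ⟨g, hg, h1, h2, h3⟩ := hs₀' (show s / 2 ∈ Set.Ioo 0 s₀ by constructor <;> linarith)
      Ω hΩ0 f hdb
    refine (kFunctional_le (by positivity) f hg).trans ?_
    have h4 : s ^ r * ∑ j : Fin r → Fin d, ‖mixedDeriv T j g‖ ≤ 2 ^ r * (B * Ω) := by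
      calc _ = 2 ^ r * ((s / 2) ^ r * ∑ j : Fin r → Fin d, ‖mixedDeriv T j g‖) := by
            rw [div_pow]; field_simp
        _ ≤ _ := by gcongr
    have h5 : s ^ r * sobolevNorm T r g ≤ N * (s ^ r * (B * ‖f‖) + 2 ^ r * (B * Ω)) := by
      calc s ^ r * sobolevNorm T r g
          ≤ s ^ r * (N * (‖g‖ + ∑ j : Fin r → Fin d, ‖mixedDeriv T j g‖)) := by
            gcongr; exact hnorm g hg
        _ = N * (s ^ r * ‖g‖ + s ^ r * ∑ j : Fin r → Fin d, ‖mixedDeriv T j g‖) := by ring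
        _ ≤ _ := by gcongr
    have h6 : 0 ≤ (B + N * B * 2 ^ r) * (s ^ r * ‖f‖) := by positivity
    have h7 : 0 ≤ N * B * Ω := by positivity
    linarith
  -- at `s = 0` the K-functional vanishes
  have hzero : ∀ f, kFunctional T r 0 f ≤ 0 := by
    intro f
    refine le_of_forall_pos_le_add fun ε hε => ?_
    -- At least one difference is needed: by strong continuity it is small for short steps, so
    -- approximants in H^r come arbitrarily close to f.
    obtain ⟨k, rfl⟩ : ∃ k, r = k + 1 := ⟨r - 1, by omega⟩
    have hpos : 0 < B + 1 := by linarith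
    obtain ⟨σ, hσ1, hσ2⟩ := (happrox.and
      (eventually_differenceBound hT k f (div_pos hε hpos))).exists
    obtain ⟨g, hg, h1, -, -⟩ := hσ1 _ (by positivity) f hσ2
    refine (kFunctional_le le_rfl f hg).trans ?_
    rw [zero_mul, add_zero, zero_add]
    refine h1.trans ?_
    rw [mul_div_assoc', div_le_iff₀ hpos]
    nlinarith
  -- A + 1 avoids division by zero. The last summand of C serves s ≥ 2s₀, where g = 0 is a good
  -- enough competitor and ‖f‖ ≤ (s/(2s₀))^r ‖f‖.
  refine ⟨1 / (A + 1), (B + N * B * 2 ^ r + N * B) + ((2 * s₀)⁻¹) ^ r, by positivity,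
    by positivity, fun f s hs => ⟨?_, ?_⟩⟩
  · have : Nonempty (sobolevSpace T r) := ⟨⟨0, zero_mem_sobolevSpace r⟩⟩
    refine le_ciInf fun g => ?_
    have h1 := hlower s hs f g g.2
    have h2 : 0 ≤ ‖f - (g : H)‖ + s ^ r * sobolevNorm T r (g : H) :=
      add_nonneg (norm_nonneg _) (mul_nonneg (by positivity) (sobolevNorm_nonneg _ _))
    rw [one_div_mul_eq_div, div_le_iff₀ (by positivity)]
    linarith
  · have hΩ0 : 0 ≤ mixedModulus T r s f := mixedModulus_nonneg r s f
    have hsum : 0 ≤ mixedModulus T r s f + s ^ r * ‖f‖ := by positivity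
    have hC0 : 0 ≤ (B + N * B * 2 ^ r + N * B) * (mixedModulus T r s f + s ^ r * ‖f‖) := by
      positivity
    rw [add_mul]
    rcases hs.eq_or_lt with rfl | hs
    · rw [zero_pow (by omega)] at *
      refine (hzero f).trans (by positivity)
    · rcases lt_or_ge s (2 * s₀) with hss | hss
      · exact (hsmall s hs hss f).trans (le_add_of_nonneg_right (by positivity))
      · have h1 : kFunctional T r (s ^ r) f ≤ ‖f‖ := by
          have := kFunctional_le (r := r) (T := T) (u := s ^ r) (by positivity) f
            (zero_mem_sobolevSpace r)
          have h0 : sobolevNorm T r (0 : H) = 0 := by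
            simpa using sobolevNorm_smul (0 : 𝕜) (zero_mem_sobolevSpace (T := T) r)
          simpa [h0] using this
        have h2 : 1 ≤ ((2 * s₀)⁻¹) ^ r * s ^ r := by
          rw [← mul_pow]
          refine one_le_pow₀ ?_
          rw [inv_mul_eq_div, one_le_div (by positivity)]
          exact hss
        have h3 : ‖f‖ ≤ ((2 * s₀)⁻¹) ^ r * (s ^ r * ‖f‖) := by
          rw [← mul_assoc]
          exact le_mul_of_one_le_left (norm_nonneg f) h2
        have h4 : 0 ≤ ((2 * s₀)⁻¹) ^ r * mixedModulus T r s f := by positivity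
        linarith
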